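/- Let $n\ge 2$ and $1\le d\le n$ be integers. A variable $x_i$ is relevant in a function $f:\{0,1\}^n\to\{0,1\}$ if changing $x_i$ alone changes the value of $f$ at some assignment, and $d$-Junta is the class of all $f:\{0,1\}^n\to\{0,1\}$ with at most $d$ relevant variables. There is a deterministic non-adaptive algorithm that learns $d$-Junta exactly from membership queries in time $n^{O(d)}$ with $O(d2^d\log n)$ queries. That is, there are a single deterministic algorithm and a constant $c$ such that for all such $n$ and $d$ the algorithm, given $n$ and $d$, first computes a list of at most $c\,d2^d\log n$ assignments in $\{0,1\}^n$, then receives the values on them of an unknown $f$ in $d$-Junta, and outputs $f$ (its relevant variables and its truth table on them), in total time at most $n^{cd}$, where time is the number of steps of a unit-cost random access machine with addition and subtraction, and asking a query takes $n$ steps. -/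

import Mathlib

namespace JuntaLearning

/-! ### Boolean functions and juntas -/

/-- Assignments (= membership queries) on `n` variables. The variables are indexed by
`0, …, n - 1`. -/
abbrev Assignment (n : ℕ) : Type := Fin n → Bool

/-- Boolean functions on `n` variables. -/
abbrev BoolFun (n : ℕ) : Type := Assignment n → Bool

/-- The variable `i` is relevant in `f`: changing it alone changes the value of `f` at some
assignment. -/
def Relevant {n : ℕ} (f : BoolFun n) (i : Fin n) : Prop :=
  ∃ a : Assignment n, f (Function.update a i false) ≠ f (Function.update a i true)

/-- The class `d`-Junta: the boolean functions on `n` variables with at most `d` relevant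
variables. -/
def Junta (n d : ℕ) : Set (BoolFun n) :=
  {f | {i : Fin n | Relevant f i}.ncard ≤ d}

/-! ### The machine model

A deterministic random access machine with unit cost, presented through structured programs. It
has number registers and number arrays (a program mentions only finitely many of each). Its
arithmetic consists of addition and truncated subtraction; there is no multiplication, so that a
computation of `t` steps only handles numbers with `O(t)` more bits than its input. -/

/-- Programs; registers and arrays are named by natural numbers. -/
inductive Prog : Type
  /-- `x := c` -/
  | const (x c : ℕ) : Prog
  /-- `x := y + z` -/
  | add (x y z : ℕ) : Prog
  /-- `x := max (y - z) 0` -/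
  | sub (x y z : ℕ) : Prog
  /-- `x := a[y]` -/
  | load (x a y : ℕ) : Prog
  /-- `a[y] := x` -/
  | store (a y x : ℕ) : Prog
  /-- `p; q` -/
  | seq (p q : Prog) : Prog
  /-- `if x ≠ 0 then p else q` -/
  | ite (x : ℕ) (p q : Prog) : Prog
  /-- `while x ≠ 0 do p` -/
  | loop (x : ℕ) (p : Prog) : Prog

/-- Memory contents: `reg x` is the content of register `x`, and `arr a j` the content of cell `j`
of array `a`. -/
structure Memory : Type where
  reg : ℕ → ℕ
  arr : ℕ → ℕ → ℕ

/-- Write `v` into register `x`. -/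
def Memory.setReg (s : Memory) (x v : ℕ) : Memory :=
  { s with reg := Function.update s.reg x v }

/-- Write `v` into cell `j` of array `a`. -/
def Memory.setCell (s : Memory) (a j v : ℕ) : Memory :=
  { s with arr := Function.update s.arr a (Function.update (s.arr a) j v) }

/-- `Exec p s t s'`: started on memory `s`, the program `p` halts after exactly `t` steps with
memory `s'`. Every elementary instruction and every evaluation of a test is one step. -/
inductive Exec : Prog → Memory → ℕ → Memory → Prop
  | const (s : Memory) (x c : ℕ) : Exec (.const x c) s 1 (s.setReg x c)
  | add (s : Memory) (x y z : ℕ) : Exec (.add x y z) s 1 (s.setReg x (s.reg y + s.reg z))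
  | sub (s : Memory) (x y z : ℕ) : Exec (.sub x y z) s 1 (s.setReg x (s.reg y - s.reg z))
  | load (s : Memory) (x a y : ℕ) : Exec (.load x a y) s 1 (s.setReg x (s.arr a (s.reg y)))
  | store (s : Memory) (a y x : ℕ) : Exec (.store a y x) s 1 (s.setCell a (s.reg y) (s.reg x))
  | seq {p q : Prog} {s s₁ s₂ : Memory} {t₁ t₂ : ℕ} :
      Exec p s t₁ s₁ → Exec q s₁ t₂ s₂ → Exec (.seq p q) s (t₁ + t₂) s₂
  | iteTrue {x : ℕ} {p : Prog} (q : Prog) {s s₁ : Memory} {t : ℕ} :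
      s.reg x ≠ 0 → Exec p s t s₁ → Exec (.ite x p q) s (t + 1) s₁
  | iteFalse {x : ℕ} (p : Prog) {q : Prog} {s s₁ : Memory} {t : ℕ} :
      s.reg x = 0 → Exec q s t s₁ → Exec (.ite x p q) s (t + 1) s₁
  | loopStop {x : ℕ} (p : Prog) {s : Memory} :
      s.reg x = 0 → Exec (.loop x p) s 1 s
  | loopStep {x : ℕ} {p : Prog} {s s₁ s₂ : Memory} {t₁ t₂ : ℕ} :
      s.reg x ≠ 0 → Exec p s t₁ s₁ → Exec (.loop x p) s₁ t₂ s₂ →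
      Exec (.loop x p) s (t₁ + t₂ + 1) s₂

/-- The machine is deterministic: the final memory and the number of steps are determined by the
program and the initial memory. -/
theorem Exec.deterministic {p : Prog} {s s₁ s₂ : Memory} {t₁ t₂ : ℕ}
    (h₁ : Exec p s t₁ s₁) (h₂ : Exec p s t₂ s₂) : t₁ = t₂ ∧ s₁ = s₂ := by
  induction h₁ generalizing t₂ s₂ with
  | const | add | sub | load | store => cases h₂; exact ⟨rfl, rfl⟩
  | seq _ _ ihp ihq =>
    cases h₂ with
    | seq hp hq =>
      obtain ⟨rfl, rfl⟩ := ihp hp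
      obtain ⟨rfl, rfl⟩ := ihq hq
      exact ⟨rfl, rfl⟩
  | iteTrue _ hx _ ih =>
    cases h₂ with
    | iteTrue _ _ hp => obtain ⟨rfl, rfl⟩ := ih hp; exact ⟨rfl, rfl⟩
    | iteFalse _ hx' _ => exact absurd hx' hx
  | iteFalse _ hx _ ih =>
    cases h₂ with
    | iteTrue _ hx' _ => exact absurd hx hx'
    | iteFalse _ _ hq => obtain ⟨rfl, rfl⟩ := ih hq; exact ⟨rfl, rfl⟩
  | loopStop _ hx =>
    cases h₂ with
    | loopStop => exact ⟨rfl, rfl⟩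
    | loopStep hx' _ _ => exact absurd hx hx'
  | loopStep hx _ _ ihp ihq =>
    cases h₂ with
    | loopStop _ hx' => exact absurd hx' hx
    | loopStep _ hp hq =>
      obtain ⟨rfl, rfl⟩ := ihp hp
      obtain ⟨rfl, rfl⟩ := ihq hq
      exact ⟨rfl, rfl⟩

/-! ### Deterministic non-adaptive learning algorithms -/

/-- A deterministic non-adaptive learning algorithm, one for all `n` and `d`. The program `ask`
writes down the whole list of queries; only then are the queries answered, all at once, and the
program `infer` continues on the same memory. -/
structure NonadaptiveAlgorithm : Type where
  ask : Prog
  infer : Prog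

/-- The initial memory: `n` in register 0, `d` in register 1, and 0 everywhere else. -/
def Memory.init (n d : ℕ) : Memory where
  reg := fun x => if x = 0 then n else if x = 1 then d else 0
  arr := fun _ _ => 0

/-- The number of queries that have been written down, in register 2. -/
def Memory.numQueries (s : Memory) : ℕ := s.reg 2

/-- The `q`-th query, in the cells `q * n, …, q * n + (n - 1)` of array 0 (a cell stands for
the value 1 if its content is nonzero). -/
def Memory.query (s : Memory) (n q : ℕ) : Assignment n :=
  fun i => decide (s.arr 0 (q * n + i) ≠ 0)

/-- Receive the answers of the target `f` to the queries that have been written down; they are put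
into array 1. -/
def Memory.withAnswers {n : ℕ} (s : Memory) (f : BoolFun n) : Memory :=
  let answers : ℕ → ℕ := fun q => if q < s.numQueries then (f (s.query n q)).toNat else 0
  { s with arr := Function.update s.arr 1 answers }

/-- The final memory describes `f` by its relevant variables and its truth table on them. Register
3 holds the number `k` of relevant variables, the cells `0, …, k - 1` of array 2 hold the
relevant variables `v₀ < ⋯ < vₖ₋₁`, and the value of `f` at `a` is in the cell of array 3
whose index has the binary digits `a v₀, …, a vₖ₋₁` (lowest digit first). -/
def Memory.Describes {n : ℕ} (s : Memory) (f : BoolFun n) : Prop :=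
  ∃ v : Fin (s.reg 3) → Fin n,
    StrictMono v ∧
    Set.range v = {i | Relevant f i} ∧
    (∀ j : Fin (s.reg 3), s.arr 2 j = (v j : ℕ)) ∧
    ∀ a : Assignment n, s.arr 3 (∑ j : Fin (s.reg 3), (a (v j)).toNat * 2 ^ (j : ℕ)) = (f a).toNat

/-- Given `n` and `d`, and with membership queries to the target `f`, the algorithm `A` asks at
most `m` queries, halts within `T` steps and outputs `f`. Asking one query takes `n` steps. -/
def NonadaptiveAlgorithm.Learns (A : NonadaptiveAlgorithm) (n d : ℕ) (f : BoolFun n)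
    (m T : ℕ) : Prop :=
  ∃ (t₁ t₂ : ℕ) (s₁ s₂ : Memory),
    Exec A.ask (Memory.init n d) t₁ s₁ ∧
    Exec A.infer (s₁.withAnswers f) t₂ s₂ ∧
    s₂.Describes f ∧
    s₁.numQueries ≤ m ∧
    t₁ + s₁.numQueries * n + t₂ ≤ T

end JuntaLearning

/-! It suffices to find queries on which no two distinct juntas agree. For tuples `s`, `t` of `d`
variables take the bipartite graph on two copies of the bit vectors of length `d` in which every
assignment `x` is an edge from `x ∘ s` to `x ∘ t`. A function of the variables of `s` labels the
left copy, and one of those of `t` the right copy. If they agree on the queries, the joint labelling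
is constant on the components formed by the edges of the queries. So if, for all `s` and `t`, the
queries form the same components as all assignments do, then the two functions are equal
(`eq_of_agree_on_queries`). The potential `totalExcess` counts the surplus components over all pairs
of tuples.

Queries are chosen greedily. An overlay for bit vectors `u`, `v` gives each variable the parity of
the bits at the positions that list it, so over uniform `u`, `v` the listed variables are
independent uniform bits. Fix `u` and `v`: the overlays in which only one of the two vectors is
varied already connect whatever all assignments connect (`overlay_determining`), so at least `excess
s t Q` of these `2 * 2 ^ d` overlays join different components. Averaging over `u` and `v`, a random
overlay does so with probability at least the excess divided by `2 * 2 ^ d`. Restricted to the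
listed variables the overlay is a uniform assignment, and the other variables do not affect the
edge. Hence one assignment serves all pairs on average, and the method of conditional expectations
finds it bit by bit: `estimate` is the mean of its values for the two choices of the next bit
(`estimate_succ`). Each query thus multiplies the potential by at most `1 - 1 / (2 * 2 ^ d)`. The
potential starts below `n ^ (4 * d)`, so it vanishes after `O(d * 2 ^ d * log n)` queries.

From the answers, call a tuple consistent if no two queries that agree on it have different answers.
A consistent tuple yields a junta that agrees with the target on all queries, hence equals it. So
the relevant variables are those that every consistent tuple lists (`relevant_iff`), and the value
at a point is read off a query that agrees with it on them (`eq_true_iff_exists_query`).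

For the time, the algorithm is written in a language whose loops are cut off at the content `N` of
register 4 and which compiles to the machine with cost polynomial in `N`. The cut-off is `n` while
powers are computed and `loopBound n d`, that is `n ^ (4 * d)`, afterwards. -/

namespace JuntaLearning

/-! ### A structured language that compiles to the machine

All loops of the language are cut off at the content of register 4, so that its programs run in
time polynomial in that number. -/

/-- Expressions. `sum x b e` is the sum of `e` over the values of register `x` below `b`, cut off at
the content of register 4. -/
inductive Expr : Type
  | const (c : ℕ) : Expr
  | reg (x : ℕ) : Expr
  | add (a b : Expr) : Expr
  | sub (a b : Expr) : Expr
  | load (a : ℕ) (e : Expr) : Expr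
  | ite (c a b : Expr) : Expr
  | sum (x : ℕ) (b e : Expr) : Expr

namespace Expr

/-- The value of an expression. -/
def eval : Expr → Memory → ℕ
  | const c, _ => c
  | reg x, s => s.reg x
  | add a b, s => a.eval s + b.eval s
  | sub a b, s => a.eval s - b.eval s
  | load a e, s => s.arr a (e.eval s)
  | ite c a b, s => if c.eval s ≠ 0 then a.eval s else b.eval s
  | sum x b e, s => ∑ i ∈ Finset.range (min (b.eval s) (s.reg 4)), e.eval (s.setReg x i)

/-- All registers of the expression are below `k`, and it does not bind register 4. -/
def wf (k : ℕ) : Expr → Bool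
  | const _ => true
  | reg x => Nat.blt x k
  | add a b => a.wf k && b.wf k
  | sub a b => a.wf k && b.wf k
  | load _ e => e.wf k
  | ite c a b => c.wf k && (a.wf k && b.wf k)
  | sum x b e => Nat.blt x k && !decide (x = 4) && (b.wf k && e.wf k)

/-- The program that puts the value into register `k` and uses the registers from `k` on as scratch
space. -/
def compile : Expr → ℕ → Prog
  | const c, k => .const k c
  | reg x, k => .seq (.const k 0) (.add k x k)
  | add a b, k => .seq (a.compile k) (.seq (b.compile (k + 1)) (.add k k (k + 1)))
  | sub a b, k => .seq (a.compile k) (.seq (b.compile (k + 1)) (.sub k k (k + 1)))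
  | load a e, k => .seq (e.compile k) (.load k a k)
  | ite c a b, k => .seq (c.compile k) (.ite k (a.compile k) (b.compile k))
  | sum x b e, k =>
    .seq (b.compile k) <| .seq (.sub (k + 1) k 4) <| .seq (.sub k k (k + 1)) <|
    .seq (.const (k + 1) 0) <| .seq (.add (k + 1) x (k + 1)) <| .seq (.const (k + 2) 0) <|
    .seq (.loop k <| .seq (.const (k + 3) 1) <| .seq (.sub k k (k + 3)) <|
      .seq (.const (k + 3) 0) <| .seq (.add x k (k + 3)) <| .seq (e.compile (k + 3)) <|
      .add (k + 2) (k + 2) (k + 3)) <|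
    .seq (.add x (k + 1) k) (.add k (k + 2) k)

/-- A bound on the time of the compiled expression when register 4 contains `N`. -/
def cost (N : ℕ) : Expr → ℕ
  | const _ => 1
  | reg _ => 2
  | add a b => a.cost N + b.cost N + 1
  | sub a b => a.cost N + b.cost N + 1
  | load _ e => e.cost N + 1
  | ite c a b => c.cost N + (a.cost N + b.cost N + 1)
  | sum _ b e => b.cost N + N * (e.cost N + 6) + 8

end Expr

/-- The memories agree on the arrays and on the registers below `k`. -/
def Memory.Agree (k : ℕ) (s s' : Memory) : Prop :=
  s.arr = s'.arr ∧ ∀ x < k, s.reg x = s'.reg x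

/-! ### Memories that agree up to scratch registers. -/

namespace Memory

@[simp] theorem setReg_arr (s : Memory) (x v : ℕ) : (s.setReg x v).arr = s.arr := rfl

theorem setReg_reg (s : Memory) (x v y : ℕ) :
    (s.setReg x v).reg y = if y = x then v else s.reg y := by
  simp [setReg, Function.update_apply]

@[simp] theorem setCell_reg (s : Memory) (a j v : ℕ) : (s.setCell a j v).reg = s.reg := rfl

theorem setCell_arr (s : Memory) (a j v b i : ℕ) :
    (s.setCell a j v).arr b i = if b = a ∧ i = j then v else s.arr b i := by
  by_cases hb : b = a
  · subst hb; simp [setCell, Function.update_apply]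
  · simp [setCell, hb]

theorem Agree.refl (k : ℕ) (s : Memory) : Agree k s s := ⟨rfl, fun _ _ => rfl⟩

theorem Agree.trans {k : ℕ} {s s' s'' : Memory} (h : Agree k s s') (h' : Agree k s' s'') :
    Agree k s s'' := ⟨h.1.trans h'.1, fun x hx => (h.2 x hx).trans (h'.2 x hx)⟩

theorem Agree.symm {k : ℕ} {s s' : Memory} (h : Agree k s s') : Agree k s' s :=
  ⟨h.1.symm, fun x hx => (h.2 x hx).symm⟩

theorem Agree.mono {k l : ℕ} {s s' : Memory} (h : Agree l s s') (hk : k ≤ l) : Agree k s s' :=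
  ⟨h.1, fun x hx => h.2 x (hx.trans_le hk)⟩

theorem Agree.setReg {k : ℕ} {s s' : Memory} (h : Agree k s s') (x v : ℕ) :
    Agree k (s.setReg x v) (s'.setReg x v) :=
  ⟨h.1, fun y hy => by simp [setReg_reg, h.2 y hy]⟩

theorem Agree.setReg_left {k x : ℕ} {s s' : Memory} (h : Agree k s s') (hx : k ≤ x) (v : ℕ) :
    Agree k (s.setReg x v) s' :=
  ⟨h.1, fun y hy => by simp [setReg_reg, h.2 y hy, (hy.trans_le hx).ne]⟩

theorem Agree.setCell {k : ℕ} {s s' : Memory} (h : Agree k s s') (a j v : ℕ) :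
    Agree k (s.setCell a j v) (s'.setCell a j v) :=
  ⟨by simp [Memory.setCell, h.1], h.2⟩

end Memory

open Memory

/-- Bounded by a polynomial. -/
def PolyBounded (f : ℕ → ℕ) : Prop := ∃ C, ∀ N, f N ≤ (N + 2) ^ C

theorem PolyBounded.const (c : ℕ) : PolyBounded fun _ => c :=
  ⟨c, fun N => c.lt_two_pow_self.le.trans (Nat.pow_le_pow_left (by omega) c)⟩

theorem PolyBounded.id : PolyBounded fun N => N := ⟨1, fun N => by simp⟩

theorem PolyBounded.mul {f g : ℕ → ℕ} : PolyBounded f → PolyBounded g →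
    PolyBounded fun N => f N * g N := by
  rintro ⟨C, hC⟩ ⟨D, hD⟩
  exact ⟨C + D, fun N => by rw [pow_add]; exact Nat.mul_le_mul (hC N) (hD N)⟩

theorem PolyBounded.add {f g : ℕ → ℕ} : PolyBounded f → PolyBounded g →
    PolyBounded fun N => f N + g N := by
  rintro ⟨C, hC⟩ ⟨D, hD⟩
  -- One extra factor `N + 2 ≥ 2` absorbs the sum of two terms.
  refine ⟨max C D + 1, fun N => ?_⟩
  have h1 := (hC N).trans (Nat.pow_le_pow_right (show 0 < N + 2 by omega) (le_max_left C D))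
  have h2 := (hD N).trans (Nat.pow_le_pow_right (show 0 < N + 2 by omega) (le_max_right C D))
  rw [pow_succ]
  nlinarith [Nat.zero_le (N * (N + 2) ^ max C D)]

/-! ### Correctness and cost of compiled expressions. -/

namespace Expr

theorem wf_mono {k l : ℕ} (hkl : k ≤ l) : ∀ {e : Expr}, e.wf k = true → e.wf l = true := by
  intro e
  induction e with
  | const => simp [wf]
  | reg x => simp only [wf, Nat.blt_eq]; omega
  | add a b iha ihb => simp only [wf, Bool.and_eq_true]; exact fun h => ⟨iha h.1, ihb h.2⟩
  | sub a b iha ihb => simp only [wf, Bool.and_eq_true]; exact fun h => ⟨iha h.1, ihb h.2⟩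
  | load a e ih => exact ih
  | ite c a b ihc iha ihb =>
    simp only [wf, Bool.and_eq_true]; exact fun h => ⟨ihc h.1, iha h.2.1, ihb h.2.2⟩
  | sum x b e ihb ihe =>
    simp only [wf, Bool.and_eq_true, Nat.blt_eq]
    exact fun h => ⟨⟨by omega, h.1.2⟩, ihb h.2.1, ihe h.2.2⟩

/-- Whatever compiled code leaves in the scratch registers is invisible to the expression. The
condition `4 < k` is there because every `sum` reads its cut-off from register 4. -/
theorem eval_congr {k : ℕ} (hk : 4 < k) {e : Expr} :
    ∀ {s s' : Memory}, e.wf k = true → Agree k s s' → e.eval s = e.eval s' := by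
  induction e with
  | const => simp [eval]
  | reg x => intro s s' h hs; simp only [wf, Nat.blt_eq] at h; exact hs.2 x h
  | add a b iha ihb =>
    intro s s' h hs; simp only [wf, Bool.and_eq_true] at h
    simp only [eval, iha h.1 hs, ihb h.2 hs]
  | sub a b iha ihb =>
    intro s s' h hs; simp only [wf, Bool.and_eq_true] at h
    simp only [eval, iha h.1 hs, ihb h.2 hs]
  | load a e ih => intro s s' h hs; simp only [eval, ih h hs, hs.1]
  | ite c a b ihc iha ihb =>
    intro s s' h hs; simp only [wf, Bool.and_eq_true] at h
    simp only [eval, ihc h.1 hs, iha h.2.1 hs, ihb h.2.2 hs]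
  | sum x b e ihb ihe =>
    intro s s' h hs; simp only [wf, Bool.and_eq_true, Nat.blt_eq] at h
    simp only [eval, ihb h.2.1 hs, hs.2 4 hk]
    exact Finset.sum_congr rfl fun i _ => ihe h.2.2 (hs.setReg x i)

/-- The loop of a compiled sum. -/
theorem exec_sum_loop {x k N : ℕ} {e : Expr} (hk : 4 < k) (hx : x < k) (hx4 : x ≠ 4)
    (he : e.wf k = true)
    (ih : ∀ s : Memory, s.reg 4 = N → ∃ t s', Exec (e.compile (k + 3)) s t s' ∧
      Agree (k + 3) s' s ∧ s'.reg (k + 3) = e.eval s ∧ t ≤ e.cost N) (s₀ : Memory)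
    (m : ℕ) : ∀ s : Memory, s.reg 4 = N → s.reg k = m → s.arr = s₀.arr →
      (∀ y < k, y ≠ x → s.reg y = s₀.reg y) →
      ∃ t s', Exec (.loop k <| .seq (.const (k + 3) 1) <| .seq (.sub k k (k + 3)) <|
        .seq (.const (k + 3) 0) <| .seq (.add x k (k + 3)) <| .seq (e.compile (k + 3)) <|
        .add (k + 2) (k + 2) (k + 3)) s t s' ∧ s'.arr = s₀.arr ∧
        (∀ y < k, y ≠ x → s'.reg y = s₀.reg y) ∧ s'.reg k = 0 ∧
        s'.reg (k + 1) = s.reg (k + 1) ∧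
        s'.reg (k + 2) = s.reg (k + 2) + ∑ i ∈ Finset.range m, e.eval (s₀.setReg x i) ∧
        t ≤ m * (e.cost N + 6) + 1 := by
  induction m with
  | zero =>
    intro s _ h0 ha hr
    exact ⟨_, _, .loopStop _ h0, ha, hr, h0, rfl, by simp, by simp⟩
  | succ m ihm =>
    intro s h4 hm ha hr
    -- The loop counts down, so this round evaluates the last summand, at index `m`.
    obtain ⟨t, s', hs', hag, hv, ht⟩ := ih
      ((((s.setReg (k + 3) 1).setReg k m).setReg (k + 3) 0).setReg x m)
      (by simp [setReg_reg, show (4 : ℕ) ≠ k + 3 by omega, hk.ne, hx4.symm, h4])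
    obtain ⟨t₂, s₂, hs₂, h1, h2, h3, h4', h5, h6⟩ := ihm
      (s'.setReg (k + 2) (s'.reg (k + 2) + s'.reg (k + 3)))
      (by simp [setReg_reg, show (4 : ℕ) ≠ k + 2 by omega, hag.2 4 (by omega), hk.ne, hx4.symm,
            show (4 : ℕ) ≠ k + 3 by omega, h4])
      (by simp [setReg_reg, hag.2 k (by omega), hx.ne'])
      (by simp [hag.1, ha])
      (fun y hy hyx => by
        simp [setReg_reg, hag.2 y (by omega), show y ≠ k + 3 by omega, show y ≠ k + 2 by omega, hyx,
          show y ≠ k by omega, hr y hy hyx])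
    -- The value left in register `x` by earlier rounds is overwritten before `e` is evaluated.
    have hev : e.eval ((((s.setReg (k + 3) 1).setReg k m).setReg (k + 3) 0).setReg x m) =
        e.eval (s₀.setReg x m) := by
      refine eval_congr hk he ⟨ha, fun y hy => ?_⟩
      by_cases hyx : y = x
      · simp [setReg_reg, hyx]
      · simp [setReg_reg, hyx, show y ≠ k + 3 by omega, show y ≠ k by omega, hr y hy hyx]
    refine ⟨_, s₂, .loopStep (by omega) (.seq (.const ..) (.seq (.sub ..) (.seq (.const ..)
      (.seq (.add ..) (.seq (t₁ := t) (s₁ := s') ?_ (.add ..)))))) hs₂, h1, h2, h3, ?_, ?_, ?_⟩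
    · have : ((s.setReg (k + 3) 1).reg k - (s.setReg (k + 3) 1).reg (k + 3)) = m := by
        simp [setReg_reg, hm]
      rw [this]
      simpa [setReg_reg] using hs'
    · rw [h4']
      simp [setReg_reg, hag.2 (k + 1) (by omega), show k + 1 ≠ x by omega]
    · rw [h5, Finset.sum_range_succ, setReg_reg, if_pos rfl, hag.2 (k + 2) (by omega), hv, hev]
      simp [setReg_reg, show k + 2 ≠ x by omega]
      ring
    · rw [Nat.succ_mul]
      omega

/-- The compiled expression computes the value. -/
theorem exec_compile {N : ℕ} (e : Expr) : ∀ (k : ℕ) (s : Memory), 4 < k → e.wf k = true →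
    s.reg 4 = N → ∃ t s', Exec (e.compile k) s t s' ∧ Agree k s' s ∧ s'.reg k = e.eval s ∧
      t ≤ e.cost N := by
  induction e with
  | const c =>
    intro k s hk _ _
    exact ⟨_, _, .const .., (Agree.refl k s).setReg_left le_rfl c, by simp [setReg_reg, eval],
      le_rfl⟩
  | reg x =>
    intro k s hk hx _
    simp only [wf, Nat.blt_eq] at hx
    exact ⟨_, _, .seq (.const ..) (.add ..),
      ((Agree.refl k s).setReg_left le_rfl _).setReg_left le_rfl _,
      by simp [setReg_reg, eval, hx.ne], le_rfl⟩
  | add a b iha ihb =>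
    intro k s hk h h4
    simp only [wf, Bool.and_eq_true] at h
    obtain ⟨t₁, s₁, e₁, g₁, v₁, c₁⟩ := iha k s hk h.1 h4
    obtain ⟨t₂, s₂, e₂, g₂, v₂, c₂⟩ := ihb (k + 1) s₁ (by omega) (wf_mono (by omega) h.2)
      (by rw [g₁.2 4 hk, h4])
    refine ⟨_, _, .seq e₁ (.seq e₂ (.add ..)),
      ((g₂.mono (by omega)).trans g₁).setReg_left le_rfl _, ?_, ?_⟩
    · simp [setReg_reg, eval, v₂, g₂.2 k (by omega), v₁, eval_congr hk h.2 g₁]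
    · simp only [cost]; omega
  | sub a b iha ihb =>
    intro k s hk h h4
    simp only [wf, Bool.and_eq_true] at h
    obtain ⟨t₁, s₁, e₁, g₁, v₁, c₁⟩ := iha k s hk h.1 h4
    obtain ⟨t₂, s₂, e₂, g₂, v₂, c₂⟩ := ihb (k + 1) s₁ (by omega) (wf_mono (by omega) h.2)
      (by rw [g₁.2 4 hk, h4])
    refine ⟨_, _, .seq e₁ (.seq e₂ (.sub ..)),
      ((g₂.mono (by omega)).trans g₁).setReg_left le_rfl _, ?_, ?_⟩
    · simp [setReg_reg, eval, v₂, g₂.2 k (by omega), v₁, eval_congr hk h.2 g₁]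
    · simp only [cost]; omega
  | load a e ih =>
    intro k s hk h h4
    obtain ⟨t₁, s₁, e₁, g₁, v₁, c₁⟩ := ih k s hk h h4
    refine ⟨_, _, .seq e₁ (.load ..), g₁.setReg_left le_rfl _, ?_, ?_⟩
    · simp [setReg_reg, eval, v₁, g₁.1]
    · simp only [cost]; omega
  | ite c a b ihc iha ihb =>
    intro k s hk h h4
    simp only [wf, Bool.and_eq_true] at h
    obtain ⟨t₁, s₁, e₁, g₁, v₁, c₁⟩ := ihc k s hk h.1 h4
    have h4' : s₁.reg 4 = N := by rw [g₁.2 4 hk, h4]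
    by_cases hc : c.eval s = 0
    · obtain ⟨t₂, s₂, e₂, g₂, v₂, c₂⟩ := ihb k s₁ hk h.2.2 h4'
      refine ⟨_, _, .seq e₁ (.iteFalse _ (v₁.trans hc) e₂), g₂.trans g₁, ?_, ?_⟩
      · simp [eval, hc, v₂, eval_congr hk h.2.2 g₁]
      · simp only [cost]; omega
    · obtain ⟨t₂, s₂, e₂, g₂, v₂, c₂⟩ := iha k s₁ hk h.2.1 h4'
      refine ⟨_, _, .seq e₁ (.iteTrue _ (by rwa [v₁]) e₂), g₂.trans g₁, ?_, ?_⟩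
      · simp [eval, hc, v₂, eval_congr hk h.2.1 g₁]
      · simp only [cost]; omega
  | sum x b e ihb ihe =>
    intro k s hk h h4
    simp only [wf, Bool.and_eq_true, Nat.blt_eq, Bool.not_eq_true',
      decide_eq_false_iff_not] at h
    obtain ⟨⟨hx, hx4⟩, hb, he⟩ := h
    obtain ⟨t₁, s₁, e₁, g₁, v₁, c₁⟩ := ihb k s hk hb h4
    -- The two truncated subtractions of the program compute `b - (b - N)`, which is this minimum.
    set m := min (b.eval s) N with hm
    have h4' : s₁.reg 4 = N := by rw [g₁.2 4 hk, h4]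
    obtain ⟨t₂, s₂, e₂, ha, hr, h0, h1, h2, c₂⟩ := exec_sum_loop (N := N) hk hx hx4 he
      (fun s' hs' => ihe (k + 3) s' (by omega) (wf_mono (by omega) he) hs') s m
      ((((((s₁.setReg (k + 1) (b.eval s - N)).setReg k m).setReg (k + 1) 0).setReg (k + 1)
        (s.reg x)).setReg (k + 2) 0))
      (by simp [setReg_reg, show (4 : ℕ) ≠ k + 2 by omega, show (4 : ℕ) ≠ k + 1 by omega, hk.ne,
            h4'])
      (by simp [setReg_reg]) g₁.1
      (fun y hy _ => by
        simp [setReg_reg, show y ≠ k + 2 by omega, show y ≠ k + 1 by omega, show y ≠ k by omega,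
          g₁.2 y hy])
    refine ⟨_, _, .seq e₁ (.seq (.sub ..) (.seq (.sub ..) (.seq (.const ..) (.seq (.add ..)
      (.seq (.const ..) (.seq (t₁ := t₂) (s₁ := s₂) ?_ (.seq (.add ..) (.add ..)))))))),
      ⟨ha, fun y hy => ?_⟩, ?_, ?_⟩
    · convert e₂ using 2
      · congr 1
        · simp [setReg_reg, v₁, h4', hm]
          congr 2
          omega
        · simp [setReg_reg, hx.ne, show x ≠ k + 1 by omega, g₁.2 x hx]
    -- The bound register is restored from its copy in `k + 1`; adding register `k` is harmless as
    -- it is 0 after the loop.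
    · by_cases hyx : y = x
      · subst hyx
        simp [setReg_reg, hy.ne, h0, h1]
      · simp [setReg_reg, hyx, hy.ne, hr y hy hyx]
    · simp [setReg_reg, hx.ne', show k + 2 ≠ x by omega, h0, h2, eval, hm, h4]
    · have : m * (e.cost N + 6) ≤ N * (e.cost N + 6) := Nat.mul_le_mul_right _ (min_le_right _ _)
      simp only [cost]; omega

/-- The nesting depth of the loops is fixed by the expression, and every loop contributes one factor
`N`. -/
theorem polyBounded_cost (e : Expr) : PolyBounded e.cost := by
  induction e with
  | const => exact .const 1
  | reg => exact .const 2
  | add a b iha ihb => exact (iha.add ihb).add (.const 1)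
  | sub a b iha ihb => exact (iha.add ihb).add (.const 1)
  | load a e ih => exact ih.add (.const 1)
  | ite c a b ihc iha ihb => exact ihc.add ((iha.add ihb).add (.const 1))
  | sum x b e ihb ihe => exact (ihb.add (PolyBounded.id.mul (ihe.add (.const 6)))).add (.const 8)

end Expr

/-- Commands. `loop x b c` runs `c` for the values of register `x` below `b`, cut off at the content
of register 4. -/
inductive Cmd : Type
  | assign (x : ℕ) (e : Expr) : Cmd
  | store (a : ℕ) (j e : Expr) : Cmd
  | seq (c c' : Cmd) : Cmd
  | when (e : Expr) (c : Cmd) : Cmd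
  | loop (x : ℕ) (b : Expr) (c : Cmd) : Cmd

/-! ### Correctness and cost of compiled commands. -/

namespace Cmd

/-- Apply `F 0`, …, `F (m - 1)` one after the other. -/
def iter (F : ℕ → Memory → Memory) (s : Memory) : ℕ → Memory
  | 0 => s
  | m + 1 => F m (iter F s m)

/-- The effect of a command on the memory. -/
def run : Cmd → Memory → Memory
  | assign x e, s => s.setReg x (e.eval s)
  | store a j e, s => s.setCell a (j.eval s) (e.eval s)
  | seq c c', s => c'.run (c.run s)
  | when e c, s => if e.eval s ≠ 0 then c.run s else s
  | loop x b c, s => iter (fun i s' => c.run (s'.setReg x i)) s (min (b.eval s) (s.reg 4))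

/-- All registers of the command are below `k`, and it does not change register 4. -/
def wf (k : ℕ) : Cmd → Bool
  | assign x e => Nat.blt x k && !decide (x = 4) && e.wf k
  | store _ j e => j.wf k && e.wf k
  | seq c c' => c.wf k && c'.wf k
  | when e c => e.wf k && c.wf k
  | loop x b c => Nat.blt x k && !decide (x = 4) && (b.wf k && c.wf k)

/-- The program that has the effect of the command and uses the registers from `k` on as scratch
space. -/
def compile : Cmd → ℕ → Prog
  | assign x e, k => .seq (e.compile k) <| .seq (.const (k + 1) 0) (.add x k (k + 1))
  | store a j e, k => .seq (j.compile k) <| .seq (e.compile (k + 1)) (.store a k (k + 1))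
  | seq c c', k => .seq (c.compile k) (c'.compile k)
  | when e c, k => .seq (e.compile k) (.ite k (c.compile k) (.const k 0))
  | loop x b c, k =>
    .seq (b.compile k) <| .seq (.sub (k + 1) k 4) <| .seq (.sub k k (k + 1)) <|
    .seq (.const (k + 1) 0) <|
    .loop k <| .seq (.const (k + 2) 0) <| .seq (.add x (k + 1) (k + 2)) <|
      .seq (c.compile (k + 2)) <| .seq (.const (k + 2) 1) <|
      .seq (.add (k + 1) (k + 1) (k + 2)) (.sub k k (k + 2))

/-- A bound on the time of the compiled command when register 4 contains `N`. -/
def cost (N : ℕ) : Cmd → ℕ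
  | assign _ e => e.cost N + 2
  | store _ j e => j.cost N + e.cost N + 1
  | seq c c' => c.cost N + c'.cost N
  | when e c => e.cost N + c.cost N + 2
  | loop _ b c => b.cost N + N * (c.cost N + 6) + 4

theorem polyBounded_cost (c : Cmd) : PolyBounded c.cost := by
  induction c with
  | assign x e => exact e.polyBounded_cost.add (.const 2)
  | store a j e => exact (j.polyBounded_cost.add e.polyBounded_cost).add (.const 1)
  | seq c c' ih ih' => exact ih.add ih'
  | when e c ih => exact (e.polyBounded_cost.add ih).add (.const 2)
  | loop x b c ih =>
    exact (b.polyBounded_cost.add (PolyBounded.id.mul (ih.add (.const 6)))).add (.const 4)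

theorem wf_mono {k l : ℕ} (hkl : k ≤ l) {c : Cmd} : c.wf k = true → c.wf l = true := by
  induction c with
  | assign x e =>
    simp only [wf, Bool.and_eq_true, Nat.blt_eq]
    exact fun h => ⟨⟨by omega, h.1.2⟩, e.wf_mono hkl h.2⟩
  | store a j e =>
    simp only [wf, Bool.and_eq_true]; exact fun h => ⟨j.wf_mono hkl h.1, e.wf_mono hkl h.2⟩
  | seq c c' ih ih' => simp only [wf, Bool.and_eq_true]; exact fun h => ⟨ih h.1, ih' h.2⟩
  | when e c ih =>
    simp only [wf, Bool.and_eq_true]; exact fun h => ⟨e.wf_mono hkl h.1, ih h.2⟩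
  | loop x b c ih =>
    simp only [wf, Bool.and_eq_true, Nat.blt_eq]
    exact fun h => ⟨⟨by omega, h.1.2⟩, b.wf_mono hkl h.2.1, ih h.2.2⟩

theorem iter_reg {F : ℕ → Memory → Memory} {x : ℕ} (hF : ∀ i s, (F i s).reg x = s.reg x)
    (s : Memory) (m : ℕ) : (iter F s m).reg x = s.reg x := by
  induction m with
  | zero => rfl
  | succ m ih => rw [iter, hF, ih]

/-- The cut-off stays the same during a run, so one number `N` bounds the cost of all the parts of a
command. -/
theorem run_reg_four {k : ℕ} {c : Cmd} : c.wf k = true → ∀ s, (c.run s).reg 4 = s.reg 4 := by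
  induction c with
  | assign x e =>
    simp only [wf, Bool.and_eq_true, Bool.not_eq_true', decide_eq_false_iff_not]
    intro h s
    simp [run, setReg_reg, Ne.symm h.1.2]
  | store a j e => simp [run]
  | seq c c' ih ih' =>
    simp only [wf, Bool.and_eq_true]
    intro h s
    rw [run, ih' h.2, ih h.1]
  | when e c ih =>
    simp only [wf, Bool.and_eq_true]
    intro h s
    simp only [run]
    split_ifs
    · exact ih h.2 s
    · rfl
  | loop x b c ih =>
    simp only [wf, Bool.and_eq_true, Bool.not_eq_true', decide_eq_false_iff_not]
    intro h s
    exact iter_reg (fun i s => by rw [ih h.2.2]; simp [setReg_reg, Ne.symm h.1.2]) s _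

theorem run_congr {k : ℕ} (hk : 4 < k) {c : Cmd} : c.wf k = true → ∀ {s s' : Memory},
    Agree k s s' → Agree k (c.run s) (c.run s') := by
  induction c with
  | assign x e =>
    simp only [wf, Bool.and_eq_true]
    intro h s s' hs
    simp only [run, e.eval_congr hk h.2 hs]
    exact hs.setReg _ _
  | store a j e =>
    simp only [wf, Bool.and_eq_true]
    intro h s s' hs
    simp only [run, e.eval_congr hk h.2 hs, j.eval_congr hk h.1 hs]
    exact hs.setCell _ _ _
  | seq c c' ih ih' =>
    simp only [wf, Bool.and_eq_true]
    intro h s s' hs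
    exact ih' h.2 (ih h.1 hs)
  | when e c ih =>
    simp only [wf, Bool.and_eq_true]
    intro h s s' hs
    simp only [run, e.eval_congr hk h.1 hs]
    split_ifs
    · exact ih h.2 hs
    · exact hs
  | loop x b c ih =>
    simp only [wf, Bool.and_eq_true]
    intro h s s' hs
    simp only [run, b.eval_congr hk h.2.1 hs, hs.2 4 hk]
    induction min (b.eval s') (s'.reg 4) with
    | zero => exact hs
    | succ m ihm => exact ih h.2.2 (ihm.setReg x m)

/-- A command does not change the registers that it does not mention. -/
theorem run_reg_of_wf {k : ℕ} {c : Cmd} : c.wf k = true → ∀ s {y : ℕ}, k ≤ y →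
    (c.run s).reg y = s.reg y := by
  induction c with
  | assign x e =>
    simp only [wf, Bool.and_eq_true, Nat.blt_eq]
    intro h s y hy
    simp [run, setReg_reg, show y ≠ x by omega]
  | store a j e => simp [run]
  | seq c c' ih ih' =>
    simp only [wf, Bool.and_eq_true]
    intro h s y hy
    rw [run, ih' h.2 _ hy, ih h.1 _ hy]
  | when e c ih =>
    simp only [wf, Bool.and_eq_true]
    intro h s y hy
    simp only [run]
    split_ifs
    · exact ih h.2 s hy
    · rfl
  | loop x b c ih =>
    simp only [wf, Bool.and_eq_true, Nat.blt_eq]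
    intro h s y hy
    exact iter_reg (fun i s => by rw [ih h.2.2 _ hy]; simp [setReg_reg, show y ≠ x by omega]) s _

/-- The loop of a compiled loop. -/
theorem exec_loop {x k N : ℕ} {c : Cmd} (hk : 4 < k) (hx : x < k) (hx4 : x ≠ 4)
    (hc : c.wf k = true)
    (ih : ∀ s : Memory, s.reg 4 = N → ∃ t s', Exec (c.compile (k + 2)) s t s' ∧
      Agree (k + 2) s' (c.run s) ∧ t ≤ c.cost N) (s₀ : Memory) (h₀ : s₀.reg 4 = N) (M : ℕ)
    (m : ℕ) : ∀ (j : ℕ) (s : Memory), s.reg k = m → s.reg (k + 1) = j → j + m = M →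
      Agree k s (iter (fun i s' => c.run (s'.setReg x i)) s₀ j) →
      ∃ t s', Exec (.loop k <| .seq (.const (k + 2) 0) <| .seq (.add x (k + 1) (k + 2)) <|
        .seq (c.compile (k + 2)) <| .seq (.const (k + 2) 1) <|
        .seq (.add (k + 1) (k + 1) (k + 2)) (.sub k k (k + 2))) s t s' ∧
        Agree k s' (iter (fun i s' => c.run (s'.setReg x i)) s₀ M) ∧
        t ≤ m * (c.cost N + 6) + 1 := by
  induction m with
  | zero =>
    intro j s h0 _ hj hs
    obtain rfl : j = M := by omega
    exact ⟨_, _, .loopStop _ h0, hs, by simp⟩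
  | succ m ihm =>
    intro j s hm hj hjm hs
    have h4 : s.reg 4 = N := by
      rw [hs.2 4 hk, iter_reg (fun i s' => ?_) s₀ j, h₀]
      rw [run_reg_four hc]; simp [setReg_reg, Ne.symm hx4]
    obtain ⟨t, s', hs', hag, ht⟩ := ih ((s.setReg (k + 2) 0).setReg x j)
      (by simp [setReg_reg, show (4 : ℕ) ≠ k + 2 by omega, hx4.symm, h4])
    -- The two counters survive the body: it mentions only registers below `k`, and its scratch
    -- space starts at `k + 2`. Unlike for sums the order matters, so `k + 1` counts up while `k`
    -- counts the remaining rounds.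
    have hreg : ∀ y, k ≤ y → y < k + 2 →
        (c.run ((s.setReg (k + 2) 0).setReg x j)).reg y = s.reg y := by
      intro y hy hy'
      rw [run_reg_of_wf hc _ hy]
      simp [setReg_reg, show y ≠ x by omega, show y ≠ k + 2 by omega]
    obtain ⟨t₂, s₂, hs₂, h1, h2⟩ := ihm (j + 1)
      (((s'.setReg (k + 2) 1).setReg (k + 1) (s'.reg (k + 1) + 1)).setReg k (s'.reg k - 1))
      (by simp [setReg_reg, hag.2 k (by omega), hreg k le_rfl (by omega), hm])
      (by simp [setReg_reg, hag.2 (k + 1) (by omega), hreg (k + 1) (by omega) (by omega), hj])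
      (by omega)
      (by
        refine (((hag.mono (by omega)).setReg_left (by omega) _).setReg_left (by omega)
          _).setReg_left le_rfl _ |>.trans ?_
        exact run_congr hk hc ((hs.setReg_left (by omega) _).setReg x j))
    refine ⟨_, s₂, .loopStep (t₂ := t₂) (by omega) (.seq (.const ..) (.seq (.add ..)
      (.seq (t₁ := t) (s₁ := s') ?_ (.seq (.const ..) (.seq (.add ..) (.sub ..)))))) ?_, h1, ?_⟩
    · simpa [setReg_reg, hj] using hs'
    · simpa [setReg_reg] using hs₂
    · rw [Nat.succ_mul]; omega

/-- The compiled command has the effect of the command. -/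
theorem exec_compile {N : ℕ} (c : Cmd) : ∀ (k : ℕ) (s : Memory), 4 < k → c.wf k = true →
    s.reg 4 = N → ∃ t s', Exec (c.compile k) s t s' ∧ Agree k s' (c.run s) ∧ t ≤ c.cost N := by
  induction c with
  | assign x e =>
    intro k s hk h h4
    simp only [wf, Bool.and_eq_true, Nat.blt_eq] at h
    obtain ⟨t₁, s₁, e₁, g₁, v₁, c₁⟩ := e.exec_compile k s hk h.2 h4
    refine ⟨_, _, .seq e₁ (.seq (.const ..) (.add ..)), ?_, ?_⟩
    · simp only [setReg_reg, if_neg (show k ≠ k + 1 by omega), if_true, v₁, add_zero, run]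
      exact (g₁.setReg_left (by omega) _).setReg _ _
    · simp only [cost]; omega
  | store a j e =>
    intro k s hk h h4
    simp only [wf, Bool.and_eq_true] at h
    obtain ⟨t₁, s₁, e₁, g₁, v₁, c₁⟩ := j.exec_compile k s hk h.1 h4
    obtain ⟨t₂, s₂, e₂, g₂, v₂, c₂⟩ := e.exec_compile (k + 1) s₁ (by omega)
      (e.wf_mono (by omega) h.2) (by rw [g₁.2 4 hk, h4])
    refine ⟨_, _, .seq e₁ (.seq e₂ (.store ..)), ?_, ?_⟩
    · rw [v₂, g₂.2 k (by omega), v₁, e.eval_congr hk h.2 g₁]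
      exact ((g₂.mono (by omega)).trans g₁).setCell _ _ _
    · simp only [cost]; omega
  | seq c c' ih ih' =>
    intro k s hk h h4
    simp only [wf, Bool.and_eq_true] at h
    obtain ⟨t₁, s₁, e₁, g₁, c₁⟩ := ih k s hk h.1 h4
    obtain ⟨t₂, s₂, e₂, g₂, c₂⟩ := ih' k s₁ hk h.2 (by rw [g₁.2 4 hk, run_reg_four h.1, h4])
    exact ⟨_, _, .seq e₁ e₂, g₂.trans (run_congr hk h.2 g₁), by simp only [cost]; omega⟩
  | when e c ih =>
    intro k s hk h h4
    simp only [wf, Bool.and_eq_true] at h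
    obtain ⟨t₁, s₁, e₁, g₁, v₁, c₁⟩ := e.exec_compile k s hk h.1 h4
    by_cases he : e.eval s = 0
    · refine ⟨_, _, .seq e₁ (.iteFalse _ (v₁.trans he) (.const ..)), ?_, ?_⟩
      · simp only [run, he, ne_eq, not_true_eq_false, if_false]
        exact g₁.setReg_left le_rfl _
      · simp only [cost]; omega
    · obtain ⟨t₂, s₂, e₂, g₂, c₂⟩ := ih k s₁ hk h.2 (by rw [g₁.2 4 hk, h4])
      refine ⟨_, _, .seq e₁ (.iteTrue _ (by rwa [v₁]) e₂), ?_, ?_⟩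
      · simp only [run, he, ne_eq, not_false_eq_true, if_true]
        exact g₂.trans (run_congr hk h.2 g₁)
      · simp only [cost]; omega
  | loop x b c ih =>
    intro k s hk h h4
    simp only [wf, Bool.and_eq_true, Nat.blt_eq, Bool.not_eq_true',
      decide_eq_false_iff_not] at h
    obtain ⟨⟨hx, hx4⟩, hb, hc⟩ := h
    obtain ⟨t₁, s₁, e₁, g₁, v₁, c₁⟩ := b.exec_compile k s hk hb h4
    set m := min (b.eval s) N with hm
    obtain ⟨t₂, s₂, e₂, g₂, c₂⟩ := exec_loop (N := N) hk hx hx4 hc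
      (fun s' hs' => ih (k + 2) s' (by omega) (wf_mono (by omega) hc) hs') s h4 m m 0
      (((s₁.setReg (k + 1) (b.eval s - N)).setReg k m).setReg (k + 1) 0)
      (by simp [setReg_reg]) (by simp [setReg_reg]) (by omega)
      (((g₁.setReg_left (by omega) _).setReg_left le_rfl _).setReg_left (by omega) _)
    refine ⟨_, _, .seq e₁ (.seq (.sub ..) (.seq (.sub ..) (.seq (.const ..)
      (t₂ := t₂) (s₂ := s₂) ?_))), ?_, ?_⟩
    · convert e₂ using 2
      simp [setReg_reg, v₁, g₁.2 4 hk, h4, hm]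
      congr 1
      omega
    · simpa only [run, h4] using g₂
    · have : m * (c.cost N + 6) ≤ N * (c.cost N + 6) := Nat.mul_le_mul_right _ (min_le_right _ _)
      simp only [cost]; omega

end Cmd

end JuntaLearning

namespace JuntaLearning

/-! ### Merging classes along edges -/

/-- Merge the classes of `a` and `b`; two numbers are in the same class if `L` agrees on them. -/
def merge (L : ℕ → ℕ) (a b : ℕ) : ℕ → ℕ := fun w => if L w = L a then L b else L w

/-- Merge along the edges of a list. -/
def mergeAll (L : ℕ → ℕ) (es : List (ℕ × ℕ)) : ℕ → ℕ := es.foldl (fun L e => merge L e.1 e.2) L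

/-- The number of classes of the numbers below `M`. -/
def classes (M : ℕ) (L : ℕ → ℕ) : ℕ := ((Finset.range M).image L).card

/-- Whether the edge joins two different classes. -/
def crossing (L : ℕ → ℕ) (e : ℕ × ℕ) : ℕ := if L e.1 = L e.2 then 0 else 1

theorem merge_eq_of_eq {L : ℕ → ℕ} {w w' : ℕ} (h : L w = L w') (a b : ℕ) :
    merge L a b w = merge L a b w' := by simp [merge, h]

theorem merge_joined (L : ℕ → ℕ) (a b : ℕ) : merge L a b a = merge L a b b := by
  simp only [merge, if_true]; split_ifs <;> rfl

theorem mergeAll_eq_of_eq {L : ℕ → ℕ} {w w' : ℕ} (h : L w = L w') (es : List (ℕ × ℕ)) :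
    mergeAll L es w = mergeAll L es w' := by
  induction es generalizing L with
  | nil => exact h
  | cons e es ih => exact ih (merge_eq_of_eq h _ _)

theorem mergeAll_joined (L : ℕ → ℕ) {es : List (ℕ × ℕ)} {e : ℕ × ℕ} (he : e ∈ es) :
    mergeAll L es e.1 = mergeAll L es e.2 := by
  induction es generalizing L with
  | nil => simp at he
  | cons e' es ih =>
    rcases List.mem_cons.1 he with rfl | he
    · exact mergeAll_eq_of_eq (merge_joined L _ _) es
    · exact ih _ he

/-- A labelling that is constant on the classes of `L` and along the edges is constant on the merged
classes. -/
theorem eq_of_mergeAll_eq {γ : Type*} (φ : ℕ → γ) {es : List (ℕ × ℕ)} {L : ℕ → ℕ}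
    (hL : ∀ w w', L w = L w' → φ w = φ w') (hφ : ∀ e ∈ es, φ e.1 = φ e.2) {w w' : ℕ}
    (h : mergeAll L es w = mergeAll L es w') : φ w = φ w' := by
  induction es generalizing L with
  | nil => exact hL w w' h
  | cons e es ih =>
    refine ih ?_ (fun e' he' => hφ e' (List.mem_cons_of_mem _ he')) h
    intro w w' h
    have he := hφ e List.mem_cons_self
    simp only [merge] at h
    split_ifs at h with h1 h2 h2
    · rw [hL _ _ h1, hL _ _ h2]
    · rw [hL _ _ h1, he, hL _ _ h]
    · rw [hL _ _ h2, he, hL _ _ h]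
    · exact hL _ _ h

/-- A coarser labelling is a function of the finer one, so its labels are an image of the finer
labels. -/
theorem classes_le_of_factor {M : ℕ} {L F : ℕ → ℕ} (h : ∀ w w', L w = L w' → F w = F w') :
    classes M F ≤ classes M L := by
  have hf : Function.FactorsThrough F L := fun w w' hw => h w w' hw
  have : (Finset.range M).image F = ((Finset.range M).image L).image (Function.extend L F id) := by
    rw [Finset.image_image]
    exact Finset.image_congr fun w _ => (hf.extend_apply id w).symm
  rw [classes, this]
  exact Finset.card_image_le

/-- If the two labels differ, exactly the label of `a` disappears. Both ends must be below `M` for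
the labels to be among those counted. -/
theorem classes_merge {M a b : ℕ} (ha : a < M) (hb : b < M) (L : ℕ → ℕ) :
    classes M (merge L a b) + crossing L (a, b) = classes M L := by
  by_cases h : L a = L b
  · have : merge L a b = L := by
      funext w
      simp only [merge]
      split_ifs with hw
      · rw [hw, h]
      · rfl
    simp [crossing, h, this]
  · have : (Finset.range M).image (merge L a b) = ((Finset.range M).image L).erase (L a) := by
      ext v
      simp only [Finset.mem_image, Finset.mem_range, Finset.mem_erase, merge]
      constructor
      · rintro ⟨w, hw, rfl⟩
        split_ifs with h'
        · exact ⟨Ne.symm h, b, hb, rfl⟩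
        · exact ⟨h', w, hw, rfl⟩
      · rintro ⟨hv, w, hw, rfl⟩
        exact ⟨w, hw, by simp [hv]⟩
    have hmem : L a ∈ (Finset.range M).image L :=
      Finset.mem_image_of_mem L (Finset.mem_range.2 ha)
    simp only [classes, crossing, h, this, if_false]
    exact Finset.card_erase_add_one hmem

theorem crossing_merge_le (L : ℕ → ℕ) (a b : ℕ) (e : ℕ × ℕ) :
    crossing (merge L a b) e ≤ crossing L e := by
  simp only [crossing]
  split_ifs with h1 h2 h2
  · exact le_rfl
  · exact Nat.zero_le _
  · exact absurd (merge_eq_of_eq h2 a b) h1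
  · exact le_rfl

/-- A merge loses a class only if its edge crosses at that moment, and then the edge already crossed
for the initial labelling, since merging only coarsens (`crossing_merge_le`). -/
theorem classes_le_mergeAll {M : ℕ} (es : List (ℕ × ℕ)) (hes : ∀ e ∈ es, e.1 < M ∧ e.2 < M)
    (L : ℕ → ℕ) : classes M L ≤ classes M (mergeAll L es) + (es.map (crossing L)).sum := by
  induction es generalizing L with
  | nil => simp [mergeAll]
  | cons e es ih =>
    have he := hes e List.mem_cons_self
    have h1 := ih (fun e' he' => hes e' (List.mem_cons_of_mem _ he')) (merge L e.1 e.2)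
    have h2 : _ + crossing L e = _ := classes_merge he.1 he.2 L
    have h3 : (es.map (crossing (merge L e.1 e.2))).sum ≤ (es.map (crossing L)).sum :=
      List.sum_le_sum fun e' _ => crossing_merge_le L e.1 e.2 e'
    simp only [List.map_cons, List.sum_cons]
    change _ ≤ classes M (mergeAll (merge L e.1 e.2) es) + _
    omega

/-! ### Binary codes -/

/-- The number with the given binary digits, lowest digit first. -/
def code {d : ℕ} (u : Fin d → Bool) : ℕ := ∑ j, (u j).toNat * 2 ^ (j : ℕ)

/-- Bit vectors as numbers. -/
def codeEquiv (d : ℕ) : (Fin d → Bool) ≃ Fin (2 ^ d) :=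
  (Equiv.arrowCongr (Equiv.refl _) finTwoEquiv.symm).trans finFunctionFinEquiv

theorem codeEquiv_val {d : ℕ} (u : Fin d → Bool) : (codeEquiv d u : ℕ) = code u := by
  simp only [codeEquiv, Equiv.trans_apply, finFunctionFinEquiv_apply, code]
  refine Finset.sum_congr rfl fun j _ => ?_
  cases h : u j <;> simp [h, finTwoEquiv]

theorem codeEquiv_symm_toNat {d : ℕ} (w : Fin (2 ^ d)) (j : Fin d) :
    ((codeEquiv d).symm w j).toNat = (w : ℕ) / 2 ^ (j : ℕ) % 2 := by
  have h : (finFunctionFinEquiv.symm w j : ℕ) = (w : ℕ) / 2 ^ (j : ℕ) % 2 := rfl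
  rw [← h]
  change (finTwoEquiv (finFunctionFinEquiv.symm w j)).toNat = _
  generalize finFunctionFinEquiv.symm w j = b
  fin_cases b <;> rfl

theorem code_lt {d : ℕ} (u : Fin d → Bool) : code u < 2 ^ d := by
  rw [← codeEquiv_val]; exact (codeEquiv d u).2

theorem code_injective {d : ℕ} : Function.Injective (code (d := d)) := fun u v h => by
  apply (codeEquiv d).injective
  apply Fin.ext
  rw [codeEquiv_val, codeEquiv_val, h]

/-! ### The potential of a list of queries -/

section Potential

variable {n d : ℕ}

/-- The values of an assignment on two tuples of variables, as an edge between two copies of the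
bit vectors of length `d`. -/
def edge (s t : Fin d → Fin n) (x : Assignment n) : ℕ × ℕ := (code (x ∘ s), 2 ^ d + code (x ∘ t))

/-- The classes formed by the edges of a list of queries. -/
def labels (s t : Fin d → Fin n) (Q : List (Assignment n)) : ℕ → ℕ :=
  mergeAll id (Q.map (edge s t))

/-- The number of classes that the queries leave in excess of the number that all assignments
leave. -/
noncomputable def excess (s t : Fin d → Fin n) (Q : List (Assignment n)) : ℕ :=
  classes (2 * 2 ^ d) (labels s t Q) -
    classes (2 * 2 ^ d) (labels s t (Finset.univ : Finset (Assignment n)).toList)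

/-- The total excess over all pairs of tuples of variables. -/
noncomputable def totalExcess (d : ℕ) (Q : List (Assignment n)) : ℕ :=
  ∑ s : Fin d → Fin n, ∑ t : Fin d → Fin n, excess s t Q

/-- The number of pairs of tuples of variables for which the assignment merges two classes. -/
def gain (d : ℕ) (Q : List (Assignment n)) (x : Assignment n) : ℕ :=
  ∑ s : Fin d → Fin n, ∑ t : Fin d → Fin n, crossing (labels s t Q) (edge s t x)

theorem edge_lt (s t : Fin d → Fin n) (x : Assignment n) :
    (edge s t x).1 < 2 * 2 ^ d ∧ (edge s t x).2 < 2 * 2 ^ d := by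
  have h1 := code_lt (x ∘ s)
  have h2 := code_lt (x ∘ t)
  simp only [edge]
  omega

theorem labels_append (s t : Fin d → Fin n) (Q : List (Assignment n)) (x : Assignment n) :
    labels s t (Q ++ [x]) = merge (labels s t Q) (edge s t x).1 (edge s t x).2 := by
  simp [labels, mergeAll]

/-- The components formed by all assignments are unions of those formed by the queries. In
particular the truncated subtraction in `excess` is a true difference. -/
theorem classes_univ_le (s t : Fin d → Fin n) (Q : List (Assignment n)) :
    classes (2 * 2 ^ d) (labels s t (Finset.univ : Finset (Assignment n)).toList) ≤
      classes (2 * 2 ^ d) (labels s t Q) := by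
  refine classes_le_of_factor fun w w' h => eq_of_mergeAll_eq _ ?_ ?_ h
  · rintro w w' rfl; rfl
  · intro e he
    obtain ⟨x, _, rfl⟩ := List.mem_map.1 he
    exact mergeAll_joined _ (List.mem_map.2 ⟨x, by simp, rfl⟩)

theorem excess_append (s t : Fin d → Fin n) (Q : List (Assignment n)) (x : Assignment n) :
    excess s t (Q ++ [x]) + crossing (labels s t Q) (edge s t x) = excess s t Q := by
  have h1 := classes_merge (edge_lt s t x).1 (edge_lt s t x).2 (labels s t Q)
  have h2 := classes_univ_le s t (Q ++ [x])
  rw [← labels_append] at h1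
  simp only [excess, Prod.mk.eta] at *
  omega

theorem totalExcess_append (Q : List (Assignment n)) (x : Assignment n) :
    totalExcess d (Q ++ [x]) + gain d Q x = totalExcess d Q := by
  simp only [totalExcess, gain, ← Finset.sum_add_distrib, excess_append]

/-- There are `n ^ d * n ^ d` pairs of tuples, and each graph has `2 * 2 ^ d` vertices. -/
theorem totalExcess_le (Q : List (Assignment n)) :
    totalExcess d Q ≤ n ^ d * n ^ d * (2 * 2 ^ d) := by
  have h : ∀ s t : Fin d → Fin n, excess s t Q ≤ 2 * 2 ^ d := fun s t =>
    (Nat.sub_le _ _).trans (Finset.card_image_le.trans (Finset.card_range _).le)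
  calc totalExcess d Q ≤ ∑ s : Fin d → Fin n, ∑ t : Fin d → Fin n, 2 * 2 ^ d :=
        Finset.sum_le_sum fun s _ => Finset.sum_le_sum fun t _ => h s t
    _ = _ := by simp; ring

/-- If a family of queries determines all edges, then the excess is at most the number of them that
merge two classes. -/
theorem excess_le_of_determining (s t : Fin d → Fin n) (Q Y : List (Assignment n))
    (hY : ∀ φ : ℕ → ℕ, (∀ y ∈ Y, φ (edge s t y).1 = φ (edge s t y).2) →
      ∀ x, φ (edge s t x).1 = φ (edge s t x).2) :
    excess s t Q ≤ (Y.map fun y => crossing (labels s t Q) (edge s t y)).sum := by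
  have h1 := classes_le_mergeAll (M := 2 * 2 ^ d) (Y.map (edge s t))
    (fun e he => by obtain ⟨y, _, rfl⟩ := List.mem_map.1 he; exact edge_lt s t y) (labels s t Q)
  have h2 : classes (2 * 2 ^ d) (mergeAll (labels s t Q) (Y.map (edge s t))) ≤
      classes (2 * 2 ^ d) (labels s t (Finset.univ : Finset (Assignment n)).toList) := by
    refine classes_le_of_factor fun w w' h => eq_of_mergeAll_eq _ ?_ ?_ h
    · rintro w w' rfl; rfl
    · intro e he
      obtain ⟨x, _, rfl⟩ := List.mem_map.1 he
      exact hY _ (fun y hy => mergeAll_joined _ (List.mem_map_of_mem hy)) x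
  rw [List.map_map] at h1
  simp only [excess, Function.comp_def] at *
  omega

/-- A crossing edge would lower the excess by one when appended (`excess_append`), which is
impossible at zero. -/
theorem crossing_eq_zero {s t : Fin d → Fin n} {Q : List (Assignment n)} (h : excess s t Q = 0)
    (x : Assignment n) : labels s t Q (edge s t x).1 = labels s t Q (edge s t x).2 := by
  have h1 := excess_append s t Q x
  by_contra hne
  simp only [crossing, hne, if_false] at h1
  omega

end Potential

/-! ### Juntas -/

/-- A function does not distinguish assignments that agree on its relevant variables. -/
theorem eq_of_agree_on_relevant {n : ℕ} {f : BoolFun n} {x y : Assignment n}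
    (h : ∀ i, Relevant f i → x i = y i) : f x = f y := by
  -- The irrelevant variables are moved from `x` to `y` one at a time.
  have key : ∀ D : Finset (Fin n), (∀ i ∈ D, ¬ Relevant f i) →
      f x = f fun i => if i ∈ D then y i else x i := by
    intro D
    induction D using Finset.induction_on with
    | empty => intro _; simp
    | insert i D hi ih =>
      intro hD
      rw [ih fun j hj => hD j (Finset.mem_insert_of_mem hj)]
      have hrel := hD i (Finset.mem_insert_self i D)
      simp only [Relevant, not_exists, not_not] at hrel
      set z : Assignment n := fun j => if j ∈ D then y j else x j with hz
      have hz' : (fun j => if j ∈ insert i D then y j else x j) = Function.update z i (y i) := by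
        funext j
        by_cases hj : j = i
        · subst hj; simp
        · simp [hz, hj]
      have hzz : z = Function.update z i (z i) := (Function.update_eq_self i z).symm
      rw [hz']
      conv_lhs => rw [hzz]
      cases z i <;> cases y i <;> simp [hrel z]
  classical
  rw [key (Finset.univ.filter fun i => ¬ Relevant f i) (by simp)]
  congr 1
  funext i
  by_cases hi : Relevant f i
  · simp [hi, h i hi]
  · simp [hi]

theorem Relevant.of_depends {n : ℕ} {f : BoolFun n} {S : Set (Fin n)}
    (hf : ∀ x y : Assignment n, (∀ i ∈ S, x i = y i) → f x = f y) {i : Fin n}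
    (h : Relevant f i) : i ∈ S := by
  obtain ⟨a, ha⟩ := h
  by_contra hi
  refine ha (hf _ _ fun j hj => ?_)
  have : j ≠ i := fun h => hi (h ▸ hj)
  simp [Function.update_of_ne this]

theorem mem_junta_of_depends {n d : ℕ} {f : BoolFun n} {S : Set (Fin n)} (hS : S.ncard ≤ d)
    (hf : ∀ x y : Assignment n, (∀ i ∈ S, x i = y i) → f x = f y) : f ∈ Junta n d :=
  (Set.ncard_le_ncard (fun _ hi => Relevant.of_depends hf hi) S.toFinite).trans hS

/-- A set of at most `d` variables, and possibly one more if it is empty, is listed by a tuple. -/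
theorem exists_tuple {n d : ℕ} {S : Set (Fin n)} (hS : S.ncard ≤ d) (i₀ : Fin n) :
    ∃ s : Fin d → Fin n, S ⊆ Set.range s ∧ Set.range s ⊆ insert i₀ S := by
  classical
  set F := S.toFinite.toFinset with hF
  have hcard : F.card = S.ncard := (Set.ncard_eq_toFinset_card S).symm
  let e := F.equivFin
  refine ⟨fun j => if h : (j : ℕ) < F.card then (e.symm ⟨j, h⟩ : Fin n) else i₀, ?_, ?_⟩
  · intro i hi
    have hiF : i ∈ F := by simpa [hF] using hi
    refine ⟨⟨e ⟨i, hiF⟩, (e ⟨i, hiF⟩).2.trans_le (hcard.le.trans hS)⟩, ?_⟩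
    simp
  · rintro _ ⟨j, rfl⟩
    simp only
    split_ifs with h
    · right
      have := (e.symm ⟨j, h⟩).2
      simpa [hF] using this
    · left; rfl

/-- Queries without excess identify every junta. -/
theorem eq_of_agree_on_queries {n d : ℕ} (hn : 1 ≤ n) {Q : List (Assignment n)}
    (hQ : totalExcess d Q = 0) {f g : BoolFun n} (hf : f ∈ Junta n d) (hg : g ∈ Junta n d)
    (hfg : ∀ q ∈ Q, f q = g q) : f = g := by
  classical
  obtain ⟨s, hs, -⟩ := exists_tuple hf ⟨0, hn⟩
  obtain ⟨t, ht, -⟩ := exists_tuple hg ⟨0, hn⟩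
  have hfs : ∀ x y : Assignment n, code (x ∘ s) = code (y ∘ s) → f x = f y := fun x y h =>
    eq_of_agree_on_relevant fun i hi => by
      obtain ⟨j, rfl⟩ := hs hi
      exact congrFun (code_injective h) j
  have hgt : ∀ x y : Assignment n, code (x ∘ t) = code (y ∘ t) → g x = g y := fun x y h =>
    eq_of_agree_on_relevant fun i hi => by
      obtain ⟨j, rfl⟩ := ht hi
      exact congrFun (code_injective h) j
  have hex : excess s t Q = 0 := by
    have h := (Finset.sum_eq_zero_iff.1 hQ) s (Finset.mem_univ _)
    exact (Finset.sum_eq_zero_iff.1 h) t (Finset.mem_univ _)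
  -- The labelling of the graph: left vertices carry the values of `f`, right vertices those of `g`.
  -- By `hfs` and `hgt` the choice of an assignment over a vertex does not matter.
  let φ : ℕ → Bool := fun w => if w < 2 ^ d then decide (∃ x, code (x ∘ s) = w ∧ f x = true) else
    decide (∃ x, 2 ^ d + code (x ∘ t) = w ∧ g x = true)
  have h1 : ∀ x, φ (edge s t x).1 = f x := fun x => by
    simp only [φ, edge, code_lt, if_true]
    rw [Bool.eq_iff_iff, decide_eq_true_iff]
    exact ⟨fun ⟨y, hy, hfy⟩ => by rw [← hfs y x hy, hfy], fun h => ⟨x, rfl, h⟩⟩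
  have h2 : ∀ x, φ (edge s t x).2 = g x := fun x => by
    simp only [φ, edge, if_neg (show ¬ 2 ^ d + code (x ∘ t) < 2 ^ d by omega)]
    rw [Bool.eq_iff_iff, decide_eq_true_iff]
    exact ⟨fun ⟨y, hy, hgy⟩ => by rw [← hgt y x (by omega), hgy], fun h => ⟨x, rfl, h⟩⟩
  funext x
  rw [← h1 x, ← h2 x]
  -- Agreement on the queries makes `φ` constant on their components, and without excess both ends
  -- of the edge of `x` lie in one component.
  refine eq_of_mergeAll_eq φ ?_ ?_ (crossing_eq_zero hex x)
  · rintro w w' rfl; rfl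
  · intro e he
    obtain ⟨q, hq, rfl⟩ := List.mem_map.1 he
    rw [h1, h2, hfg q hq]

end JuntaLearning

namespace JuntaLearning

/-! ### A small family of assignments, and fixing the bits of a query one by one -/

section Greedy

variable {n d : ℕ}

/-- The number of positions at which the tuple lists the variable and the bit is set. -/
def hits (s : Fin d → Fin n) (u : Fin d → Bool) (i : Fin n) : ℕ :=
  ∑ j, if s j = i then (u j).toNat else 0

/-- The assignment in which the value of a variable is the parity of the bits at the positions at
which the two tuples list it. -/
def overlay (s t : Fin d → Fin n) (u v : Fin d → Bool) : Assignment n :=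
  fun i => decide ((hits s u i + hits t v i) % 2 = 1)

/-- Replace the first `i` values of `x` by those of `y`. -/
def override (y : Assignment n) (i : ℕ) (x : Assignment n) : Assignment n :=
  fun v => if (v : ℕ) < i then y v else x v

/-- The total number of merging overlays after the first `i` values are fixed. -/
def estimate (d : ℕ) (Q : List (Assignment n)) (y : Assignment n) (i : ℕ) : ℕ :=
  ∑ s : Fin d → Fin n, ∑ t : Fin d → Fin n, ∑ u : Fin d → Bool, ∑ v : Fin d → Bool,
    crossing (labels s t Q) (edge s t (override y i (overlay s t u v)))

/-- One listing position is chosen for every listed variable; only there may the bit be set. -/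
theorem exists_hits (s : Fin d → Fin n) (h : Fin n → Bool) :
    ∃ u : Fin d → Bool, ∀ i ∈ Set.range s, hits s u i = (h i).toNat := by
  classical
  choose σ hσ using fun i : Set.range s => i.2
  refine ⟨fun j => if σ ⟨s j, j, rfl⟩ = j then h (s j) else false, fun i hi => ?_⟩
  rw [hits, Finset.sum_eq_single (σ ⟨i, hi⟩)]
  · have := hσ ⟨i, hi⟩
    simp only at this
    simp [this]
  · intro j _ hj
    by_cases hji : s j = i
    · subst hji
      simp [Ne.symm hj]
    · simp [hji]
  · simp

theorem hits_eq_zero {s : Fin d → Fin n} (u : Fin d → Bool) {i : Fin n} (hi : i ∉ Set.range s) :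
    hits s u i = 0 :=
  Finset.sum_eq_zero fun j _ => if_neg fun h => hi ⟨j, h⟩

/-- Varying `u` alone sets the variables of `s` at will: the parity to be produced is the wanted
value plus the contribution of `v`. -/
theorem exists_overlay_left (s t : Fin d → Fin n) (u v : Fin d → Bool) {x : Assignment n}
    (hx : ∀ i, i ∉ Set.range s → x i = overlay s t u v i) : ∃ u', overlay s t u' v = x := by
  obtain ⟨u', hu'⟩ := exists_hits s fun i => xor (x i) (decide (hits t v i % 2 = 1))
  refine ⟨u', funext fun i => ?_⟩
  by_cases hi : i ∈ Set.range s
  · simp only [overlay, hu' i hi]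
    rcases Nat.mod_two_eq_zero_or_one (hits t v i) with h | h <;> cases x i <;>
      simp [Nat.add_mod, h]
  · rw [hx i hi]
    simp only [overlay, hits_eq_zero _ hi]

theorem overlay_comm (s t : Fin d → Fin n) (u v : Fin d → Bool) :
    overlay s t u v = overlay t s v u := by
  funext i; simp only [overlay, add_comm]

theorem exists_overlay_right (s t : Fin d → Fin n) (u v : Fin d → Bool) {x : Assignment n}
    (hx : ∀ i, i ∉ Set.range t → x i = overlay s t u v i) : ∃ v', overlay s t u v' = x := by
  obtain ⟨v', hv'⟩ := exists_overlay_left (x := x) t s v u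
    (fun i hi => by rw [hx i hi, overlay_comm])
  exact ⟨v', by rw [overlay_comm, hv']⟩

/-- The overlays in one row and one column determine all edges. -/
theorem overlay_determining (s t : Fin d → Fin n) (u v : Fin d → Bool) (φ : ℕ → ℕ)
    (hl : ∀ u', φ (edge s t (overlay s t u' v)).1 = φ (edge s t (overlay s t u' v)).2)
    (hr : ∀ v', φ (edge s t (overlay s t u v')).1 = φ (edge s t (overlay s t u v')).2)
    (x : Assignment n) : φ (edge s t x).1 = φ (edge s t x).2 := by
  classical
  set a := overlay s t u v with ha
  have hl' : ∀ y : Assignment n, (∀ i, i ∉ Set.range s → y i = a i) →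
      φ (edge s t y).1 = φ (edge s t y).2 := fun y hy => by
    obtain ⟨u', rfl⟩ := exists_overlay_left s t u v hy; exact hl u'
  have hr' : ∀ y : Assignment n, (∀ i, i ∉ Set.range t → y i = a i) →
      φ (edge s t y).1 = φ (edge s t y).2 := fun y hy => by
    obtain ⟨v', rfl⟩ := exists_overlay_right s t u v hy; exact hr v'
  -- The ends of the edge of `x` are joined by the path of the edges of `p`, `b` and `p'`: the first
  -- shares its left end with `x`, the last its right end, `p` and `b` share the right end, `b` and
  -- `p'` the left end. Each of the three differs from `a` only on the variables of `s` or only on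
  -- those of `t`, so it is an overlay of the column or the row.
  let p : Assignment n := fun i => if i ∈ Set.range s then x i else a i
  let p' : Assignment n := fun i => if i ∈ Set.range t then x i else a i
  let b : Assignment n := fun i => if i ∈ Set.range s ∧ i ∈ Set.range t then x i else a i
  have h1 : (edge s t x).1 = (edge s t p).1 := by
    simp only [edge]; congr 1; funext j; simp [p]
  have h2 : (edge s t p).2 = (edge s t b).2 := by
    simp only [edge]; congr 2; funext j; simp [p, b]
  have h3 : (edge s t b).1 = (edge s t p').1 := by
    simp only [edge]; congr 1; funext j; simp [p', b]
  have h4 : (edge s t p').2 = (edge s t x).2 := by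
    simp only [edge]; congr 2; funext j; simp [p']
  rw [h1, hl' p fun i hi => if_neg hi, h2, ← hl' b fun i hi => if_neg fun h => hi h.1, h3,
    hr' p' fun i hi => if_neg hi, h4]

theorem excess_le_sum (s t : Fin d → Fin n) (Q : List (Assignment n)) (u v : Fin d → Bool) :
    excess s t Q ≤ ∑ u', crossing (labels s t Q) (edge s t (overlay s t u' v)) +
      ∑ v', crossing (labels s t Q) (edge s t (overlay s t u v')) := by
  have h := excess_le_of_determining s t Q
    ((Finset.univ : Finset (Fin d → Bool)).toList.map (fun u' => overlay s t u' v) ++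
      (Finset.univ : Finset (Fin d → Bool)).toList.map (fun v' => overlay s t u v')) ?_
  · simpa [Function.comp_def, Finset.sum_map_toList] using h
  · intro φ hφ
    refine overlay_determining s t u v φ (fun u' => hφ _ ?_) (fun v' => hφ _ ?_)
    · simp
    · simp

/-- Sum `excess_le_sum` over all `4 ^ d` pairs of bit vectors: each overlay is then counted `2 ^ d`
times by its row and `2 ^ d` times by its column. One factor `2 ^ d` cancels. -/
theorem totalExcess_le_estimate (Q : List (Assignment n)) (y : Assignment n) :
    2 ^ d * totalExcess d Q ≤ 2 * estimate d Q y 0 := by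
  have h : ∀ s t : Fin d → Fin n, 2 ^ d * excess s t Q ≤ 2 * ∑ u : Fin d → Bool,
      ∑ v : Fin d → Bool, crossing (labels s t Q) (edge s t (overlay s t u v)) := by
    intro s t
    have h1 : ∑ u : Fin d → Bool, ∑ v : Fin d → Bool, excess s t Q ≤ _ :=
      Finset.sum_le_sum fun u _ => Finset.sum_le_sum fun v _ => excess_le_sum s t Q u v
    simp only [Finset.sum_add_distrib, Finset.sum_const, Finset.card_univ, Fintype.card_fun,
      Fintype.card_bool, Fintype.card_fin, smul_eq_mul, ← Finset.mul_sum] at h1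
    rw [Finset.sum_comm, ← mul_add, ← two_mul] at h1
    exact Nat.le_of_mul_le_mul_left h1 (by positivity)
  simp only [totalExcess, estimate, Finset.mul_sum] at *
  refine Finset.sum_le_sum fun s _ => Finset.sum_le_sum fun t _ => ?_
  have h0 : ∀ x, override y 0 x = x := fun x => funext fun v => by simp [override]
  simpa only [h0] using h s t

/-- Once all values are fixed, each of the `4 ^ d` overlays has become the query itself. -/
theorem estimate_full (Q : List (Assignment n)) (y : Assignment n) :
    estimate d Q y n = 2 ^ d * 2 ^ d * gain d Q y := by
  have h : ∀ x, override y n x = y := fun x => funext fun v => if_pos v.2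
  simp only [estimate, h, Finset.sum_const, Finset.card_univ, Fintype.card_fun,
    Fintype.card_bool, Fintype.card_fin, smul_eq_mul, gain, Finset.mul_sum, mul_assoc]

theorem override_succ (y : Assignment n) (i : Fin n) (b : Bool) (x : Assignment n) :
    override (Function.update y i b) (i + 1) x = Function.update (override y i x) i b := by
  funext v
  by_cases hv : v = i
  · subst hv; simp [override]
  · have : (v : ℕ) ≠ i := fun h => hv (Fin.ext h)
    simp only [override, Function.update_of_ne hv]
    congr 1
    simp only [eq_iff_iff]
    omega

/-- Flipping one bit flips one parity, however often the variable is listed. This is why overlays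
use parities. -/
theorem overlay_flip (s t : Fin d → Fin n) (u v : Fin d → Bool) (j : Fin d) :
    overlay s t (Function.update u j (!u j)) v =
      Function.update (overlay s t u v) (s j) (!overlay s t u v (s j)) := by
  have hsum : ∀ u' : Fin d → Bool, ∀ i, hits s u' i =
      (if s j = i then (u' j).toNat else 0) +
        ∑ k ∈ Finset.univ.erase j, if s k = i then (u' k).toNat else 0 := fun u' i =>
    (Finset.add_sum_erase _ _ (Finset.mem_univ j)).symm
  have hrest : ∀ i, (∑ k ∈ Finset.univ.erase j,
      if s k = i then (Function.update u j (!u j) k).toNat else 0) =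
      ∑ k ∈ Finset.univ.erase j, if s k = i then (u k).toNat else 0 := fun i =>
    Finset.sum_congr rfl fun k hk => by rw [Function.update_of_ne (Finset.ne_of_mem_erase hk)]
  funext i
  by_cases hi : i = s j
  · subst hi
    simp only [overlay, hsum _ (s j), hrest, Function.update_self, if_true]
    generalize (∑ k ∈ Finset.univ.erase j, if s k = s j then (u k).toNat else 0) = r
    rw [← decide_not]
    apply decide_eq_decide.2
    cases u j <;> simp <;> omega
  · simp only [overlay, hsum _ i, hrest, Function.update_of_ne hi, if_neg (Ne.symm hi)]

/-- If flipping the parameter flips the value of `i`, then the values of `i` can be fixed at will. -/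
theorem sum_update_of_flip {ι : Type*} [Fintype ι] (F : Assignment n → ℕ) (X : ι → Assignment n)
    (i : Fin n) (flip : ι → ι) (hflip : Function.Involutive flip)
    (hX : ∀ w, X (flip w) = Function.update (X w) i (!X w i)) :
    2 * ∑ w, F (X w) =
      ∑ w, F (Function.update (X w) i false) + ∑ w, F (Function.update (X w) i true) := by
  -- One of two copies of the sum is reindexed by the flip. Then `X w` and `X (flip w)` are, in some
  -- order, the two updates of `X w` at `i`.
  have h1 : ∑ w, F (X w) = ∑ w, F (X (flip w)) := (Equiv.sum_comp hflip.toPerm fun w => F (X w)).symm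
  rw [two_mul]
  nth_rewrite 2 [h1]
  rw [← Finset.sum_add_distrib, ← Finset.sum_add_distrib]
  refine Finset.sum_congr rfl fun w _ => ?_
  rw [hX]
  have : F (X w) = F (Function.update (X w) i (X w i)) := by rw [Function.update_eq_self]
  rw [this]
  cases X w i <;> simp [add_comm]

theorem edge_update {s t : Fin d → Fin n} {i : Fin n} (hs : i ∉ Set.range s)
    (ht : i ∉ Set.range t) (x : Assignment n) (b : Bool) :
    edge s t (Function.update x i b) = edge s t x := by
  have h : ∀ r : Fin d → Fin n, i ∉ Set.range r → Function.update x i b ∘ r = x ∘ r := fun r hr =>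
    funext fun j => Function.update_of_ne (fun h => hr ⟨j, h⟩) _ _
  rw [edge, h s hs, h t ht, edge]

theorem override_update (y : Assignment n) (i : Fin n) (w : Assignment n) (b : Bool) :
    Function.update (override y i w) i b = override y i (Function.update w i b) := by
  funext v
  by_cases hv : v = i
  · subst hv; simp [override]
  · simp [override, hv]

theorem override_overlay_flip (y : Assignment n) (s t : Fin d → Fin n) (u v : Fin d → Bool)
    (j : Fin d) : override y (s j) (overlay s t (Function.update u j (!u j)) v) =
      Function.update (override y (s j) (overlay s t u v)) (s j)
        (!override y (s j) (overlay s t u v) (s j)) := by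
  rw [overlay_flip, override_update]
  simp [override]

/-- If `s` or `t` lists `i`, flipping a bit at a listing position pairs up the overlays. Otherwise
both updates leave `F` unchanged. -/
theorem sum_overlay_succ (s t : Fin d → Fin n) (y : Assignment n) (i : Fin n)
    (F : Assignment n → ℕ)
    (hF : i ∉ Set.range s → i ∉ Set.range t → ∀ x b, F (Function.update x i b) = F x) :
    2 * ∑ u : Fin d → Bool, ∑ v : Fin d → Bool, F (override y i (overlay s t u v)) =
      ∑ u : Fin d → Bool, ∑ v : Fin d → Bool,
        F (Function.update (override y i (overlay s t u v)) i false) +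
      ∑ u : Fin d → Bool, ∑ v : Fin d → Bool,
        F (Function.update (override y i (overlay s t u v)) i true) := by
  by_cases hs : i ∈ Set.range s
  · obtain ⟨j, rfl⟩ := hs
    have h : ∀ v, _ := fun v => sum_update_of_flip F
      (fun u => override y (s j) (overlay s t u v)) (s j) (fun u => Function.update u j (!u j))
      (fun u => by simp) (fun u => override_overlay_flip y s t u v j)
    have h' := Finset.sum_congr (rfl : (Finset.univ : Finset (Fin d → Bool)) = Finset.univ)
      fun v _ => h v
    rw [← Finset.mul_sum, Finset.sum_add_distrib] at h'
    convert h' using 2 <;> exact Finset.sum_comm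
  · by_cases ht : i ∈ Set.range t
    · obtain ⟨j, rfl⟩ := ht
      rw [Finset.mul_sum, ← Finset.sum_add_distrib]
      refine Finset.sum_congr rfl fun u _ => sum_update_of_flip F
        (fun v => override y (t j) (overlay s t u v)) (t j) (fun v => Function.update v j (!v j))
        (fun v => by simp) (fun v => ?_)
      rw [overlay_comm s t, overlay_comm s t]
      exact override_overlay_flip y t s v u j
    · simp only [hF hs ht, two_mul]

/-- The martingale property behind the conditional expectations: one of the two values for variable
`i` does not lower the estimate. -/
theorem estimate_succ (Q : List (Assignment n)) (y : Assignment n) (i : Fin n) :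
    2 * estimate d Q y i = estimate d Q (Function.update y i false) (i + 1) +
      estimate d Q (Function.update y i true) (i + 1) := by
  simp only [estimate, override_succ]
  rw [Finset.mul_sum, ← Finset.sum_add_distrib]
  refine Finset.sum_congr rfl fun s _ => ?_
  rw [Finset.mul_sum, ← Finset.sum_add_distrib]
  exact Finset.sum_congr rfl fun t _ => sum_overlay_succ s t y i
    (fun x => crossing (labels s t Q) (edge s t x)) fun hs ht x b => by
      rw [edge_update hs ht]

end Greedy

end JuntaLearning

namespace JuntaLearning

open Memory

/-! ### Arithmetic expressions -/

namespace Expr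

/-- The product; the second factor is at most the content of register 4. -/
def mul (a b : Expr) : Expr := sum 30 b a

/-- `1` if the values are equal, and `0` otherwise. -/
def eq (a b : Expr) : Expr := ite (sub a b) (const 0) (ite (sub b a) (const 0) (const 1))

/-- `1` if the first value is at most the second, and `0` otherwise. -/
def le (a b : Expr) : Expr := ite (sub a b) (const 0) (const 1)

/-- `1` if the first value is less than the second, and `0` otherwise. -/
def lt (a b : Expr) : Expr := ite (sub b a) (const 1) (const 0)

/-- The quotient. -/
def div (a b : Expr) : Expr := sum 31 a (le (mul b (add (reg 31) (const 1))) a)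

/-- The remainder. -/
def mod (a b : Expr) : Expr := sub a (mul b (div a b))

/-- `1` if the value is odd, and `0` otherwise. -/
def odd (c : Expr) : Expr := sum 32 c (eq (add (add (reg 32) (reg 32)) (const 1)) c)

@[simp] theorem eval_const (c : ℕ) (s : Memory) : (const c).eval s = c := rfl
@[simp] theorem eval_reg (x : ℕ) (s : Memory) : (reg x).eval s = s.reg x := rfl
@[simp] theorem eval_add (a b : Expr) (s : Memory) : (add a b).eval s = a.eval s + b.eval s := rfl
@[simp] theorem eval_sub (a b : Expr) (s : Memory) : (sub a b).eval s = a.eval s - b.eval s := rfl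
@[simp] theorem eval_load (a : ℕ) (e : Expr) (s : Memory) :
    (load a e).eval s = s.arr a (e.eval s) := rfl
@[simp] theorem eval_ite (c a b : Expr) (s : Memory) :
    (ite c a b).eval s = if c.eval s = 0 then b.eval s else a.eval s := by
  simp [eval]

theorem eval_sum {x m : ℕ} {b : Expr} {s : Memory} (hb : b.eval s = m) (hm : m ≤ s.reg 4)
    (e : Expr) : (sum x b e).eval s = ∑ i ∈ Finset.range m, e.eval (s.setReg x i) := by
  simp [eval, hb, hm]

@[simp] theorem eval_eq (a b : Expr) (s : Memory) :
    (eq a b).eval s = if a.eval s = b.eval s then 1 else 0 := by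
  simp only [eq, eval_ite, eval_sub, eval_const]
  grind

@[simp] theorem eval_le (a b : Expr) (s : Memory) :
    (le a b).eval s = if a.eval s ≤ b.eval s then 1 else 0 := by
  simp only [le, eval_ite, eval_sub, eval_const]
  grind

@[simp] theorem eval_lt (a b : Expr) (s : Memory) :
    (lt a b).eval s = if a.eval s < b.eval s then 1 else 0 := by
  simp only [lt, eval_ite, eval_sub, eval_const]
  grind

theorem eval_mul {a b : Expr} {s : Memory} (ha : ∀ i, a.eval (s.setReg 30 i) = a.eval s)
    (hb : b.eval s ≤ s.reg 4) : (mul a b).eval s = a.eval s * b.eval s := by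
  rw [mul, eval_sum rfl hb]
  simp [ha, mul_comm]

theorem eval_div {a b : Expr} {s : Memory}
    (ha : ∀ i, a.eval (s.setReg 31 i) = a.eval s)
    (hb : ∀ i, b.eval (s.setReg 31 i) = b.eval s)
    (hb' : ∀ i j, b.eval ((s.setReg 31 i).setReg 30 j) = b.eval s)
    (h4 : a.eval s ≤ s.reg 4) (h0 : 0 < b.eval s) : (div a b).eval s = a.eval s / b.eval s := by
  rw [div, eval_sum rfl h4]
  have h : ∀ i ∈ Finset.range (a.eval s),
      (le (mul b (add (reg 31) (const 1))) a).eval (s.setReg 31 i) =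
        if (i + 1) * b.eval s ≤ a.eval s then 1 else 0 := fun i hi => by
    rw [Finset.mem_range] at hi
    rw [eval_le, eval_mul (fun j => by rw [hb', hb]) (by simp [setReg_reg]; omega), ha, hb]
    simp [setReg_reg, mul_comm]
  rw [Finset.sum_congr rfl h, Finset.sum_boole]
  -- The quotient is the number of positive multiples of the divisor up to the dividend.
  have : (Finset.range (a.eval s)).filter (fun i => (i + 1) * b.eval s ≤ a.eval s) =
      Finset.range (a.eval s / b.eval s) := by
    ext i
    simp only [Finset.mem_filter, Finset.mem_range, ← Nat.le_div_iff_mul_le h0]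
    have := Nat.div_le_self (a.eval s) (b.eval s)
    omega
  simp [this]

theorem eval_mod {a b : Expr} {s : Memory}
    (ha : ∀ i, a.eval (s.setReg 31 i) = a.eval s)
    (hb : ∀ i, b.eval (s.setReg 31 i) = b.eval s)
    (hb1 : ∀ i, b.eval (s.setReg 30 i) = b.eval s)
    (hb' : ∀ i j, b.eval ((s.setReg 31 i).setReg 30 j) = b.eval s)
    (h4 : a.eval s ≤ s.reg 4) (h0 : 0 < b.eval s) : (mod a b).eval s = a.eval s % b.eval s := by
  have hd := eval_div ha hb hb' h4 h0
  rw [mod, eval_sub, eval_mul hb1 (by rw [hd]; exact (Nat.div_le_self _ _).trans h4), hd]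
  have := Nat.div_add_mod (a.eval s) (b.eval s)
  omega

theorem eval_odd {c : Expr} {s : Memory} (hc : ∀ i, c.eval (s.setReg 32 i) = c.eval s)
    (h4 : c.eval s ≤ s.reg 4) : (odd c).eval s = c.eval s % 2 := by
  rw [odd, eval_sum rfl h4]
  -- Only the index `c / 2` can satisfy `2 * i + 1 = c`, and it does so exactly for odd `c`.
  have h : ∀ i ∈ Finset.range (c.eval s),
      (eq (add (add (reg 32) (reg 32)) (const 1)) c).eval (s.setReg 32 i) =
        if i = c.eval s / 2 then c.eval s % 2 else 0 := fun i _ => by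
    simp only [eval_eq, eval_add, eval_reg, eval_const, hc, setReg_reg, if_true]
    split_ifs <;> omega
  rw [Finset.sum_congr rfl h, Finset.sum_ite_eq']
  simp only [Finset.mem_range]
  split_ifs <;> omega

end Expr

theorem sum_range_two_pow {d : ℕ} (F : ℕ → ℕ) :
    ∑ i ∈ Finset.range (2 ^ d), F i = ∑ u : Fin d → Bool, F (code u) := by
  rw [Finset.sum_range, ← (codeEquiv d).sum_comp]
  simp only [codeEquiv_val]

/-- The number of a tuple of variables. -/
def tupleCode {n d : ℕ} (σ : Fin d → Fin n) : ℕ := (finFunctionFinEquiv σ : ℕ)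

theorem tupleCode_lt {n d : ℕ} (σ : Fin d → Fin n) : tupleCode σ < n ^ d :=
  (finFunctionFinEquiv σ).2

theorem exists_tupleCode {n d a : ℕ} (ha : a < n ^ d) : ∃ σ : Fin d → Fin n, tupleCode σ = a :=
  ⟨finFunctionFinEquiv.symm ⟨a, ha⟩, by simp [tupleCode]⟩

theorem tupleCode_digit {n d : ℕ} (σ : Fin d → Fin n) (j : Fin d) :
    tupleCode σ / n ^ (j : ℕ) % n = σ j := by
  conv_rhs => rw [← finFunctionFinEquiv.symm_apply_apply σ]
  rfl

theorem code_digit {d : ℕ} (u : Fin d → Bool) (j : Fin d) :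
    code u / 2 ^ (j : ℕ) % 2 = (u j).toNat := by
  rw [← codeEquiv_val, ← codeEquiv_symm_toNat, Equiv.symm_apply_apply]

theorem sum_range_tuple {n d : ℕ} (F : ℕ → ℕ) :
    ∑ i ∈ Finset.range (n ^ d), F i = ∑ σ : Fin d → Fin n, F (tupleCode σ) := by
  rw [Finset.sum_range, ← finFunctionFinEquiv.sum_comp]
  rfl

/-! ### The expressions of the algorithm -/

/-- The bound on all loops. -/
def loopBound (n d : ℕ) : ℕ := (n ^ 4) ^ d

/-- Registers 0, 1, 4, 5, 6 contain `n`, `d`, the bound on all loops, `n ^ d` and `2 ^ d`, and arrays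
4 and 5 contain the powers of `n` and of 2. -/
structure Base (n d : ℕ) (s : Memory) : Prop where
  two_le : 2 ≤ n
  one_le : 1 ≤ d
  le : d ≤ n
  reg_zero : s.reg 0 = n
  reg_one : s.reg 1 = d
  reg_four : s.reg 4 = loopBound n d
  reg_five : s.reg 5 = n ^ d
  reg_six : s.reg 6 = 2 ^ d
  pow_n : ∀ j < d, s.arr 4 j = n ^ j
  pow_two : ∀ j < d, s.arr 5 j = 2 ^ j

theorem Base.setReg {n d : ℕ} {s : Memory} (h : Base n d s) {x : ℕ} (hx : 7 ≤ x) (v : ℕ) :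
    Base n d (s.setReg x v) where
  two_le := h.two_le
  one_le := h.one_le
  le := h.le
  reg_zero := by rw [setReg_reg, if_neg (by omega), h.reg_zero]
  reg_one := by rw [setReg_reg, if_neg (by omega), h.reg_one]
  reg_four := by rw [setReg_reg, if_neg (by omega), h.reg_four]
  reg_five := by rw [setReg_reg, if_neg (by omega), h.reg_five]
  reg_six := by rw [setReg_reg, if_neg (by omega), h.reg_six]
  pow_n := h.pow_n
  pow_two := h.pow_two

section Bounds

variable {n d : ℕ}

theorem pow_le_loopBound (hn : 2 ≤ n) {a : ℕ} (ha : a ≤ 4 * d) : n ^ a ≤ loopBound n d := by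
  rw [loopBound, ← pow_mul]; exact Nat.pow_le_pow_right (by omega) ha

theorem le_loopBound (hn : 2 ≤ n) (hd : 1 ≤ d) : n ≤ loopBound n d := by
  simpa using pow_le_loopBound (d := d) hn (show 1 ≤ 4 * d by omega)

theorem two_mul_le_loopBound (hn : 2 ≤ n) : 2 * d ≤ loopBound n d :=
  calc 2 * d ≤ 2 ^ (2 * d) := Nat.lt_two_pow_self.le
    _ ≤ n ^ (2 * d) := Nat.pow_le_pow_left hn _
    _ ≤ _ := pow_le_loopBound hn (by omega)

theorem two_pow_le_loopBound (hn : 2 ≤ n) {a : ℕ} (ha : a ≤ 4 * d) : 2 ^ a ≤ loopBound n d :=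
  (Nat.pow_le_pow_left hn _).trans (pow_le_loopBound hn ha)

end Bounds

/-! ### Expressions for overlays, components, estimate and gain. -/

namespace Expr

/-- The entry at position `y` of the tuple with the number in register `x`. -/
def entry (x y : ℕ) : Expr := mod (div (reg x) (load 4 (reg y))) (reg 0)

/-- The binary digit at position `y` of register `x`. -/
def bit (x y : ℕ) : Expr := mod (div (reg x) (load 5 (reg y))) (const 2)

/-- The number of positions at which the tuple in register `x` lists the variable and the digit of
register `y` is set. -/
def hits (x y : ℕ) (i : Expr) : Expr :=
  sum 14 (reg 1) (ite (eq (entry x 14) i) (bit y 14) (const 0))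

/-- The value of the overlay given by registers 10 to 13. -/
def overlay (i : Expr) : Expr := odd (add (hits 10 12 i) (hits 11 13 i))

/-- The overlay, with the values of the variables below register 9 taken from array 7. -/
def override (i : Expr) : Expr := ite (lt i (reg 9)) (load 7 i) (overlay i)

/-- The number with the binary digits `e`, as register 15 ranges over the positions. -/
def proj (e : Expr) : Expr := sum 15 (reg 1) (ite e (load 5 (reg 15)) (const 0))

/-- The cell of the class of `v` for the tuples in registers 10 and 11. -/
def cell (v : Expr) : Expr := add (mul (add (mul (reg 10) (reg 4)) (reg 11)) (reg 4)) v

/-- Whether the classes of the ends of an edge differ. -/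
def crossing (l r : Expr) : Expr :=
  ite (eq (load 6 (cell l)) (load 6 (cell (add (reg 6) r)))) (const 0) (const 1)

/-- The estimate of a partial query. -/
def estimate : Expr :=
  sum 10 (reg 5) <| sum 11 (reg 5) <| sum 12 (reg 6) <| sum 13 (reg 6) <|
    crossing (proj (override (entry 10 15))) (proj (override (entry 11 15)))

/-- The gain of a query. -/
def gain : Expr :=
  sum 10 (reg 5) <| sum 11 (reg 5) <|
    crossing (proj (load 7 (entry 10 15))) (proj (load 7 (entry 11 15)))

section Eval

variable {n d : ℕ} {s : Memory}

theorem eval_entry (h : Base n d s) {x y : ℕ} (hx : x ≠ 30 ∧ x ≠ 31) (hy : y ≠ 30 ∧ y ≠ 31)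
    {σ : Fin d → Fin n} (hσ : s.reg x = tupleCode σ) {j : Fin d} (hj : s.reg y = j) :
    (entry x y).eval s = σ j := by
  have hp : s.arr 4 j = n ^ (j : ℕ) := h.pow_n j j.2
  have h4 : tupleCode σ ≤ s.reg 4 := by
    rw [h.reg_four]; exact (tupleCode_lt σ).le.trans (pow_le_loopBound h.two_le (by omega))
  have hn : 0 < n := by have := h.two_le; omega
  have hdiv : ∀ s', (s' = s ∨ ∃ i, s' = s.setReg 31 i) →
      (div (reg x) (load 4 (reg y))).eval s' = tupleCode σ / n ^ (j : ℕ) := by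
    rintro s' (rfl | ⟨i, rfl⟩)
    · rw [eval_div] <;> simp [setReg_reg, hx, hy, hσ, hj, hp, h4, hn]
    · rw [eval_div] <;> simp [setReg_reg, hx, hy, hσ, hj, hp, h4, hn]
  rw [entry, eval_mod]
  · rw [hdiv s (.inl rfl), eval_reg, h.reg_zero, tupleCode_digit]
  · intro i; rw [hdiv s (.inl rfl), hdiv _ (.inr ⟨i, rfl⟩)]
  · simp [setReg_reg]
  · simp [setReg_reg]
  · simp [setReg_reg]
  · rw [hdiv s (.inl rfl)]; exact (Nat.div_le_self _ _).trans h4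
  · rw [eval_reg, h.reg_zero]; exact hn

theorem eval_bit (h : Base n d s) {x y : ℕ} (hx : x ≠ 30 ∧ x ≠ 31) (hy : y ≠ 30 ∧ y ≠ 31)
    {u : Fin d → Bool} (hu : s.reg x = code u) {j : Fin d} (hj : s.reg y = j) :
    (bit x y).eval s = (u j).toNat := by
  have hp : s.arr 5 j = 2 ^ (j : ℕ) := h.pow_two j j.2
  have h4 : code u ≤ s.reg 4 := by
    rw [h.reg_four]; exact (code_lt u).le.trans (two_pow_le_loopBound h.two_le (by omega))
  have hdiv : ∀ s', (s' = s ∨ ∃ i, s' = s.setReg 31 i) →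
      (div (reg x) (load 5 (reg y))).eval s' = code u / 2 ^ (j : ℕ) := by
    rintro s' (rfl | ⟨i, rfl⟩)
    · rw [eval_div] <;> simp [setReg_reg, hx, hy, hu, hj, hp, h4]
    · rw [eval_div] <;> simp [setReg_reg, hx, hy, hu, hj, hp, h4]
  rw [bit, eval_mod]
  · rw [hdiv s (.inl rfl), eval_const, code_digit]
  · intro i; rw [hdiv s (.inl rfl), hdiv _ (.inr ⟨i, rfl⟩)]
  · simp
  · simp
  · simp
  · rw [hdiv s (.inl rfl)]; exact (Nat.div_le_self _ _).trans h4
  · simp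

theorem eval_hits (h : Base n d s) {x y : ℕ} (hx : x ≠ 30 ∧ x ≠ 31 ∧ x ≠ 14)
    (hy : y ≠ 30 ∧ y ≠ 31 ∧ y ≠ 14) {σ : Fin d → Fin n} (hσ : s.reg x = tupleCode σ)
    {u : Fin d → Bool} (hu : s.reg y = code u) {e : Expr} {i : Fin n}
    (he : ∀ j, e.eval (s.setReg 14 j) = i) :
    (hits x y e).eval s = JuntaLearning.hits σ u i := by
  rw [hits, eval_sum (b := reg 1) (m := d) h.reg_one (by
    have := two_mul_le_loopBound (d := d) h.two_le
    rw [h.reg_four]; omega), Finset.sum_range]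
  refine Finset.sum_congr rfl fun j _ => ?_
  have hb := h.setReg (x := 14) (by norm_num) j
  rw [eval_ite, eval_eq, he, eval_entry hb ⟨hx.1, hx.2.1⟩ (by norm_num) (σ := σ) (j := j)
    (by simp [setReg_reg, hx, hσ]) (by simp [setReg_reg]), eval_bit hb ⟨hy.1, hy.2.1⟩ (by norm_num)
    (u := u) (j := j) (by simp [setReg_reg, hy, hu]) (by simp [setReg_reg])]
  by_cases hji : σ j = i
  · simp [hji]
  · have : (σ j : ℕ) ≠ i := fun h => hji (Fin.ext h)
    simp [hji, this]

theorem hits_le (σ : Fin d → Fin n) (u : Fin d → Bool) (i : Fin n) :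
    JuntaLearning.hits σ u i ≤ d := by
  calc JuntaLearning.hits σ u i ≤ ∑ _j : Fin d, 1 := Finset.sum_le_sum fun j _ => by
        split_ifs
        · exact Bool.toNat_le _
        · exact Nat.zero_le _
    _ = d := by simp

/-- Registers 10 and 11 contain tuples of variables. -/
structure Tuples (σ τ : Fin d → Fin n) (s : Memory) : Prop where
  base : Base n d s
  reg_left : s.reg 10 = tupleCode σ
  reg_right : s.reg 11 = tupleCode τ

theorem Tuples.setReg {σ τ : Fin d → Fin n} (h : Tuples σ τ s) {x : ℕ} (hx : 12 ≤ x) (v : ℕ) :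
    Tuples σ τ (s.setReg x v) where
  base := h.base.setReg (by omega) v
  reg_left := by rw [setReg_reg, if_neg (by omega), h.reg_left]
  reg_right := by rw [setReg_reg, if_neg (by omega), h.reg_right]

/-- The expression `e` is evaluated under the binders 14 and 32, so its value is required in all
memories that keep the tuples and register 15, the position in an enclosing `proj`. -/
theorem eval_overlay {σ τ : Fin d → Fin n} (h : Tuples σ τ s) {u v : Fin d → Bool}
    (hu : s.reg 12 = code u) (hv : s.reg 13 = code v) {e : Expr} {i : Fin n}
    (he : ∀ s', Tuples σ τ s' → s'.reg 15 = s.reg 15 → e.eval s' = i) :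
    (overlay e).eval s = (JuntaLearning.overlay σ τ u v i).toNat := by
  have hc : ∀ s', Tuples σ τ s' → s'.reg 15 = s.reg 15 → s'.reg 12 = code u → s'.reg 13 = code v →
      (add (hits 10 12 e) (hits 11 13 e)).eval s' =
        JuntaLearning.hits σ u i + JuntaLearning.hits τ v i := fun s' hs' h15 h12 h13 => by
    rw [eval_add, eval_hits hs'.base (by norm_num) (by norm_num) hs'.reg_left h12 fun j =>
        he _ (hs'.setReg (by norm_num) j) (by simp [setReg_reg, h15]),
      eval_hits hs'.base (by norm_num) (by norm_num) hs'.reg_right h13 fun j =>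
        he _ (hs'.setReg (by norm_num) j) (by simp [setReg_reg, h15])]
  have hcs := hc s h rfl hu hv
  rw [overlay, eval_odd (fun j => ?_), hcs, JuntaLearning.overlay]
  · rcases Nat.mod_two_eq_zero_or_one (JuntaLearning.hits σ u i + JuntaLearning.hits τ v i) with
      h | h <;> simp [h]
  · rw [hcs, h.base.reg_four]
    have := two_mul_le_loopBound (d := d) h.base.two_le
    have := hits_le σ u i
    have := hits_le τ v i
    omega
  · rw [hcs]
    exact hc _ (h.setReg (by norm_num) j) (by simp [setReg_reg]) (by simp [setReg_reg, hu])
      (by simp [setReg_reg, hv])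

theorem eval_override {σ τ : Fin d → Fin n} (h : Tuples σ τ s) {u v : Fin d → Bool}
    (hu : s.reg 12 = code u) (hv : s.reg 13 = code v) {y : Assignment n}
    (hy : ∀ i : Fin n, s.arr 7 i = (y i).toNat) {e : Expr} {i : Fin n}
    (he : ∀ s', Tuples σ τ s' → s'.reg 15 = s.reg 15 → e.eval s' = i) :
    (override e).eval s =
      (JuntaLearning.override y (s.reg 9) (JuntaLearning.overlay σ τ u v) i).toNat := by
  simp only [override, eval_ite, eval_lt, eval_load, he s h rfl, eval_reg, hy,
    eval_overlay h hu hv he, JuntaLearning.override]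
  split_ifs <;> simp_all

theorem eval_proj (h : Base n d s) {σ : Fin d → Fin n} {x : Assignment n} {e : Expr}
    (he : ∀ j : Fin d, e.eval (s.setReg 15 j) = (x (σ j)).toNat) :
    (proj e).eval s = code (x ∘ σ) := by
  rw [proj, eval_sum (b := reg 1) (m := d) h.reg_one (by
    have := two_mul_le_loopBound (d := d) h.two_le
    rw [h.reg_four]; omega), Finset.sum_range]
  refine Finset.sum_congr rfl fun j _ => ?_
  rw [eval_ite, he]
  cases hx : x (σ j) <;> simp [hx, setReg_reg, h.pow_two j j.2]

/-- The cell of the class of `w` for the tuples with the numbers `a` and `b`. -/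
def _root_.JuntaLearning.cellIndex (n d a b w : ℕ) : ℕ :=
  (a * loopBound n d + b) * loopBound n d + w

theorem eval_cell (h : Base n d s) (v : Expr) :
    (cell v).eval s = cellIndex n d (s.reg 10) (s.reg 11) (v.eval s) := by
  have hm : ∀ s', (s' = s ∨ ∃ i, s' = s.setReg 30 i) →
      (mul (reg 10) (reg 4)).eval s' = s.reg 10 * loopBound n d := by
    rintro s' (rfl | ⟨i, rfl⟩)
    · rw [eval_mul] <;> simp [setReg_reg, h.reg_four]
    · rw [eval_mul] <;> simp [setReg_reg, h.reg_four]
  rw [cell, eval_add, eval_mul (fun i => ?_) (by simp), eval_add, hm s (.inl rfl)]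
  · simp [cellIndex, h.reg_four]
  · rw [eval_add, eval_add, hm s (.inl rfl), hm _ (.inr ⟨i, rfl⟩)]
    simp [setReg_reg]

/-- Array 6 contains the classes formed by the queries. -/
def _root_.JuntaLearning.HasLabels (n d : ℕ) (Q : List (Assignment n)) (s : Memory) : Prop :=
  ∀ (σ τ : Fin d → Fin n) (w : ℕ), w < 2 * 2 ^ d →
    s.arr 6 (cellIndex n d (tupleCode σ) (tupleCode τ) w) = labels σ τ Q w

theorem eval_crossing {σ τ : Fin d → Fin n} (h : Tuples σ τ s) {Q : List (Assignment n)}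
    (hQ : HasLabels n d Q s) {x : Assignment n} {l r : Expr} (hl : l.eval s = code (x ∘ σ))
    (hr : r.eval s = code (x ∘ τ)) :
    (crossing l r).eval s = JuntaLearning.crossing (labels σ τ Q) (edge σ τ x) := by
  have h1 := (edge_lt σ τ x).1
  have h2 := (edge_lt σ τ x).2
  have h3 := hQ σ τ _ h1
  have h4 := hQ σ τ _ h2
  simp only [edge] at h3 h4
  simp only [crossing, eval_ite, eval_eq, eval_load, eval_cell h.base, h.reg_left, h.reg_right,
    eval_add, eval_reg, h.base.reg_six, hl, hr, h3, h4, JuntaLearning.crossing, edge, eval_const]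
  split_ifs <;> simp_all

theorem eval_sum_tuple (h : Base n d s) (x : ℕ) (e : Expr) : (sum x (reg 5) e).eval s =
    ∑ σ : Fin d → Fin n, e.eval (s.setReg x (tupleCode σ)) := by
  rw [eval_sum (b := reg 5) (m := n ^ d) h.reg_five
    (by rw [h.reg_four]; exact pow_le_loopBound h.two_le (by omega)), sum_range_tuple]

theorem eval_sum_bits (h : Base n d s) (x : ℕ) (e : Expr) : (sum x (reg 6) e).eval s =
    ∑ u : Fin d → Bool, e.eval (s.setReg x (code u)) := by
  rw [eval_sum (b := reg 6) (m := 2 ^ d) h.reg_six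
    (by rw [h.reg_four]; exact two_pow_le_loopBound h.two_le (by omega)), sum_range_two_pow]

theorem eval_estimate (h : Base n d s) {Q : List (Assignment n)} (hQ : HasLabels n d Q s)
    {y : Assignment n} (hy : ∀ i : Fin n, s.arr 7 i = (y i).toNat) :
    estimate.eval s = JuntaLearning.estimate d Q y (s.reg 9) := by
  rw [estimate, eval_sum_tuple h, JuntaLearning.estimate]
  refine Finset.sum_congr rfl fun σ _ => ?_
  have h1 := h.setReg (x := 10) (by norm_num) (tupleCode σ)
  rw [eval_sum_tuple h1]
  refine Finset.sum_congr rfl fun τ _ => ?_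
  have h2 : Tuples σ τ ((s.setReg 10 (tupleCode σ)).setReg 11 (tupleCode τ)) :=
    ⟨h1.setReg (by norm_num) _, by simp [setReg_reg], by simp [setReg_reg]⟩
  rw [eval_sum_bits h2.base]
  refine Finset.sum_congr rfl fun u _ => ?_
  have h3 := h2.setReg (x := 12) (by norm_num) (code u)
  rw [eval_sum_bits h3.base]
  refine Finset.sum_congr rfl fun v _ => ?_
  have h4 := h3.setReg (x := 13) (by norm_num) (code v)
  set s' := (((s.setReg 10 (tupleCode σ)).setReg 11 (tupleCode τ)).setReg 12
    (code u)).setReg 13 (code v) with hs'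
  have h9 : s'.reg 9 = s.reg 9 := by simp [hs', setReg_reg]
  have h12 : s'.reg 12 = code u := by simp [hs', setReg_reg]
  have h13 : s'.reg 13 = code v := by simp [hs', setReg_reg]
  refine eval_crossing h4 hQ (eval_proj h4.base fun j => ?_) (eval_proj h4.base fun j => ?_)
  · have h5 := h4.setReg (x := 15) (by norm_num) j
    rw [eval_override h5 (u := u) (v := v) (y := y) (i := σ j)]
    · simp [setReg_reg, h9]
    · simp [setReg_reg, h12]
    · simp [setReg_reg, h13]
    · exact hy
    · intro s'' hs'' h15
      exact eval_entry hs''.base (by norm_num) (by norm_num) hs''.reg_left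
        (by rw [h15]; simp [setReg_reg])
  · have h5 := h4.setReg (x := 15) (by norm_num) j
    rw [eval_override h5 (u := u) (v := v) (y := y) (i := τ j)]
    · simp [setReg_reg, h9]
    · simp [setReg_reg, h12]
    · simp [setReg_reg, h13]
    · exact hy
    · intro s'' hs'' h15
      exact eval_entry hs''.base (by norm_num) (by norm_num) hs''.reg_right
        (by rw [h15]; simp [setReg_reg])

theorem eval_proj_load (h : Base n d s) {y : Assignment n}
    (hy : ∀ i : Fin n, s.arr 7 i = (y i).toNat) {x : ℕ} (hx : x ≠ 30 ∧ x ≠ 31 ∧ x ≠ 15)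
    {σ : Fin d → Fin n} (hσ : s.reg x = tupleCode σ) :
    (proj (load 7 (entry x 15))).eval s = code (y ∘ σ) := by
  refine eval_proj h fun j => ?_
  rw [eval_load, eval_entry (h.setReg (by norm_num) _) ⟨hx.1, hx.2.1⟩ (by norm_num) (σ := σ)
    (j := j) (by simp [setReg_reg, hx, hσ]) (by simp [setReg_reg]), setReg_arr, hy]

theorem eval_gain (h : Base n d s) {Q : List (Assignment n)} (hQ : HasLabels n d Q s)
    {y : Assignment n} (hy : ∀ i : Fin n, s.arr 7 i = (y i).toNat) :
    gain.eval s = JuntaLearning.gain d Q y := by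
  rw [gain, eval_sum_tuple h, JuntaLearning.gain]
  refine Finset.sum_congr rfl fun σ _ => ?_
  have h1 := h.setReg (x := 10) (by norm_num) (tupleCode σ)
  rw [eval_sum_tuple h1]
  refine Finset.sum_congr rfl fun τ _ => ?_
  have h2 : Tuples σ τ ((s.setReg 10 (tupleCode σ)).setReg 11 (tupleCode τ)) :=
    ⟨h1.setReg (by norm_num) _, by simp [setReg_reg], by simp [setReg_reg]⟩
  exact eval_crossing h2 hQ (eval_proj_load h2.base hy (by norm_num) h2.reg_left)
    (eval_proj_load h2.base hy (by norm_num) h2.reg_right)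

end Eval

end Expr

end JuntaLearning

namespace JuntaLearning

open Memory

/-! ### The commands that select the queries -/

namespace Cmd

/-- The rule of loop invariants. By `hm` the cut-off does not shorten the loop. -/
theorem run_loop_induction {x m : ℕ} {b : Expr} {c : Cmd} {s : Memory} (hb : b.eval s = m)
    (hm : m ≤ s.reg 4) (P : ℕ → Memory → Prop) (h0 : P 0 s)
    (hs : ∀ i < m, ∀ s', P i s' → P (i + 1) (c.run (s'.setReg x i))) :
    P m ((loop x b c).run s) := by
  rw [run, hb, min_eq_left hm]
  have : ∀ i ≤ m, P i (iter (fun i s' => c.run (s'.setReg x i)) s i) := by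
    intro i
    induction i with
    | zero => exact fun _ => h0
    | succ i ih => exact fun hi => hs i hi _ (ih (by omega))
  exact this m le_rfl

/-- Fix the value of the variable in register 16 in the query in array 7. -/
def chooseBit : Cmd :=
  .seq (assign 9 (.add (.reg 16) (.const 1))) <| .seq (store 7 (.reg 16) (.const 0)) <|
  .seq (assign 21 .estimate) <| .seq (store 7 (.reg 16) (.const 1)) <|
  when (.lt .estimate (.reg 21)) (store 7 (.reg 16) (.const 0))

/-- Select the next query in array 7. -/
def chooseQuery : Cmd := loop 16 (.reg 0) chooseBit

/-- Append the query in array 7 to the list. -/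
def appendQuery : Cmd :=
  .seq (loop 16 (.reg 0)
    (store 0 (.add (.mul (.reg 2) (.reg 0)) (.reg 16)) (.load 7 (.reg 16)))) <|
  assign 2 (.add (.reg 2) (.const 1))

/-- For the tuples in registers 10 and 11, merge the classes of the ends of the edge of the query in
array 7. -/
def mergePair : Cmd :=
  .seq (assign 23 (.load 6 (.cell (.proj (.load 7 (.entry 10 15)))))) <|
  .seq (assign 24 (.load 6 (.cell (.add (.reg 6) (.proj (.load 7 (.entry 11 15))))))) <|
  loop 20 (.add (.reg 6) (.reg 6)) <|
    when (.eq (.load 6 (.cell (.reg 20))) (.reg 23)) (store 6 (.cell (.reg 20)) (.reg 24))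

/-- For the tuples in registers 10 and 11, put every vertex into a class of its own. -/
def initPair : Cmd :=
  loop 20 (.add (.reg 6) (.reg 6)) <| store 6 (.cell (.reg 20)) (.reg 20)

/-- Run a command for all pairs of tuples. -/
def forPairs (c : Cmd) : Cmd := loop 10 (.reg 5) (loop 11 (.reg 5) c)

/-- Select a query, and append it to the list if it merges two classes. -/
def step : Cmd := .seq chooseQuery <| when .gain (.seq (forPairs mergePair) appendQuery)

/-- Select all queries. -/
def select : Cmd := .seq (forPairs initPair) (loop 17 (.reg 4) step)

end Cmd

/-! ### The array of component labels. -/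

section Cells

variable {n d : ℕ} {s s' : Memory}

/-- The last two entries are digits in base `N`; the leading one needs no bound. -/
theorem cellIndex_injective {N a b w a' b' w' : ℕ} (hb : b < N) (hw : w < N) (hb' : b' < N)
    (hw' : w' < N) (h : (a * N + b) * N + w = (a' * N + b') * N + w') :
    a = a' ∧ b = b' ∧ w = w' := by
  have key : ∀ {x y x' y' : ℕ}, y < N → y' < N → x * N + y = x' * N + y' → x = x' ∧ y = y' := by
    intro x y x' y' hy hy' h
    have h1 : x = x' := by
      have := congrArg (· / N) h
      simpa [Nat.add_comm (_ * N), Nat.add_mul_div_right _ _ (show 0 < N by omega),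
        Nat.div_eq_of_lt hy, Nat.div_eq_of_lt hy'] using this
    subst h1
    exact ⟨rfl, by omega⟩
  obtain ⟨h1, h2⟩ := key hw hw' h
  obtain ⟨h3, h4⟩ := key hb hb' h1
  exact ⟨h3, h4, h2⟩

/-- The memories agree on all arrays but array 6 and on the registers below 7. -/
def Stable (s s' : Memory) : Prop := (∀ x < 7, s'.reg x = s.reg x) ∧ ∀ a ≠ 6, s'.arr a = s.arr a

theorem Stable.setReg (h : Stable s s') {x : ℕ} (hx : 7 ≤ x) (v : ℕ) :
    Stable s (s'.setReg x v) :=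
  ⟨fun y hy => by rw [setReg_reg, if_neg (by omega), h.1 y hy], h.2⟩

theorem Base.of_stable (hs : Base n d s) (h : Stable s s') : Base n d s' where
  two_le := hs.two_le
  one_le := hs.one_le
  le := hs.le
  reg_zero := by rw [h.1 0 (by norm_num), hs.reg_zero]
  reg_one := by rw [h.1 1 (by norm_num), hs.reg_one]
  reg_four := by rw [h.1 4 (by norm_num), hs.reg_four]
  reg_five := by rw [h.1 5 (by norm_num), hs.reg_five]
  reg_six := by rw [h.1 6 (by norm_num), hs.reg_six]
  pow_n := by rw [h.2 4 (by norm_num)]; exact hs.pow_n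
  pow_two := by rw [h.2 5 (by norm_num)]; exact hs.pow_two

theorem two_mul_two_pow_le (h : Base n d s) : 2 * 2 ^ d ≤ loopBound n d := by
  rw [← pow_succ']
  exact two_pow_le_loopBound h.two_le (by have := h.one_le; omega)

theorem cellIndex_ne (h : Base n d s) {a b w a' b' w' : ℕ} (hb : b < n ^ d) (hw : w < 2 * 2 ^ d)
    (hb' : b' < n ^ d) (hw' : w' < 2 * 2 ^ d) (hne : ¬ (a = a' ∧ b = b' ∧ w = w')) :
    cellIndex n d a b w ≠ cellIndex n d a' b' w' := by
  have h1 : n ^ d ≤ loopBound n d := pow_le_loopBound h.two_le (by omega)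
  have h2 := two_mul_two_pow_le h
  exact fun he => hne (cellIndex_injective (by omega) (by omega) (by omega) (by omega) he)

/-- A loop that rewrites the cells of a pair of tuples one by one. -/
theorem run_loop_cells {c : Cmd} {a b : ℕ} (hs : Base n d s) (hb : b < n ^ d) (G : ℕ → ℕ)
    (hc : ∀ w < 2 * 2 ^ d, ∀ s', s'.reg 20 = w → (∀ x ≠ 20, s'.reg x = s.reg x) →
      (∀ r ≠ 6, s'.arr r = s.arr r) →
      s'.arr 6 (cellIndex n d a b w) = s.arr 6 (cellIndex n d a b w) →
      c.run s' = s'.setCell 6 (cellIndex n d a b w) (G w))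
    (s'' : Memory) (hs'' : s'' = (Cmd.loop 20 (.add (.reg 6) (.reg 6)) c).run s) :
    (∀ x ≠ 20, s''.reg x = s.reg x) ∧ (∀ r ≠ 6, s''.arr r = s.arr r) ∧
    (∀ w < 2 * 2 ^ d, s''.arr 6 (cellIndex n d a b w) = G w) ∧
    ∀ a' b' w', b' < n ^ d → w' < 2 * 2 ^ d → ¬ (a' = a ∧ b' = b) →
      s''.arr 6 (cellIndex n d a' b' w') = s.arr 6 (cellIndex n d a' b' w') := by
  subst hs''
  have := Cmd.run_loop_induction (x := 20) (m := 2 * 2 ^ d) (b := .add (.reg 6) (.reg 6)) (c := c)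
    (s := s) (by simp [hs.reg_six]; ring) (by rw [hs.reg_four]; exact two_mul_two_pow_le hs)
    (fun i s' => (∀ x ≠ 20, s'.reg x = s.reg x) ∧ (∀ r ≠ 6, s'.arr r = s.arr r) ∧
      (∀ w < 2 * 2 ^ d, s'.arr 6 (cellIndex n d a b w) =
        if w < i then G w else s.arr 6 (cellIndex n d a b w)) ∧
      ∀ a' b' w', b' < n ^ d → w' < 2 * 2 ^ d → ¬ (a' = a ∧ b' = b) →
        s'.arr 6 (cellIndex n d a' b' w') = s.arr 6 (cellIndex n d a' b' w'))
    ⟨fun _ _ => rfl, fun _ _ => rfl, fun _ _ => by simp, fun _ _ _ _ _ _ => rfl⟩ ?_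
  · exact ⟨this.1, this.2.1, fun w hw => by rw [this.2.2.1 w hw, if_pos hw], this.2.2.2⟩
  · rintro i hi s' ⟨h1, h2, h3, h4⟩
    rw [hc i hi (s'.setReg 20 i) (by simp [setReg_reg])
      (fun x hx => by simp [setReg_reg, hx, h1 x hx]) h2 (by simp [h3 i hi])]
    refine ⟨fun x hx => by simp [setReg_reg, hx, h1 x hx],
      fun r hr => by funext j; simp [setCell_arr, hr, h2 r hr], fun w hw => ?_,
      fun a' b' w' hb' hw' hne => ?_⟩
    · by_cases hwi : w = i
      · subst hwi; simp [setCell_arr]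
      · simp only [setCell_arr, cellIndex_ne hs hb hw hb hi (fun h => hwi h.2.2), and_false,
          if_false, setReg_arr, h3 w hw]
        have : w < i ↔ w < i + 1 := by omega
        simp [this]
    · simp only [setCell_arr, cellIndex_ne hs hb' hw' hb hi (fun h => hne ⟨h.1, h.2.1⟩),
        and_false, if_false, setReg_arr, h4 a' b' w' hb' hw' hne]

/-- A command that rewrites the cells of a pair of tuples, run for all pairs. -/
theorem run_forPairs {c : Cmd} (hs : Base n d s) (G : (Fin d → Fin n) → (Fin d → Fin n) → ℕ → ℕ)
    (hc : ∀ σ τ s', Stable s s' → Expr.Tuples σ τ s' →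
      (∀ w < 2 * 2 ^ d, s'.arr 6 (cellIndex n d (tupleCode σ) (tupleCode τ) w) =
        s.arr 6 (cellIndex n d (tupleCode σ) (tupleCode τ) w)) →
      Stable s (c.run s') ∧ (c.run s').reg 10 = s'.reg 10 ∧
      (∀ w < 2 * 2 ^ d, (c.run s').arr 6 (cellIndex n d (tupleCode σ) (tupleCode τ) w) = G σ τ w) ∧
      ∀ a' b' w', b' < n ^ d → w' < 2 * 2 ^ d → ¬ (a' = tupleCode σ ∧ b' = tupleCode τ) →
        (c.run s').arr 6 (cellIndex n d a' b' w') = s'.arr 6 (cellIndex n d a' b' w')) :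
    Stable s ((Cmd.forPairs c).run s) ∧ ∀ σ τ, ∀ w < 2 * 2 ^ d,
      ((Cmd.forPairs c).run s).arr 6 (cellIndex n d (tupleCode σ) (tupleCode τ) w) = G σ τ w := by
  have hN : n ^ d ≤ loopBound n d := pow_le_loopBound hs.two_le (by omega)
  have := Cmd.run_loop_induction (x := 10) (m := n ^ d) (b := .reg 5) (c := .loop 11 (.reg 5) c)
    (s := s) hs.reg_five (by rw [hs.reg_four]; exact hN)
    (fun i s' => Stable s s' ∧ ∀ σ τ, ∀ w < 2 * 2 ^ d,
      s'.arr 6 (cellIndex n d (tupleCode σ) (tupleCode τ) w) = if tupleCode σ < i then G σ τ w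
        else s.arr 6 (cellIndex n d (tupleCode σ) (tupleCode τ) w))
    ⟨⟨fun _ _ => rfl, fun _ _ => rfl⟩, by simp⟩ ?_
  · exact ⟨this.1, fun σ τ w hw => by rw [Cmd.forPairs, this.2 σ τ w hw, if_pos (tupleCode_lt σ)]⟩
  rintro i hi s₁ ⟨hst₁, hG₁⟩
  have hs₁ := hs.of_stable (hst₁.setReg (x := 10) (by norm_num) i)
  obtain ⟨σ, rfl⟩ := exists_tupleCode hi
  have := Cmd.run_loop_induction (x := 11) (m := n ^ d) (b := .reg 5) (c := c)
    (s := s₁.setReg 10 (tupleCode σ)) hs₁.reg_five (by rw [hs₁.reg_four]; exact hN)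
    -- The pairs are treated in lexicographic order: those before the current one have been
    -- rewritten, the others are untouched.
    (fun i s' => Stable s s' ∧ s'.reg 10 = tupleCode σ ∧ ∀ σ' τ, ∀ w < 2 * 2 ^ d,
      s'.arr 6 (cellIndex n d (tupleCode σ') (tupleCode τ) w) =
        if tupleCode σ' < tupleCode σ ∨ (tupleCode σ' = tupleCode σ ∧ tupleCode τ < i)
        then G σ' τ w else s.arr 6 (cellIndex n d (tupleCode σ') (tupleCode τ) w))
    ⟨hst₁.setReg (by norm_num) _, by simp [setReg_reg], fun σ' τ w hw => by
      simp [hG₁ σ' τ w hw]⟩ ?_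
  · refine ⟨this.1, fun σ' τ w hw => ?_⟩
    rw [this.2.2 σ' τ w hw]
    have h1 := tupleCode_lt τ
    have h2 : (tupleCode σ' < tupleCode σ ∨ (tupleCode σ' = tupleCode σ ∧ tupleCode τ < n ^ d)) ↔
      tupleCode σ' < tupleCode σ + 1 := by omega
    simp only [h2]
  rintro j hj s₂ ⟨hst₂, h10, hG₂⟩
  obtain ⟨τ, rfl⟩ := exists_tupleCode hj
  have hst₂' := hst₂.setReg (x := 11) (by norm_num) (tupleCode τ)
  obtain ⟨k1, k2, k3, k4⟩ := hc σ τ (s₂.setReg 11 (tupleCode τ)) hst₂'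
    ⟨hs.of_stable hst₂', by simp [setReg_reg, h10], by simp [setReg_reg]⟩
    (fun w hw => by simp [hG₂ σ τ w hw])
  refine ⟨k1, by rw [k2]; simp [setReg_reg, h10], fun σ' τ' w hw => ?_⟩
  by_cases hst : tupleCode σ' = tupleCode σ ∧ tupleCode τ' = tupleCode τ
  · obtain ⟨h1, h2⟩ := hst
    obtain rfl : σ' = σ := finFunctionFinEquiv.injective (Fin.ext h1)
    obtain rfl : τ' = τ := finFunctionFinEquiv.injective (Fin.ext h2)
    rw [k3 w hw, if_pos (by omega)]
  · rw [k4 _ _ w (tupleCode_lt τ') hw hst, setReg_arr, hG₂ σ' τ' w hw]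
    have h2 : (tupleCode σ' < tupleCode σ ∨ (tupleCode σ' = tupleCode σ ∧
        tupleCode τ' < tupleCode τ)) ↔ (tupleCode σ' < tupleCode σ ∨
          (tupleCode σ' = tupleCode σ ∧ tupleCode τ' < tupleCode τ + 1)) := by omega
    simp only [h2]

theorem run_forPairs_initPair (hs : Base n d s) :
    Stable s ((Cmd.forPairs .initPair).run s) ∧ HasLabels n d [] ((Cmd.forPairs .initPair).run s) := by
  refine run_forPairs hs (fun _ _ w => w) fun σ τ s' hst ht _ => ?_
  have hc : ∀ w < 2 * 2 ^ d, ∀ s₁ : Memory, s₁.reg 20 = w → (∀ x ≠ 20, s₁.reg x = s'.reg x) →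
      (∀ r ≠ 6, s₁.arr r = s'.arr r) →
      s₁.arr 6 (cellIndex n d (tupleCode σ) (tupleCode τ) w) =
        s'.arr 6 (cellIndex n d (tupleCode σ) (tupleCode τ) w) →
      (Cmd.store 6 (.cell (.reg 20)) (.reg 20)).run s₁ =
        s₁.setCell 6 (cellIndex n d (tupleCode σ) (tupleCode τ) w) w :=
    fun w _ s₁ h20 hr ha _ => by
      have hb : Base n d s₁ := ht.base.of_stable ⟨fun x hx => hr x (by omega), ha⟩
      simp [Cmd.run, Expr.eval_cell hb, h20, hr 10, hr 11, ht.reg_left, ht.reg_right]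
  obtain ⟨h1, h2, h3, h4⟩ := run_loop_cells ht.base (tupleCode_lt τ) (fun w => w) hc _ rfl
  exact ⟨⟨fun x hx => by rw [Cmd.initPair, h1 x (by omega), hst.1 x hx],
    fun r hr => by rw [Cmd.initPair, h2 r hr, hst.2 r hr]⟩, h1 10 (by norm_num), h3, h4⟩

theorem run_forPairs_mergePair (hs : Base n d s) {Q : List (Assignment n)}
    (hQ : HasLabels n d Q s) {y : Assignment n} (hy : ∀ i : Fin n, s.arr 7 i = (y i).toNat) :
    Stable s ((Cmd.forPairs .mergePair).run s) ∧
      HasLabels n d (Q ++ [y]) ((Cmd.forPairs .mergePair).run s) := by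
  refine run_forPairs hs (fun σ τ => labels σ τ (Q ++ [y])) fun σ τ s' hst ht hcell => ?_
  have hy' : ∀ i : Fin n, s'.arr 7 i = (y i).toNat := by rw [hst.2 7 (by norm_num)]; exact hy
  obtain ⟨hl1, hl2⟩ := edge_lt σ τ y
  -- Both labels are saved in registers before the loop, which may overwrite the cells they come
  -- from.
  set l₁ := labels σ τ Q (edge σ τ y).1 with hl₁
  set l₂ := labels σ τ Q (edge σ τ y).2 with hl₂
  have hlab : ∀ w < 2 * 2 ^ d, s'.arr 6 (cellIndex n d (tupleCode σ) (tupleCode τ) w) =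
      labels σ τ Q w := fun w hw => by rw [hcell w hw, hQ σ τ w hw]
  have e1 : (Cmd.assign 23 (.load 6 (.cell (.proj (.load 7 (.entry 10 15)))))).run s' =
      s'.setReg 23 l₁ := by
    rw [Cmd.run, Expr.eval_load, Expr.eval_cell ht.base, Expr.eval_proj_load ht.base hy'
      (by norm_num) ht.reg_left, ht.reg_left, ht.reg_right, hl₁, ← hlab _ hl1]
    rfl
  have ht₁ := ht.setReg (x := 23) (by norm_num) l₁
  have e2 : (Cmd.assign 24 (.load 6 (.cell (.add (.reg 6)
      (.proj (.load 7 (.entry 11 15))))))).run (s'.setReg 23 l₁) =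
      (s'.setReg 23 l₁).setReg 24 l₂ := by
    rw [Cmd.run, Expr.eval_load, Expr.eval_cell ht₁.base, Expr.eval_add, Expr.eval_reg,
      Expr.eval_proj_load ht₁.base hy' (by norm_num) ht₁.reg_right, ht₁.reg_left, ht₁.reg_right,
      ht₁.base.reg_six, hl₂, ← hlab _ hl2]
    rfl
  have ht₂ := ht₁.setReg (x := 24) (by norm_num) l₂
  rw [Cmd.mergePair, Cmd.run, e1, Cmd.run, e2]
  set s₂ := (s'.setReg 23 l₁).setReg 24 l₂ with hs₂
  have hc : ∀ w < 2 * 2 ^ d, ∀ s₁ : Memory, s₁.reg 20 = w → (∀ x ≠ 20, s₁.reg x = s₂.reg x) →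
      (∀ r ≠ 6, s₁.arr r = s₂.arr r) →
      s₁.arr 6 (cellIndex n d (tupleCode σ) (tupleCode τ) w) =
        s₂.arr 6 (cellIndex n d (tupleCode σ) (tupleCode τ) w) →
      (Cmd.when (.eq (.load 6 (.cell (.reg 20))) (.reg 23))
        (.store 6 (.cell (.reg 20)) (.reg 24))).run s₁ =
        s₁.setCell 6 (cellIndex n d (tupleCode σ) (tupleCode τ) w) (labels σ τ (Q ++ [y]) w) := by
    intro w hw s₁ h20 hr ha hc
    have hb : Base n d s₁ := ht₂.base.of_stable ⟨fun x hx => hr x (by omega), ha⟩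
    have h10 : s₁.reg 10 = tupleCode σ := by rw [hr 10 (by norm_num), ht₂.reg_left]
    have h11 : s₁.reg 11 = tupleCode τ := by rw [hr 11 (by norm_num), ht₂.reg_right]
    have h23 : s₁.reg 23 = l₁ := by rw [hr 23 (by norm_num)]; simp [hs₂, setReg_reg]
    have h24 : s₁.reg 24 = l₂ := by rw [hr 24 (by norm_num)]; simp [hs₂, setReg_reg]
    have hw' : s₁.arr 6 (cellIndex n d (tupleCode σ) (tupleCode τ) w) = labels σ τ Q w :=
      hc.trans (hlab w hw)
    rw [labels_append]
    simp only [Cmd.run, Expr.eval_eq, Expr.eval_load, Expr.eval_cell hb, Expr.eval_reg, h20, h10,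
      h11, h23, h24, hw', merge]
    by_cases h : labels σ τ Q w = l₁
    · simp [h, ← hl₁, ← hl₂]
    · simp only [h, ← hl₁, if_false, ne_eq, not_true_eq_false]
      rw [← hw']
      simp [Memory.setCell]
  obtain ⟨h1, h2, h3, h4⟩ := run_loop_cells ht₂.base (tupleCode_lt τ) (labels σ τ (Q ++ [y])) hc _
    rfl
  refine ⟨⟨fun x hx => ?_, fun r hr => ?_⟩, ?_, h3, h4⟩
  · rw [h1 x (by omega)]
    simp [hs₂, setReg_reg, show x ≠ 23 by omega, show x ≠ 24 by omega, hst.1 x hx]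
  · rw [h2 r hr]; exact hst.2 r hr
  · rw [h1 10 (by norm_num)]; simp [hs₂, setReg_reg]

end Cells

/-! ### The list of queries -/

/-- The memory holds the list of queries and the classes formed by them. -/
structure HasQueries (n d : ℕ) (Q : List (Assignment n)) (s : Memory) : Prop where
  base : Base n d s
  length : s.reg 2 = Q.length
  queries : ∀ q x, Q[q]? = some x → ∀ i : Fin n, s.arr 0 (q * n + i) = (x i).toNat
  labels : HasLabels n d Q s
  buffer : ∃ y : Assignment n, ∀ i : Fin n, s.arr 7 i = (y i).toNat

section Queries

variable {n d : ℕ} {s : Memory} {Q : List (Assignment n)}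

theorem HasQueries.setReg (h : HasQueries n d Q s) {x : ℕ} (hx : 7 ≤ x) (v : ℕ) :
    HasQueries n d Q (s.setReg x v) where
  base := h.base.setReg hx v
  length := by rw [setReg_reg, if_neg (by omega), h.length]
  queries := h.queries
  labels := h.labels
  buffer := h.buffer

theorem Base.setCell (h : Base n d s) {a : ℕ} (h4 : a ≠ 4) (h5 : a ≠ 5) (j v : ℕ) :
    Base n d (s.setCell a j v) where
  two_le := h.two_le
  one_le := h.one_le
  le := h.le
  reg_zero := h.reg_zero
  reg_one := h.reg_one
  reg_four := h.reg_four
  reg_five := h.reg_five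
  reg_six := h.reg_six
  pow_n := fun i hi => by simp [setCell_arr, Ne.symm h4, h.pow_n i hi]
  pow_two := fun i hi => by simp [setCell_arr, Ne.symm h5, h.pow_two i hi]

theorem setCell_buffer {y : Assignment n} (hy : ∀ i : Fin n, s.arr 7 i = (y i).toNat)
    (i : Fin n) (b : Bool) (j : Fin n) :
    (s.setCell 7 i b.toNat).arr 7 j = (Function.update y i b j).toNat := by
  by_cases hj : j = i
  · subst hj; simp [setCell_arr]
  · have : (j : ℕ) ≠ i := fun h => hj (Fin.ext h)
    simp [setCell_arr, this, hj, hy]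

theorem HasQueries.setBit (h : HasQueries n d Q s) (i : Fin n) (b : Bool) :
    HasQueries n d Q (s.setCell 7 i b.toNat) where
  base := h.base.setCell (by norm_num) (by norm_num) _ _
  length := h.length
  queries := fun q x hq j => by simp [setCell_arr, h.queries q x hq j]
  labels := fun σ τ w hw => by simp [setCell_arr, h.labels σ τ w hw]
  buffer := h.buffer.imp' (fun y => Function.update y i b) fun y hy => setCell_buffer hy i b

/-- The value 0 is tried first, then 1, and 0 is restored if its estimate is larger. By
`estimate_succ` the larger estimate is at least the previous one, so a lower bound `T` persists. -/
theorem run_chooseBit (h : HasQueries n d Q s) {i : Fin n} (hi : s.reg 16 = i) {y : Assignment n}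
    (hy : ∀ i : Fin n, s.arr 7 i = (y i).toNat) {T : ℕ} (hT : T ≤ estimate d Q y i) :
    HasQueries n d Q (Cmd.chooseBit.run s) ∧ ∃ y' : Assignment n,
      (∀ i : Fin n, (Cmd.chooseBit.run s).arr 7 i = (y' i).toNat) ∧
      T ≤ estimate d Q y' (i + 1) := by
  set y₀ := Function.update y i false with hy₀
  set y₁ := Function.update y i true with hy₁
  have hsucc := estimate_succ (d := d) Q y i
  rw [← hy₀, ← hy₁] at hsucc
  set s₁ := s.setReg 9 (i + 1) with hs₁
  set s₂ := s₁.setCell 7 i 0 with hs₂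
  have q₂ : HasQueries n d Q s₂ := (h.setReg (by norm_num) _).setBit i false
  have b₂ : ∀ j : Fin n, s₂.arr 7 j = (y₀ j).toNat :=
    setCell_buffer (s := s₁) hy i false
  have v₂ : Expr.estimate.eval s₂ = estimate d Q y₀ (i + 1) := by
    rw [Expr.eval_estimate q₂.base q₂.labels b₂]
    simp [hs₂, hs₁, setReg_reg]
  set s₃ := s₂.setReg 21 (estimate d Q y₀ (i + 1)) with hs₃
  set s₄ := s₃.setCell 7 i 1 with hs₄
  have q₄ : HasQueries n d Q s₄ := (q₂.setReg (by norm_num) _).setBit i true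
  have b₄ : ∀ j : Fin n, s₄.arr 7 j = (y₁ j).toNat := by
    have := setCell_buffer (s := s₃) (y := y₀) b₂ i true
    rw [hy₀, Function.update_idem] at this
    exact this
  have v₄ : Expr.estimate.eval s₄ = estimate d Q y₁ (i + 1) := by
    rw [Expr.eval_estimate q₄.base q₄.labels b₄]
    simp [hs₄, hs₃, hs₂, hs₁, setReg_reg]
  have h21 : s₄.reg 21 = estimate d Q y₀ (i + 1) := by simp [hs₄, hs₃, setReg_reg]
  have hrun : Cmd.chooseBit.run s =
      if estimate d Q y₁ (i + 1) < estimate d Q y₀ (i + 1) then s₄.setCell 7 i 0 else s₄ := by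
    have e1 : (Cmd.assign 9 (.add (.reg 16) (.const 1))).run s = s₁ := by simp [Cmd.run, hi, hs₁]
    have e2 : (Cmd.store 7 (.reg 16) (.const 0)).run s₁ = s₂ := by
      simp [Cmd.run, hs₂, hs₁, setReg_reg, hi]
    have e3 : (Cmd.assign 21 .estimate).run s₂ = s₃ := by rw [Cmd.run, v₂]
    have e4 : (Cmd.store 7 (.reg 16) (.const 1)).run s₃ = s₄ := by
      simp [Cmd.run, hs₄, hs₃, hs₂, hs₁, setReg_reg, hi]
    have h16 : s₄.reg 16 = i := by simp [hs₄, hs₃, hs₂, hs₁, setReg_reg, hi]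
    rw [Cmd.chooseBit, Cmd.run, e1, Cmd.run, e2, Cmd.run, e3, Cmd.run, e4]
    simp only [Cmd.run, Expr.eval_lt, v₄, Expr.eval_reg, h21, h16, Expr.eval_const]
    split_ifs <;> simp_all
  rw [hrun]
  split_ifs with hlt
  · refine ⟨q₄.setBit i false, y₀, ?_, by omega⟩
    have := setCell_buffer (s := s₄) (y := y₁) b₄ i false
    rw [hy₁, Function.update_idem] at this
    exact this
  · exact ⟨q₄, y₁, b₄, by omega⟩

/-- The estimate never falls: it starts at no less than `2 ^ d / 2` times the excess
(`totalExcess_le_estimate`) and ends at `4 ^ d` times the gain (`estimate_full`). -/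
theorem run_chooseQuery (h : HasQueries n d Q s) : HasQueries n d Q (Cmd.chooseQuery.run s) ∧
    ∃ y : Assignment n, (∀ i : Fin n, (Cmd.chooseQuery.run s).arr 7 i = (y i).toNat) ∧
      totalExcess d Q ≤ 2 * 2 ^ d * gain d Q y := by
  obtain ⟨y₀, hy₀⟩ := h.buffer
  have := Cmd.run_loop_induction (x := 16) (m := n) (b := .reg 0) (c := .chooseBit) (s := s)
    h.base.reg_zero (by rw [h.base.reg_four]; exact le_loopBound h.base.two_le h.base.one_le)
    (fun i s' => HasQueries n d Q s' ∧ ∃ y : Assignment n,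
      (∀ i : Fin n, s'.arr 7 i = (y i).toNat) ∧ estimate d Q y₀ 0 ≤ estimate d Q y i)
    ⟨h, y₀, hy₀, le_rfl⟩ ?_
  · obtain ⟨h1, y, hy, hle⟩ := this
    refine ⟨h1, y, hy, ?_⟩
    have h2 := totalExcess_le_estimate (d := d) Q y₀
    rw [estimate_full] at hle
    have h3 : 2 ^ d * totalExcess d Q ≤ 2 ^ d * (2 * 2 ^ d * gain d Q y) := by
      calc _ ≤ _ := h2
        _ ≤ 2 * (2 ^ d * 2 ^ d * gain d Q y) := by omega
        _ = _ := by ring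
    exact Nat.le_of_mul_le_mul_left h3 (by positivity)
  · rintro i hi s' ⟨h1, y, hy, hle⟩
    exact run_chooseBit (i := ⟨i, hi⟩) (h1.setReg (by norm_num) i) (by simp [setReg_reg]) hy hle

/-- A copy of the buffer is appended. -/
theorem run_appendQuery (hb : Base n d s) (hlen : s.reg 2 = Q.length)
    (hq : ∀ q x, Q[q]? = some x → ∀ i : Fin n, s.arr 0 (q * n + i) = (x i).toNat)
    {y : Assignment n} (hl : HasLabels n d (Q ++ [y]) s)
    (hy : ∀ i : Fin n, s.arr 7 i = (y i).toNat) :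
    HasQueries n d (Q ++ [y]) (Cmd.appendQuery.run s) := by
  have := Cmd.run_loop_induction (x := 16) (m := n) (b := .reg 0)
    (c := .store 0 (.add (.mul (.reg 2) (.reg 0)) (.reg 16)) (.load 7 (.reg 16))) (s := s)
    hb.reg_zero (by rw [hb.reg_four]; exact le_loopBound hb.two_le hb.one_le)
    (fun i s' => Base n d s' ∧ s'.reg 2 = Q.length ∧ (∀ a ≠ 0, s'.arr a = s.arr a) ∧
      (∀ j < Q.length * n, s'.arr 0 j = s.arr 0 j) ∧
      ∀ j : Fin n, (j : ℕ) < i → s'.arr 0 (Q.length * n + j) = (y j).toNat)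
    ⟨hb, hlen, fun _ _ => rfl, fun _ _ => rfl, by simp⟩ ?_
  · obtain ⟨h1, h2, h3, h4, h5⟩ := this
    rw [Cmd.appendQuery, Cmd.run]
    set s' := (Cmd.loop 16 (.reg 0)
      (.store 0 (.add (.mul (.reg 2) (.reg 0)) (.reg 16)) (.load 7 (.reg 16)))).run s
    have hrun : (Cmd.assign 2 (.add (.reg 2) (.const 1))).run s' = s'.setReg 2 (Q.length + 1) := by
      simp [Cmd.run, h2]
    rw [hrun]
    refine ⟨⟨h1.two_le, h1.one_le, h1.le, ?_, ?_, ?_, ?_, ?_, h1.pow_n, h1.pow_two⟩, ?_, ?_, ?_,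
      y, ?_⟩
    · simp [setReg_reg, h1.reg_zero]
    · simp [setReg_reg, h1.reg_one]
    · simp [setReg_reg, h1.reg_four]
    · simp [setReg_reg, h1.reg_five]
    · simp [setReg_reg, h1.reg_six]
    · simp [setReg_reg]
    · intro q x hx i
      rcases lt_or_ge q Q.length with hql | hql
      · rw [List.getElem?_append_left hql] at hx
        have : q * n + i < Q.length * n := by
          have := Nat.mul_le_mul_right n (Nat.succ_le_of_lt hql)
          have := i.2
          rw [Nat.succ_mul] at *
          omega
        rw [setReg_arr, h4 _ this, hq q x hx]
      · rw [List.getElem?_append_right hql] at hx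
        obtain hq0 : q - Q.length = 0 := by
          by_contra hne
          rw [List.getElem?_eq_none (by simp; omega)] at hx
          simp at hx
        rw [hq0] at hx
        obtain rfl : y = x := by simpa using hx
        obtain rfl : q = Q.length := by omega
        exact h5 i i.2
    · intro σ τ w hw
      rw [setReg_arr, h3 6 (by norm_num)]
      exact hl σ τ w hw
    · rw [setReg_arr, h3 7 (by norm_num)]
      exact hy
  · rintro i hi s' ⟨h1, h2, h3, h4, h5⟩
    have hrun : (Cmd.store 0 (.add (.mul (.reg 2) (.reg 0)) (.reg 16)) (.load 7 (.reg 16))).run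
        (s'.setReg 16 i) = (s'.setReg 16 i).setCell 0 (Q.length * n + i) (y ⟨i, hi⟩).toNat := by
      rw [Cmd.run, Expr.eval_add, Expr.eval_mul (by simp [setReg_reg]) ?_]
      · have : s'.arr 7 i = (y ⟨i, hi⟩).toNat := by rw [h3 7 (by norm_num)]; exact hy ⟨i, hi⟩
        simp [setReg_reg, h2, h1.reg_zero, this]
      · simp only [Expr.eval_reg, setReg_reg, if_neg (show (0 : ℕ) ≠ 16 by norm_num),
          if_neg (show (4 : ℕ) ≠ 16 by norm_num), h1.reg_zero, h1.reg_four]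
        exact le_loopBound hb.two_le hb.one_le
    rw [hrun]
    refine ⟨(h1.setReg (by norm_num) _).setCell (by norm_num) (by norm_num) _ _,
      by simp [setReg_reg, h2], fun a ha => ?_, fun j hj => ?_, fun j hj => ?_⟩
    · funext j; simp [setCell_arr, ha, h3 a ha]
    · simp [setCell_arr, show j ≠ Q.length * n + i by omega, h4 j hj]
    · by_cases hji : (j : ℕ) = i
      · obtain rfl : j = ⟨i, hi⟩ := Fin.ext hji
        simp [setCell_arr]
      · simp [setCell_arr, hji, h5 j (by omega)]

/-- Lists of queries that are built up greedily. -/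
inductive IsGreedy (d : ℕ) : List (Assignment n) → Prop
  | nil : IsGreedy d []
  | append {Q : List (Assignment n)} {y : Assignment n} : IsGreedy d Q → gain d Q y ≠ 0 →
      totalExcess d Q ≤ 2 * 2 ^ d * gain d Q y → IsGreedy d (Q ++ [y])

/-- A chosen query without gain shows that no excess is left, so nothing is appended in that case.
-/
theorem run_step (h : HasQueries n d Q s) (hQ : IsGreedy d Q) : ∃ Q', HasQueries n d Q' (Cmd.step.run s) ∧
    IsGreedy d Q' ∧ (totalExcess d Q' = 0 ∨ totalExcess d Q' < totalExcess d Q) := by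
  obtain ⟨h1, y, hy, hle⟩ := run_chooseQuery h
  rw [Cmd.step, Cmd.run]
  set s₁ := Cmd.chooseQuery.run s
  rw [Cmd.run, Expr.eval_gain h1.base h1.labels hy]
  split_ifs with hg
  · obtain ⟨k1, k2⟩ := run_forPairs_mergePair h1.base h1.labels hy
    rw [Cmd.run]
    refine ⟨Q ++ [y], run_appendQuery (h1.base.of_stable k1) (by rw [k1.1 2 (by norm_num), h1.length])
      ?_ k2 ?_, .append hQ hg hle, ?_⟩
    · rw [k1.2 0 (by norm_num)]; exact h1.queries
    · rw [k1.2 7 (by norm_num)]; exact hy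
    · have := totalExcess_append (d := d) Q y
      omega
  · exact ⟨Q, h1, hQ, .inl (by simp only [ne_eq, not_not] at hg; rw [hg] at hle; omega)⟩

theorem totalExcess_nil_le (hn : 2 ≤ n) (hd : 1 ≤ d) :
    totalExcess d ([] : List (Assignment n)) ≤ loopBound n d := by
  calc totalExcess d ([] : List (Assignment n)) ≤ n ^ d * n ^ d * (2 * 2 ^ d) := totalExcess_le _
    _ ≤ n ^ d * n ^ d * (n ^ d * n ^ d) := by
        refine Nat.mul_le_mul_left _ (Nat.mul_le_mul ?_ (Nat.pow_le_pow_left hn d))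
        exact hn.trans (Nat.le_self_pow (by omega) n)
    _ = loopBound n d := by rw [loopBound, ← pow_mul]; ring

/-- The initial excess is at most `loopBound n d`, and every round lowers it by at least one until
it is zero. So that many rounds suffice, with no test for termination. -/
theorem run_select (h : Base n d s) (h2 : s.reg 2 = 0) (h7 : ∀ i, s.arr 7 i = 0) :
    ∃ Q, HasQueries n d Q (Cmd.select.run s) ∧ IsGreedy d Q ∧ totalExcess d Q = 0 := by
  obtain ⟨k1, k2⟩ := run_forPairs_initPair h
  rw [Cmd.select, Cmd.run]
  set s₁ := (Cmd.forPairs .initPair).run s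
  have hb := h.of_stable k1
  have := Cmd.run_loop_induction (x := 17) (m := loopBound n d) (b := .reg 4) (c := .step)
    (s := s₁) hb.reg_four hb.reg_four.ge
    (fun i s' => ∃ Q, HasQueries n d Q s' ∧ IsGreedy d Q ∧
      (totalExcess d Q = 0 ∨ i + totalExcess d Q ≤ loopBound n d))
    ⟨[], ⟨hb, by rw [k1.1 2 (by norm_num), h2]; rfl, by simp, k2, fun _ => false, fun i => by
      rw [k1.2 7 (by norm_num), h7]; rfl⟩, .nil, .inr ?_⟩ ?_
  · obtain ⟨Q, q1, q2, q3⟩ := this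
    exact ⟨Q, q1, q2, by omega⟩
  · rw [zero_add]; exact totalExcess_nil_le h.two_le h.one_le
  · rintro i hi s' ⟨Q, q1, q2, q3⟩
    obtain ⟨Q', r1, r2, r3⟩ := run_step (q1.setReg (x := 17) (by norm_num) i) q2
    exact ⟨Q', r1, r2, by omega⟩

end Queries

end JuntaLearning

namespace JuntaLearning

open Memory

/-! ### The commands that infer the target -/

/-- The queries do not refute that the target depends only on the variables of the tuple. -/
def Consistent {n d : ℕ} (f : BoolFun n) (Q : List (Assignment n)) (σ : Fin d → Fin n) : Prop :=
  ∀ x ∈ Q, ∀ y ∈ Q, x ∘ σ = y ∘ σ → f x = f y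

/-! ### Why the answers determine the target. -/

section Inference

variable {n d : ℕ} {f : BoolFun n} {Q : List (Assignment n)}

/-- If the queries do not refute that the target depends only on at most `d` given variables, then
it does, and the queries show its value everywhere. -/
theorem eq_true_iff_exists_query (hn : 1 ≤ n) (hQ : totalExcess d Q = 0) (hf : f ∈ Junta n d)
    {S : Set (Fin n)} (hS : S.ncard ≤ d)
    (hc : ∀ x ∈ Q, ∀ y ∈ Q, (∀ i ∈ S, x i = y i) → f x = f y) (a : Assignment n) :
    f a = true ↔ ∃ x ∈ Q, f x = true ∧ ∀ i ∈ S, x i = a i := by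
  classical
  -- The function that the queries suggest. It depends only on `S`, so it is a junta, and by `hc` it
  -- agrees with `f` on the queries; hence it equals `f`.
  set g : BoolFun n := fun a => decide (∃ x ∈ Q, f x = true ∧ ∀ i ∈ S, x i = a i) with hg
  have hgS : ∀ x y : Assignment n, (∀ i ∈ S, x i = y i) → g x = g y := fun x y h => by
    simp only [hg]
    congr 1
    simp only [eq_iff_iff]
    exact exists_congr fun q => and_congr_right fun _ => and_congr_right fun _ =>
      forall₂_congr fun i hi => by rw [h i hi]
  have hfg : f = g := eq_of_agree_on_queries hn hQ hf (mem_junta_of_depends hS hgS) fun q hq => by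
    rw [Bool.eq_iff_iff]
    simp only [hg, decide_eq_true_iff]
    exact ⟨fun h => ⟨q, hq, h, fun _ _ => rfl⟩, fun ⟨x, hx, hfx, h⟩ => by
      rw [← hc x hx q hq h, hfx]⟩
  conv_lhs => rw [hfg]
  simp [hg]

/-- The target depends only on the variables of a consistent tuple, which therefore lists all
relevant ones. Conversely, a tuple that lists them is consistent, and it can be padded so as to
avoid a given irrelevant variable. -/
theorem relevant_iff (hn : 2 ≤ n) (hQ : totalExcess d Q = 0) (hf : f ∈ Junta n d) (i : Fin n) :
    Relevant f i ↔ ∀ σ : Fin d → Fin n, Consistent f Q σ → i ∈ Set.range σ := by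
  constructor
  · intro hi σ hσ
    have hcard : (Set.range σ).ncard ≤ d := by
      rw [← Set.image_univ]
      exact (Set.ncard_image_le Set.finite_univ).trans (by simp [Set.ncard_univ])
    have key := eq_true_iff_exists_query (by omega) hQ hf hcard fun x hx y hy h =>
      hσ x hx y hy (funext fun j => h _ ⟨j, rfl⟩)
    refine Relevant.of_depends (fun x y h => ?_) hi
    rw [Bool.eq_iff_iff, key, key]
    exact exists_congr fun q => and_congr_right fun _ => and_congr_right fun _ =>
      forall₂_congr fun i hi => by rw [h i hi]
  · intro h
    by_contra hi
    -- Tuples have exactly `d` entries, so padding needs a variable other than `i`; this is where `2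
    -- ≤ n` is used.
    have : Nontrivial (Fin n) := Fin.nontrivial_iff_two_le.2 hn
    obtain ⟨i₀, hi₀⟩ := exists_ne i
    obtain ⟨σ, h1, h2⟩ := exists_tuple hf i₀
    have := h2 (h σ fun x _ y _ hxy => eq_of_agree_on_relevant fun k hk => by
      obtain ⟨j, rfl⟩ := h1 hk
      exact congrFun hxy j)
    rcases this with rfl | h3
    · exact hi₀ rfl
    · exact hi h3

end Inference

namespace Expr

/-- The value of the query with the number in register `r` at a variable. -/
def queryValue (r : ℕ) (i : Expr) : Expr := load 0 (add (mul (reg r) (reg 0)) i)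

/-- The number of pairs of queries that refute that the target depends only on the variables of the
tuple in register 10. -/
def conflicts : Expr :=
  sum 18 (reg 2) <| sum 19 (reg 2) <|
    ite (eq (proj (queryValue 18 (entry 10 15))) (proj (queryValue 19 (entry 10 15))))
      (ite (eq (load 1 (reg 18)) (load 1 (reg 19))) (const 0) (const 1)) (const 0)

/-- The number of the consistent tuples that do not list the variable in register 16. -/
def avoiding : Expr :=
  sum 10 (reg 5) <| ite (load 8 (reg 10))
    (eq (sum 15 (reg 1) (eq (entry 10 15) (reg 16))) (const 0)) (const 0)

/-- The number of the queries with answer 1 that have the binary digits of register 20 as values of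
the relevant variables. -/
def matching : Expr :=
  sum 18 (reg 2) <| ite (load 1 (reg 18))
    (eq (sum 15 (reg 3) (ite (eq (queryValue 18 (load 2 (reg 15))) (bit 20 15)) (const 0) (const 1)))
      (const 0)) (const 0)

end Expr

namespace Cmd

/-- Find the consistent tuples. -/
def checkTuples : Cmd := loop 10 (.reg 5) (store 8 (.reg 10) (.eq .conflicts (.const 0)))

/-- List the relevant variables. -/
def listRelevant : Cmd :=
  .seq (assign 3 (.const 0)) <| loop 16 (.reg 0) <| when (.eq .avoiding (.const 0)) <|
    .seq (store 2 (.reg 3) (.reg 16)) (assign 3 (.add (.reg 3) (.const 1)))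

/-- Write the truth table. -/
def writeTable : Cmd :=
  loop 20 (.reg 6) (store 3 (.reg 20) (.ite .matching (.const 1) (.const 0)))

/-- Infer the target from the answers. -/
def infer : Cmd := .seq checkTuples (.seq listRelevant writeTable)

end Cmd

/-- The memory holds the queries and the answers of the target. -/
structure HasAnswers (n d : ℕ) (f : BoolFun n) (Q : List (Assignment n)) (s : Memory) : Prop where
  base : Base n d s
  length : s.reg 2 = Q.length
  le : Q.length ≤ loopBound n d
  queries : ∀ q x, Q[q]? = some x → ∀ i : Fin n, s.arr 0 (q * n + i) = (x i).toNat
  answers : ∀ q x, Q[q]? = some x → s.arr 1 q = (f x).toNat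

/-! ### Correctness of the inference commands. -/

section InferenceRun

variable {n d : ℕ} {f : BoolFun n} {Q : List (Assignment n)} {s : Memory}

theorem Base.setReg_three (h : Base n d s) (v : ℕ) : Base n d (s.setReg 3 v) :=
  ⟨h.two_le, h.one_le, h.le, h.reg_zero, h.reg_one, h.reg_four, h.reg_five, h.reg_six, h.pow_n,
    h.pow_two⟩

theorem HasAnswers.setReg (h : HasAnswers n d f Q s) {x : ℕ} (hx : 7 ≤ x) (v : ℕ) :
    HasAnswers n d f Q (s.setReg x v) where
  base := h.base.setReg hx v
  length := by rw [setReg_reg, if_neg (by omega), h.length]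
  le := h.le
  queries := h.queries
  answers := h.answers

theorem HasAnswers.setReg_three (h : HasAnswers n d f Q s) (v : ℕ) :
    HasAnswers n d f Q (s.setReg 3 v) :=
  ⟨h.base.setReg_three v, h.length, h.le, h.queries, h.answers⟩

theorem HasAnswers.setCell (h : HasAnswers n d f Q s) {a : ℕ} (ha : a ≠ 0 ∧ a ≠ 1 ∧ a ≠ 4 ∧ a ≠ 5)
    (j v : ℕ) : HasAnswers n d f Q (s.setCell a j v) where
  base := h.base.setCell ha.2.2.1 ha.2.2.2 j v
  length := h.length
  le := h.le
  queries := fun q x hq i => by simp [setCell_arr, Ne.symm ha.1, h.queries q x hq i]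
  answers := fun q x hq => by simp [setCell_arr, Ne.symm ha.2.1, h.answers q x hq]

theorem HasAnswers.eval_sum_query (h : HasAnswers n d f Q s) (x : ℕ) (e : Expr) :
    (Expr.sum x (.reg 2) e).eval s = ∑ q : Fin Q.length, e.eval (s.setReg x q) := by
  rw [Expr.eval_sum (b := .reg 2) (m := Q.length) h.length
    (by rw [h.base.reg_four]; exact h.le), Finset.sum_range]

theorem HasAnswers.eval_queryValue (h : HasAnswers n d f Q s) {r : ℕ} (hr : r ≠ 30)
    {q : Fin Q.length} (hq : s.reg r = q) {e : Expr} {i : Fin n} (he : e.eval s = i) :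
    (Expr.queryValue r e).eval s = (Q[q] i).toNat := by
  rw [Expr.queryValue, Expr.eval_load, Expr.eval_add, he, Expr.eval_mul (by simp [setReg_reg, hr])]
  · rw [Expr.eval_reg, Expr.eval_reg, hq, h.base.reg_zero]
    exact h.queries q _ (by simp) i
  · rw [Expr.eval_reg, h.base.reg_zero, h.base.reg_four]
    exact le_loopBound h.base.two_le h.base.one_le

theorem HasAnswers.eval_proj_query (h : HasAnswers n d f Q s) {σ : Fin d → Fin n}
    (hσ : s.reg 10 = tupleCode σ) {r : ℕ} (hr : r ≠ 30 ∧ r ≠ 15) {q : Fin Q.length}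
    (hq : s.reg r = q) :
    (Expr.proj (.queryValue r (.entry 10 15))).eval s = code (Q[q] ∘ σ) := by
  refine Expr.eval_proj h.base fun j => ?_
  have h' := h.setReg (x := 15) (by norm_num) j
  exact h'.eval_queryValue hr.1 (by simp [setReg_reg, hr.2, hq])
    (Expr.eval_entry h'.base (by norm_num) (by norm_num) (by simp [setReg_reg, hσ])
      (by simp [setReg_reg]))

theorem HasAnswers.eval_conflicts (h : HasAnswers n d f Q s) {σ : Fin d → Fin n}
    (hσ : s.reg 10 = tupleCode σ) : Expr.conflicts.eval s = 0 ↔ Consistent f Q σ := by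
  have key : Expr.conflicts.eval s = ∑ q : Fin Q.length, ∑ q' : Fin Q.length,
      if Q[q] ∘ σ = Q[q'] ∘ σ ∧ f Q[q] ≠ f Q[q'] then 1 else 0 := by
    rw [Expr.conflicts, h.eval_sum_query]
    refine Finset.sum_congr rfl fun q _ => ?_
    have h1 := h.setReg (x := 18) (by norm_num) q
    rw [h1.eval_sum_query]
    refine Finset.sum_congr rfl fun q' _ => ?_
    have h2 := h1.setReg (x := 19) (by norm_num) q'
    have ha : ∀ q : Fin Q.length, s.arr 1 q = (f Q[q]).toNat := fun q => h.answers q _ (by simp)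
    rw [Expr.eval_ite, Expr.eval_eq, h2.eval_proj_query (σ := σ) (q := q)
      (by simp [setReg_reg, hσ]) (by norm_num) (by simp [setReg_reg]),
      h2.eval_proj_query (σ := σ) (q := q') (by simp [setReg_reg, hσ]) (by norm_num)
      (by simp [setReg_reg])]
    simp only [code_injective.eq_iff, Expr.eval_ite, Expr.eval_eq, Expr.eval_load, Expr.eval_reg,
      setReg_reg, setReg_arr, Expr.eval_const, if_true, if_neg (show (18 : ℕ) ≠ 19 by norm_num), ha]
    by_cases h1 : Q[q] ∘ σ = Q[q'] ∘ σ
    · cases f Q[q] <;> cases f Q[q'] <;> simp_all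
    · simp_all
  simp only [key, Finset.sum_eq_zero_iff, Finset.mem_univ, true_imp_iff, Consistent]
  constructor
  · intro hq x hx y hy hxy
    obtain ⟨i, hi, rfl⟩ := List.mem_iff_getElem.1 hx
    obtain ⟨j, hj, rfl⟩ := List.mem_iff_getElem.1 hy
    have := hq ⟨i, hi⟩ ⟨j, hj⟩
    by_contra hne
    simp_all
  · intro hc q q'
    rw [if_neg]
    rintro ⟨h1, h2⟩
    exact h2 (hc _ (List.getElem_mem _) _ (List.getElem_mem _) h1)

/-- Array 8 contains the consistent tuples. -/
def HasConsistent (n d : ℕ) (f : BoolFun n) (Q : List (Assignment n)) (s : Memory) : Prop :=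
  ∀ σ : Fin d → Fin n, s.arr 8 (tupleCode σ) ≠ 0 ↔ Consistent f Q σ

theorem HasAnswers.run_checkTuples (h : HasAnswers n d f Q s) :
    HasAnswers n d f Q (Cmd.checkTuples.run s) ∧ HasConsistent n d f Q (Cmd.checkTuples.run s) := by
  have := Cmd.run_loop_induction (x := 10) (m := n ^ d) (b := .reg 5)
    (c := .store 8 (.reg 10) (.eq .conflicts (.const 0))) (s := s) h.base.reg_five
    (by rw [h.base.reg_four]; exact pow_le_loopBound h.base.two_le (by omega))
    (fun i s' => HasAnswers n d f Q s' ∧ ∀ σ : Fin d → Fin n, tupleCode σ < i →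
      (s'.arr 8 (tupleCode σ) ≠ 0 ↔ Consistent f Q σ)) ⟨h, by simp⟩ ?_
  · exact ⟨this.1, fun σ => this.2 σ (tupleCode_lt σ)⟩
  · rintro i hi s' ⟨h1, h2⟩
    obtain ⟨σ, rfl⟩ := exists_tupleCode hi
    have h3 := h1.setReg (x := 10) (by norm_num) (tupleCode σ)
    have h4 := h3.eval_conflicts (σ := σ) (by simp [setReg_reg])
    rw [Cmd.run]
    refine ⟨h3.setCell (by norm_num) _ _, fun τ hτ => ?_⟩
    simp only [setCell_arr, Expr.eval_reg, setReg_reg, if_true, true_and, Expr.eval_eq,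
      Expr.eval_const, setReg_arr]
    by_cases hst : tupleCode τ = tupleCode σ
    · obtain rfl : τ = σ := finFunctionFinEquiv.injective (Fin.ext hst)
      rw [if_pos rfl, ← h4]
      split_ifs with h0 <;> simp [h0]
    · rw [if_neg hst, h2 τ (by omega)]

theorem HasAnswers.eval_avoiding (h : HasAnswers n d f Q s) (hc : HasConsistent n d f Q s)
    {i : Fin n} (hi : s.reg 16 = i) : Expr.avoiding.eval s = 0 ↔
      ∀ σ : Fin d → Fin n, Consistent f Q σ → i ∈ Set.range σ := by
  rw [Expr.avoiding, Expr.eval_sum_tuple h.base]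
  simp only [Finset.sum_eq_zero_iff, Finset.mem_univ, true_imp_iff]
  refine forall_congr' fun σ => ?_
  have h1 := h.setReg (x := 10) (by norm_num) (tupleCode σ)
  have hsum : (Expr.sum 15 (.reg 1) (.eq (.entry 10 15) (.reg 16))).eval
      (s.setReg 10 (tupleCode σ)) = ∑ j : Fin d, if σ j = i then 1 else 0 := by
    rw [Expr.eval_sum (b := .reg 1) (m := d) h1.base.reg_one (by
      have := two_mul_le_loopBound (d := d) h.base.two_le
      rw [h1.base.reg_four]; omega), Finset.sum_range]
    refine Finset.sum_congr rfl fun j _ => ?_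
    have h2 := h1.setReg (x := 15) (by norm_num) j
    rw [Expr.eval_eq, Expr.eval_entry h2.base (by norm_num) (by norm_num) (σ := σ) (j := j)
      (by simp [setReg_reg]) (by simp [setReg_reg])]
    simp [setReg_reg, hi, Fin.ext_iff]
  rw [Expr.eval_ite, Expr.eval_eq, hsum, Expr.eval_load, Expr.eval_reg, setReg_reg, if_pos rfl,
    setReg_arr]
  have := hc σ
  by_cases hσ : Consistent f Q σ
  · rw [if_neg (this.2 hσ)]
    simp [hσ]
  · have h0 : s.arr 8 (tupleCode σ) = 0 := by by_contra hne; exact hσ (this.1 hne)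
    simp [h0, hσ]

/-- Register 3 and array 2 contain the list of variables. -/
def HasList (n : ℕ) (l : List (Fin n)) (s : Memory) : Prop :=
  s.reg 3 = l.length ∧ ∀ (j : ℕ) (i : Fin n), l[j]? = some i → s.arr 2 j = i

/-- The variables are scanned in increasing order, so the list comes out sorted. -/
theorem HasAnswers.run_listRelevant (h : HasAnswers n d f Q s) (hc : HasConsistent n d f Q s)
    (hQ : totalExcess d Q = 0) (hf : f ∈ Junta n d) :
    HasAnswers n d f Q (Cmd.listRelevant.run s) ∧ ∃ l : List (Fin n), l.Pairwise (· < ·) ∧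
      (∀ i, i ∈ l ↔ Relevant f i) ∧ HasList n l (Cmd.listRelevant.run s) := by
  rw [Cmd.listRelevant, Cmd.run]
  have h3 : (Cmd.assign 3 (.const 0)).run s = s.setReg 3 0 := by simp [Cmd.run]
  rw [h3]
  have hb := h.setReg_three 0
  have := Cmd.run_loop_induction (x := 16) (m := n) (b := .reg 0)
    (c := .when (.eq .avoiding (.const 0)) <|
      .seq (.store 2 (.reg 3) (.reg 16)) (.assign 3 (.add (.reg 3) (.const 1))))
    (s := s.setReg 3 0) hb.base.reg_zero
    (by rw [hb.base.reg_four]; exact le_loopBound h.base.two_le h.base.one_le)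
    (fun i s' => HasAnswers n d f Q s' ∧ HasConsistent n d f Q s' ∧ ∃ l : List (Fin n),
      l.Pairwise (· < ·) ∧ (∀ k, k ∈ l ↔ Relevant f k ∧ (k : ℕ) < i) ∧ HasList n l s')
    ⟨hb, hc, [], by simp, by simp, by simp [HasList, setReg_reg]⟩ ?_
  · obtain ⟨k1, -, l, k2, k3, k4⟩ := this
    exact ⟨k1, l, k2, fun i => by simp [k3 i], k4⟩
  · rintro i hi s' ⟨k1, k2, l, l1, l2, l3, l4⟩
    have k3 := k1.setReg (x := 16) (by norm_num) i
    have k4 := k3.eval_avoiding (i := ⟨i, hi⟩) k2 (by simp [setReg_reg])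
    rw [← relevant_iff h.base.two_le hQ hf] at k4
    rw [Cmd.run, Expr.eval_eq, Expr.eval_const]
    by_cases hrel : Relevant f ⟨i, hi⟩
    · rw [if_pos (k4.2 hrel), if_pos one_ne_zero, Cmd.run]
      have e1 : (Cmd.store 2 (.reg 3) (.reg 16)).run (s'.setReg 16 i) =
          (s'.setReg 16 i).setCell 2 l.length i := by simp [Cmd.run, setReg_reg, l3]
      have e2 : (Cmd.assign 3 (.add (.reg 3) (.const 1))).run
          ((s'.setReg 16 i).setCell 2 l.length i) =
          ((s'.setReg 16 i).setCell 2 l.length i).setReg 3 (l.length + 1) := by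
        simp [Cmd.run, setReg_reg, l3]
      rw [e1, e2]
      refine ⟨(k3.setCell (by norm_num) _ _).setReg_three _, fun σ => ?_, l ++ [⟨i, hi⟩], ?_,
        fun k => ?_, by simp [setReg_reg], fun j k hjk => ?_⟩
      · simpa [setCell_arr] using k2 σ
      · rw [List.pairwise_append]
        exact ⟨l1, by simp, fun a ha b hb => by
          obtain rfl : b = ⟨i, hi⟩ := by simpa using hb
          exact Fin.lt_def.2 ((l2 a).1 ha).2⟩
      · rw [List.mem_append, l2, List.mem_singleton]
        constructor
        · rintro (⟨a1, a2⟩ | rfl)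
          · exact ⟨a1, by omega⟩
          · exact ⟨hrel, by simp⟩
        · rintro ⟨a1, a2⟩
          rcases Nat.lt_succ_iff_lt_or_eq.1 a2 with a3 | a3
          · exact .inl ⟨a1, a3⟩
          · exact .inr (Fin.ext a3)
      · rcases lt_trichotomy j l.length with hj | rfl | hj
        · rw [List.getElem?_append_left hj] at hjk
          simp [setCell_arr, hj.ne, l4 j k hjk]
        · obtain rfl : ⟨i, hi⟩ = k := by simpa using hjk
          simp [setCell_arr]
        · rw [List.getElem?_eq_none (by simp; omega)] at hjk
          simp at hjk
    · rw [if_neg (fun h => hrel (k4.1 h)), if_neg (by simp)]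
      refine ⟨k3, k2, l, l1, fun k => ?_, by simpa [setReg_reg] using l3, l4⟩
      rw [l2]
      refine and_congr_right fun hk => ⟨fun h => by omega, fun h => ?_⟩
      rcases Nat.lt_succ_iff_lt_or_eq.1 h with a3 | a3
      · exact a3
      · obtain rfl : k = ⟨i, hi⟩ := Fin.ext a3
        exact absurd hk hrel

/-- Positions from `l.length` on impose no condition, as `l[j]?` is `none` there. So the table is
filled for all bit vectors of length `d`, although fewer variables may be relevant. -/
theorem HasAnswers.eval_matching (h : HasAnswers n d f Q s) {l : List (Fin n)} (hl : HasList n l s)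
    (hld : l.length ≤ d) {u : Fin d → Bool} (hu : s.reg 20 = code u) :
    Expr.matching.eval s ≠ 0 ↔ ∃ x ∈ Q, f x = true ∧ ∀ (j : Fin d) (i : Fin n),
      l[(j : ℕ)]? = some i → x i = u j := by
  have key : Expr.matching.eval s = ∑ q : Fin Q.length, if f Q[q] = true ∧
      ∀ (j : Fin d) (i : Fin n), l[(j : ℕ)]? = some i → Q[q] i = u j then 1 else 0 := by
    rw [Expr.matching, h.eval_sum_query]
    refine Finset.sum_congr rfl fun q _ => ?_
    have h1 := h.setReg (x := 18) (by norm_num) q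
    have ha : s.arr 1 q = (f Q[q]).toNat := h.answers q _ (by simp)
    have hsum : (Expr.sum 15 (.reg 3) (.ite (.eq (.queryValue 18 (.load 2 (.reg 15))) (.bit 20 15))
        (.const 0) (.const 1))).eval (s.setReg 18 q) = 0 ↔
        ∀ (j : Fin d) (i : Fin n), l[(j : ℕ)]? = some i → Q[q] i = u j := by
      rw [Expr.eval_sum (b := .reg 3) (m := l.length) (by simp [setReg_reg, hl.1]) (by
        have := two_mul_le_loopBound (d := d) h.base.two_le
        rw [h1.base.reg_four]; omega)]
      simp only [Finset.sum_eq_zero_iff, Finset.mem_range]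
      have hterm : ∀ (j : Fin d) (hj : (j : ℕ) < l.length),
          (Expr.ite (.eq (.queryValue 18 (.load 2 (.reg 15))) (.bit 20 15))
            (.const 0) (.const 1)).eval ((s.setReg 18 q).setReg 15 j) = 0 ↔
          Q[q] l[(j : ℕ)] = u j := by
        intro j hj
        have h2 := h1.setReg (x := 15) (by norm_num) j
        rw [Expr.eval_ite, Expr.eval_eq, h2.eval_queryValue (q := q) (i := l[(j : ℕ)])
          (by norm_num) (by simp [setReg_reg]) (by
            simp only [Expr.eval_load, Expr.eval_reg, setReg_reg, setReg_arr, if_true]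
            exact hl.2 j _ (by simp [hj])),
          Expr.eval_bit h2.base (by norm_num) (by norm_num) (u := u) (j := j)
          (by simp [setReg_reg, hu]) (by simp [setReg_reg])]
        cases Q[q] l[(j : ℕ)] <;> cases u j <;> simp
      constructor
      · intro hall j i hji
        obtain ⟨hj, rfl⟩ := List.getElem?_eq_some_iff.1 hji
        exact (hterm j hj).1 (hall j hj)
      · intro hall j hj
        exact (hterm ⟨j, by omega⟩ hj).2 (hall ⟨j, by omega⟩ _ (by simp [hj]))
    rw [Expr.eval_ite, Expr.eval_eq, Expr.eval_const, Expr.eval_load, Expr.eval_reg,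
      setReg_reg, if_pos rfl, setReg_arr, ha]
    simp only [hsum]
    cases hfq : f Q[q] <;> simp
  rw [key, ne_eq, Finset.sum_eq_zero_iff]
  simp only [Finset.mem_univ, true_imp_iff, not_forall]
  constructor
  · rintro ⟨q, hq⟩
    refine ⟨Q[q], List.getElem_mem _, ?_⟩
    by_contra hne
    exact hq (if_neg hne)
  · rintro ⟨x, hx, hfx⟩
    obtain ⟨q, hq, rfl⟩ := List.mem_iff_getElem.1 hx
    exact ⟨⟨q, hq⟩, by rw [if_pos (by exact hfx)]; exact one_ne_zero⟩

theorem HasAnswers.run_writeTable (h : HasAnswers n d f Q s) {l : List (Fin n)}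
    (hl : HasList n l s) (hld : l.length ≤ d) : HasList n l (Cmd.writeTable.run s) ∧
      ∀ u : Fin d → Bool, (Cmd.writeTable.run s).arr 3 (code u) ≤ 1 ∧
        ((Cmd.writeTable.run s).arr 3 (code u) ≠ 0 ↔ ∃ x ∈ Q, f x = true ∧
          ∀ (j : Fin d) (i : Fin n), l[(j : ℕ)]? = some i → x i = u j) := by
  have := Cmd.run_loop_induction (x := 20) (m := 2 ^ d) (b := .reg 6)
    (c := .store 3 (.reg 20) (.ite .matching (.const 1) (.const 0))) (s := s) h.base.reg_six
    (by rw [h.base.reg_four]; exact two_pow_le_loopBound h.base.two_le (by omega))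
    (fun i s' => HasAnswers n d f Q s' ∧ HasList n l s' ∧ ∀ u : Fin d → Bool, code u < i →
      s'.arr 3 (code u) ≤ 1 ∧ (s'.arr 3 (code u) ≠ 0 ↔ ∃ x ∈ Q, f x = true ∧
        ∀ (j : Fin d) (i : Fin n), l[(j : ℕ)]? = some i → x i = u j)) ⟨h, hl, by simp⟩ ?_
  · exact ⟨this.2.1, fun u => this.2.2 u (code_lt u)⟩
  · rintro w hw s' ⟨k1, ⟨l1, l2⟩, k2⟩
    obtain ⟨u, rfl⟩ : ∃ u : Fin d → Bool, code u = w :=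
      ⟨(codeEquiv d).symm ⟨w, hw⟩, by rw [← codeEquiv_val, Equiv.apply_symm_apply]⟩
    have k3 := k1.setReg (x := 20) (by norm_num) (code u)
    have k4 := k3.eval_matching (l := l) ⟨by simp [setReg_reg, l1], l2⟩ hld (u := u)
      (by simp [setReg_reg])
    rw [Cmd.run]
    refine ⟨k3.setCell (by norm_num) _ _, ⟨by simp [setReg_reg, l1], fun j i hji => by
      simp [setCell_arr, l2 j i hji]⟩, fun v hv => ?_⟩
    simp only [setCell_arr, Expr.eval_reg, setReg_reg, if_true, true_and, Expr.eval_ite,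
      Expr.eval_const, setReg_arr]
    by_cases hvu : code v = code u
    · obtain rfl := code_injective hvu
      rw [if_pos rfl, ← k4]
      split_ifs with h0 <;> simp [h0]
    · rw [if_neg hvu]
      exact k2 v (by omega)

theorem HasAnswers.describes (h : HasAnswers n d f Q s) (hQ : totalExcess d Q = 0)
    (hf : f ∈ Junta n d) : (Cmd.infer.run s).Describes f := by
  obtain ⟨k1, k2⟩ := h.run_checkTuples
  rw [Cmd.infer, Cmd.run, Cmd.run]
  set s₁ := Cmd.checkTuples.run s
  obtain ⟨k3, l, l1, l2, l3⟩ := k1.run_listRelevant k2 hQ hf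
  set s₂ := Cmd.listRelevant.run s₁
  have hset : {i | Relevant f i} = (l.toFinset : Set (Fin n)) := by ext i; simp [l2]
  have hld : l.length ≤ d := by
    have : {i | Relevant f i}.ncard ≤ d := hf
    rwa [hset, Set.ncard_coe_finset, List.toFinset_card_of_nodup
      (l1.imp (fun h => h.ne))] at this
  obtain ⟨⟨k4, k5⟩, k6⟩ := k3.run_writeTable l3 hld
  set s₃ := Cmd.writeTable.run s₂
  refine ⟨fun j => l[(j : ℕ)]'(j.2.trans_eq k4), ?_, ?_, ?_, ?_⟩
  · intro i j hij
    exact List.pairwise_iff_getElem.1 l1 _ _ _ _ hij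
  · ext i
    rw [Set.mem_range, Set.mem_ofPred_eq, ← l2, List.mem_iff_getElem]
    exact ⟨fun ⟨j, hj⟩ => ⟨j, _, hj⟩, fun ⟨j, hj, hji⟩ => ⟨⟨j, hj.trans_eq k4.symm⟩, hji⟩⟩
  · intro j
    exact k5 j _ (by simp [j.2.trans_eq k4])
  · intro a
    -- Padding by `false` leaves the code unchanged, so the index over the listed variables is the
    -- code of a bit vector of length `d`.
    let u : Fin d → Bool := fun j => if h : (j : ℕ) < l.length then a l[(j : ℕ)] else false
    have hcode : ∑ j : Fin (s₃.reg 3), (a (l[(j : ℕ)]'(j.2.trans_eq k4))).toNat * 2 ^ (j : ℕ) =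
        code u := by
      let F : ℕ → ℕ := fun j => (if h : j < l.length then a l[j] else false).toNat * 2 ^ j
      have h1 : ∑ j : Fin (s₃.reg 3), (a (l[(j : ℕ)]'(j.2.trans_eq k4))).toNat * 2 ^ (j : ℕ) =
          ∑ j ∈ Finset.range (s₃.reg 3), F j := by
        rw [Finset.sum_range]
        exact Finset.sum_congr rfl fun j _ => by simp [F, j.2.trans_eq k4]
      have h2 : code u = ∑ j ∈ Finset.range d, F j := by rw [Finset.sum_range]; rfl
      rw [h1, h2, k4]
      refine Finset.sum_subset (Finset.range_mono hld) fun j _ hj => ?_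
      simp only [Finset.mem_range] at hj
      simp [F, hj]
    obtain ⟨h1, h2⟩ := k6 u
    have h3 := eq_true_iff_exists_query (S := {i | Relevant f i})
      (by have := h.base.two_le; omega) hQ hf hf
      (fun x _ y _ hxy => eq_of_agree_on_relevant hxy) a
    have h4 : (∃ x ∈ Q, f x = true ∧ ∀ (j : Fin d) (i : Fin n), l[(j : ℕ)]? = some i → x i = u j) ↔
        f a = true := by
      rw [h3]
      refine exists_congr fun x => and_congr_right fun _ => and_congr_right fun _ => ?_
      constructor
      · intro hx i hi
        obtain ⟨j, hj, rfl⟩ := List.mem_iff_getElem.1 ((l2 i).2 hi)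
        rw [hx ⟨j, by omega⟩ _ (by simp [hj])]
        simp [u, hj]
      · intro hx j i hji
        obtain ⟨hj, rfl⟩ := List.getElem?_eq_some_iff.1 hji
        rw [hx _ ((l2 _).1 (List.getElem_mem hj))]
        simp [u, hj]
    rw [h4] at h2
    rw [hcode]
    cases hfa : f a
    · rw [hfa] at h2
      simpa using h2
    · rw [hfa] at h2
      have := h2.2 rfl
      simp only [Bool.toNat_true]
      omega

end InferenceRun

end JuntaLearning

namespace JuntaLearning

open Memory

/-! ### The whole algorithm -/

namespace Cmd

theorem run_seq (c c' : Cmd) (s : Memory) : (seq c c').run s = c'.run (c.run s) := rfl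

theorem run_assign (x : ℕ) (e : Expr) (s : Memory) :
    (assign x e).run s = s.setReg x (e.eval s) := rfl

theorem run_store (a : ℕ) (j e : Expr) (s : Memory) :
    (store a j e).run s = s.setCell a (j.eval s) (e.eval s) := rfl

/-- Compute `n ^ d`, `2 ^ d` and the bound on all loops. -/
def powers : Cmd :=
  .seq (assign 5 (.const 1)) <| .seq (assign 6 (.const 1)) <| .seq (assign 7 (.const 1)) <|
  loop 16 (.reg 1) <|
    .seq (assign 5 (.mul (.reg 5) (.reg 0))) <| .seq (assign 6 (.add (.reg 6) (.reg 6))) <|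
    assign 7 (.mul (.mul (.mul (.mul (.reg 7) (.reg 0)) (.reg 0)) (.reg 0)) (.reg 0))

/-- Compute the powers of `n` and of 2. -/
def tables : Cmd :=
  .seq (store 4 (.const 0) (.const 1)) <| .seq (store 5 (.const 0) (.const 1)) <|
  loop 16 (.reg 1) <|
    .seq (store 4 (.add (.reg 16) (.const 1)) (.mul (.load 4 (.reg 16)) (.reg 0))) <|
    store 5 (.add (.reg 16) (.const 1)) (.add (.load 5 (.reg 16)) (.load 5 (.reg 16)))

end Cmd

/-- The learning algorithm. -/
def learner : NonadaptiveAlgorithm where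
  ask := .seq (.const 4 0) <| .seq (.add 4 0 4) <| .seq (Cmd.powers.compile 40) <|
    .seq (.const 4 0) <| .seq (.add 4 7 4) <| (Cmd.seq .tables .select).compile 40
  infer := Cmd.infer.compile 40

section Run

variable {n d : ℕ} {s s' : Memory}

/-- The cut-off `n` suffices: the loop makes `d ≤ n` rounds, and the second factor of each product,
which is its number of rounds, is `n`. -/
theorem run_powers (h0 : s.reg 0 = n) (h1 : s.reg 1 = d) (h4 : s.reg 4 = n) (hd : d ≤ n) :
    (Cmd.powers.run s).arr = s.arr ∧ (∀ x < 4, (Cmd.powers.run s).reg x = s.reg x) ∧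
      (Cmd.powers.run s).reg 5 = n ^ d ∧ (Cmd.powers.run s).reg 6 = 2 ^ d ∧
      (Cmd.powers.run s).reg 7 = loopBound n d := by
  rw [Cmd.powers]
  simp only [Cmd.run_seq, Cmd.run_assign, Expr.eval_const]
  have := Cmd.run_loop_induction (x := 16) (m := d) (b := .reg 1)
    (c := .seq (.assign 5 (.mul (.reg 5) (.reg 0))) <|
      .seq (.assign 6 (.add (.reg 6) (.reg 6))) <|
      .assign 7 (.mul (.mul (.mul (.mul (.reg 7) (.reg 0)) (.reg 0)) (.reg 0)) (.reg 0)))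
    (s := ((s.setReg 5 1).setReg 6 1).setReg 7 1) (by simp [setReg_reg, h1])
    (by simp [setReg_reg, h4, hd])
    (fun i s' => s'.arr = s.arr ∧ (∀ x < 5, s'.reg x = s.reg x) ∧ s'.reg 5 = n ^ i ∧
      s'.reg 6 = 2 ^ i ∧ s'.reg 7 = (n ^ 4) ^ i) ⟨rfl, fun x hx => by
        simp [setReg_reg, show x ≠ 5 by omega, show x ≠ 6 by omega, show x ≠ 7 by omega],
        by simp [setReg_reg], by simp [setReg_reg], by simp [setReg_reg]⟩ ?_
  · exact ⟨this.1, fun x hx => this.2.1 x (by omega), this.2.2⟩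
  · rintro i - s' ⟨k1, k2, k3, k4, k5⟩
    set s₁ := s'.setReg 16 i with hs₁
    have e1 : (Cmd.assign 5 (.mul (.reg 5) (.reg 0))).run s₁ = s₁.setReg 5 (n ^ (i + 1)) := by
      rw [Cmd.run, Expr.eval_mul (by simp [setReg_reg]) (by simp [hs₁, setReg_reg, k2, h0, h4])]
      simp [hs₁, setReg_reg, k2, h0, k3, pow_succ]
    set s₂ := s₁.setReg 5 (n ^ (i + 1)) with hs₂
    have e2 : (Cmd.assign 6 (.add (.reg 6) (.reg 6))).run s₂ = s₂.setReg 6 (2 ^ (i + 1)) := by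
      simp [Cmd.run, hs₂, hs₁, setReg_reg, k4, pow_succ, mul_two]
    set s₃ := s₂.setReg 6 (2 ^ (i + 1)) with hs₃
    have hmul : ∀ (e : Expr) (v : ℕ),
        (∀ s'' : Memory, (∀ x < 8, s''.reg x = s₃.reg x) → e.eval s'' = v) →
        ∀ s'' : Memory, (∀ x < 8, s''.reg x = s₃.reg x) → (Expr.mul e (.reg 0)).eval s'' = v * n := by
      intro e v he s'' hs''
      have hr0 : s''.reg 0 = n := by
        rw [hs'' 0 (by norm_num)]; simp [hs₃, hs₂, hs₁, setReg_reg, k2, h0]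
      have hr4 : s''.reg 4 = n := by
        rw [hs'' 4 (by norm_num)]; simp [hs₃, hs₂, hs₁, setReg_reg, k2, h4]
      rw [Expr.eval_mul (fun j => ?_) (by simp [hr0, hr4]), he s'' hs'', Expr.eval_reg, hr0]
      rw [he s'' hs'', he _ fun x hx => by
        rw [setReg_reg, if_neg (by omega), hs'' x hx]]
    have e3 : (Cmd.assign 7 (.mul (.mul (.mul (.mul (.reg 7) (.reg 0)) (.reg 0)) (.reg 0))
        (.reg 0))).run s₃ = s₃.setReg 7 ((n ^ 4) ^ (i + 1)) := by
      rw [Cmd.run, hmul _ _ (hmul _ _ (hmul _ _ (hmul _ ((n ^ 4) ^ i) fun s'' hs'' => ?_))) s₃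
        fun _ _ => rfl]
      · congr 1; ring
      · rw [Expr.eval_reg, hs'' 7 (by norm_num)]
        simp [hs₃, hs₂, hs₁, setReg_reg, k5]
    rw [Cmd.run_seq, Cmd.run_seq, e1, e2, e3]
    refine ⟨k1, fun x hx => ?_, ?_, ?_, ?_⟩
    · simp [hs₃, hs₂, hs₁, setReg_reg, show x ≠ 5 by omega, show x ≠ 6 by omega,
        show x ≠ 7 by omega, show x ≠ 16 by omega, k2 x hx]
    · simp [hs₃, hs₂, setReg_reg]
    · simp [hs₃, setReg_reg]
    · simp [setReg_reg]

theorem run_tables (hn : 2 ≤ n) (hd : 1 ≤ d) (hdn : d ≤ n) (h0 : s.reg 0 = n) (h1 : s.reg 1 = d)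
    (h2 : s.reg 2 = 0) (h4 : s.reg 4 = loopBound n d) (h5 : s.reg 5 = n ^ d)
    (h6 : s.reg 6 = 2 ^ d) (ha : ∀ a j, s.arr a j = 0) :
    Base n d (Cmd.tables.run s) ∧ (Cmd.tables.run s).reg 2 = 0 ∧
      ∀ i, (Cmd.tables.run s).arr 7 i = 0 := by
  have hN := le_loopBound hn hd
  rw [Cmd.tables, Cmd.run_seq, Cmd.run_seq]
  simp only [Cmd.run_store, Expr.eval_const]
  have := Cmd.run_loop_induction (x := 16) (m := d) (b := .reg 1)
    (c := .seq (.store 4 (.add (.reg 16) (.const 1)) (.mul (.load 4 (.reg 16)) (.reg 0))) <|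
      .store 5 (.add (.reg 16) (.const 1)) (.add (.load 5 (.reg 16)) (.load 5 (.reg 16))))
    (s := (s.setCell 4 0 1).setCell 5 0 1) (by simp [h1]) (by simp [h4]; omega)
    (fun i s' => (∀ x < 7, s'.reg x = s.reg x) ∧ (∀ j ≤ i, s'.arr 4 j = n ^ j) ∧
      (∀ j ≤ i, s'.arr 5 j = 2 ^ j) ∧ ∀ j, s'.arr 7 j = 0)
    ⟨fun _ _ => rfl, by simp [setCell_arr], by simp [setCell_arr], by simp [setCell_arr, ha]⟩ ?_
  · obtain ⟨k1, k2, k3, k4⟩ := this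
    refine ⟨⟨hn, hd, hdn, ?_, ?_, ?_, ?_, ?_, fun j hj => k2 j hj.le, fun j hj => k3 j hj.le⟩, ?_,
      k4⟩
    · rw [k1 0 (by norm_num), h0]
    · rw [k1 1 (by norm_num), h1]
    · rw [k1 4 (by norm_num), h4]
    · rw [k1 5 (by norm_num), h5]
    · rw [k1 6 (by norm_num), h6]
    · rw [k1 2 (by norm_num), h2]
  · rintro i - s' ⟨k1, k2, k3, k4⟩
    have e1 : (Cmd.store 4 (.add (.reg 16) (.const 1)) (.mul (.load 4 (.reg 16)) (.reg 0))).run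
        (s'.setReg 16 i) = (s'.setReg 16 i).setCell 4 (i + 1) (n ^ (i + 1)) := by
      rw [Cmd.run, Expr.eval_mul (by simp [setReg_reg]) (by simp [setReg_reg, k1, h0, h4, hN])]
      simp [setReg_reg, k1, h0, k2, pow_succ]
    have e2 : (Cmd.store 5 (.add (.reg 16) (.const 1))
        (.add (.load 5 (.reg 16)) (.load 5 (.reg 16)))).run
        ((s'.setReg 16 i).setCell 4 (i + 1) (n ^ (i + 1))) =
        ((s'.setReg 16 i).setCell 4 (i + 1) (n ^ (i + 1))).setCell 5 (i + 1) (2 ^ (i + 1)) := by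
      simp [Cmd.run, setReg_reg, setCell_arr, k3, pow_succ, mul_two]
    rw [Cmd.run, e1, e2]
    refine ⟨fun x hx => ?_, fun j hj => ?_, fun j hj => ?_, fun j => ?_⟩
    · simp [setReg_reg, show x ≠ 16 by omega, k1 x hx]
    · by_cases hji : j = i + 1
      · simp [setCell_arr, hji]
      · simp [setCell_arr, hji, k2 j (by omega)]
    · by_cases hji : j = i + 1
      · simp [setCell_arr, hji]
      · simp [setCell_arr, hji, k3 j (by omega)]
    · simp [setCell_arr, k4]

theorem Base.of_agree {k : ℕ} (hk : 6 < k) (h : Base n d s) (ha : Agree k s' s) : Base n d s' where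
  two_le := h.two_le
  one_le := h.one_le
  le := h.le
  reg_zero := by rw [ha.2 0 (by omega), h.reg_zero]
  reg_one := by rw [ha.2 1 (by omega), h.reg_one]
  reg_four := by rw [ha.2 4 (by omega), h.reg_four]
  reg_five := by rw [ha.2 5 (by omega), h.reg_five]
  reg_six := by rw [ha.2 6 (by omega), h.reg_six]
  pow_n := by rw [ha.1]; exact h.pow_n
  pow_two := by rw [ha.1]; exact h.pow_two

theorem describes_of_agree {k : ℕ} (hk : 3 < k) {f : BoolFun n} (ha : Agree k s' s)
    (h : s.Describes f) : s'.Describes f := by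
  have h3 : s'.reg 3 = s.reg 3 := ha.2 3 hk
  obtain ⟨v, h1, h2, h4, h5⟩ := h
  refine ⟨v ∘ finCongr h3, fun i j hij => h1 hij, ?_, fun j => ?_, fun a => ?_⟩
  · rw [(finCongr h3).surjective.range_comp, h2]
  · rw [ha.1]; exact h4 (finCongr h3 j)
  · rw [← h5 a, ha.1]
    congr 1
    exact (finCongr h3).sum_comp fun j => (a (v j)).toNat * 2 ^ (j : ℕ)

/-- The memory after the queries have been written down. -/
theorem exec_ask (hn : 2 ≤ n) (hd : 1 ≤ d) (hdn : d ≤ n) : ∃ (t : ℕ) (s₁ : Memory)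
    (Q : List (Assignment n)), Exec learner.ask (Memory.init n d) t s₁ ∧
      t ≤ Cmd.powers.cost n + (Cmd.seq .tables .select).cost (loopBound n d) + 4 ∧
      Base n d s₁ ∧ s₁.reg 2 = Q.length ∧
      (∀ q x, Q[q]? = some x → ∀ i : Fin n, s₁.arr 0 (q * n + i) = (x i).toNat) ∧
      IsGreedy d Q ∧ totalExcess d Q = 0 := by
  -- The cut-off is set outside the language, whose commands may not change register 4: to `n` here,
  -- and to `loopBound n d` in `s₂`.
  set s₀ := ((Memory.init n d).setReg 4 0).setReg 4 n with hs₀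
  have r0 : s₀.reg 0 = n := by simp [hs₀, setReg_reg, Memory.init]
  have r1 : s₀.reg 1 = d := by simp [hs₀, setReg_reg, Memory.init]
  have r2 : s₀.reg 2 = 0 := by simp [hs₀, setReg_reg, Memory.init]
  have r4 : s₀.reg 4 = n := by simp [hs₀, setReg_reg]
  obtain ⟨t₁, s₁, e₁, g₁, c₁⟩ := Cmd.exec_compile Cmd.powers 40 s₀ (by norm_num) (by decide) r4
  obtain ⟨p1, p2, p3, p4, p5⟩ := run_powers r0 r1 r4 hdn
  set s₂ := (s₁.setReg 4 0).setReg 4 (loopBound n d) with hs₂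
  have q7 : s₁.reg 7 = loopBound n d := by rw [g₁.2 7 (by norm_num), p5]
  have q : ∀ x < 4, s₂.reg x = s₀.reg x := fun x hx => by
    simp [hs₂, setReg_reg, hx.ne, g₁.2 x (by omega), p2 x hx]
  obtain ⟨b1, b2, b3⟩ := run_tables (s := s₂) hn hd hdn (by rw [q 0 (by norm_num), r0])
    (by rw [q 1 (by norm_num), r1]) (by rw [q 2 (by norm_num), r2]) (by simp [hs₂, setReg_reg])
    (by simp [hs₂, setReg_reg, g₁.2 5, p3]) (by simp [hs₂, setReg_reg, g₁.2 6, p4])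
    (fun a j => by change s₁.arr a j = 0; rw [g₁.1, p1]; rfl)
  obtain ⟨Q, k1, k2, k3⟩ := run_select b1 b2 b3
  obtain ⟨t₂, s₃, e₂, g₂, c₂⟩ := Cmd.exec_compile (Cmd.seq .tables .select) 40 s₂ (by norm_num)
    (by decide) (show s₂.reg 4 = loopBound n d by simp [hs₂, setReg_reg])
  rw [Cmd.run] at g₂
  refine ⟨_, s₃, Q, .seq (.const ..) (.seq (.add ..) (.seq (t₁ := t₁) (s₁ := s₁) ?_
    (.seq (.const ..) (.seq (.add ..) (t₂ := t₂) ?_)))), by omega, k1.base.of_agree (by norm_num) g₂,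
    by rw [g₂.2 2 (by norm_num), k1.length], by rw [g₂.1]; exact k1.queries, k2, k3⟩
  · simpa [hs₀, setReg_reg, Memory.init] using e₁
  · simpa [setReg_reg, q7] using e₂

end Run

/-! ### The number of queries and the time -/

section Bounds

variable {n d : ℕ} {Q : List (Assignment n)}

/-- Each query lowers the excess by at least one. This crude bound keeps the loops over the queries
below the cut-off. -/
theorem IsGreedy.length_add_le (h : IsGreedy d Q) :
    Q.length + totalExcess d Q ≤ totalExcess d ([] : List (Assignment n)) := by
  induction h with
  | nil => simp
  | append _ hg _ ih =>
    rename_i Q y _ _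
    have := totalExcess_append (d := d) Q y
    simp only [List.length_append, List.length_singleton]
    omega

/-- Every query of a greedy list reduces the excess by a constant factor. -/
theorem IsGreedy.excess_le (h : IsGreedy d Q) :
    (totalExcess d Q : ℝ) ≤
      totalExcess d ([] : List (Assignment n)) * Real.exp (-(Q.length / (2 * 2 ^ d))) ∧
    (Q.length : ℝ) ≤ 2 * 2 ^ d * Real.log (totalExcess d ([] : List (Assignment n))) + 1 := by
  have hK : (0 : ℝ) < 2 * 2 ^ d := by positivity
  induction h with
  | nil =>
    refine ⟨by simp, ?_⟩
    have := Real.log_natCast_nonneg (totalExcess d ([] : List (Assignment n)))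
    simp only [List.length_nil, Nat.cast_zero]
    positivity
  | append _ hg hle ih =>
    rename_i Q y _
    have hadd : (totalExcess d (Q ++ [y]) : ℝ) + gain d Q y = totalExcess d Q := by
      exact_mod_cast totalExcess_append (d := d) Q y
    have hle' : (totalExcess d Q : ℝ) ≤ 2 * 2 ^ d * gain d Q y := by exact_mod_cast hle
    have hg' : (1 : ℝ) ≤ gain d Q y := by exact_mod_cast Nat.one_le_iff_ne_zero.2 hg
    -- The excess before the last query is at least 1, since that query has a gain. Compared with
    -- the exponential decay, this bounds the number of the earlier queries; the last one is the `+
    -- 1`.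
    have hT : (1 : ℝ) ≤ totalExcess d Q := by
      have : (0 : ℝ) ≤ totalExcess d (Q ++ [y]) := Nat.cast_nonneg _
      linarith
    obtain ⟨ih1, -⟩ := ih
    constructor
    · have h1 : (totalExcess d (Q ++ [y]) : ℝ) ≤ totalExcess d Q * (1 - 1 / (2 * 2 ^ d)) := by
        have : (totalExcess d Q : ℝ) / (2 * 2 ^ d) ≤ gain d Q y := by
          rw [div_le_iff₀ hK]; linarith
        rw [mul_sub, mul_one, mul_one_div]
        linarith
      have h2 : (1 : ℝ) - 1 / (2 * 2 ^ d) ≤ Real.exp (-(1 / (2 * 2 ^ d))) := by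
        have := Real.add_one_le_exp (-(1 / (2 * 2 ^ d) : ℝ))
        linarith
      calc (totalExcess d (Q ++ [y]) : ℝ) ≤ totalExcess d Q * (1 - 1 / (2 * 2 ^ d)) := h1
        _ ≤ totalExcess d Q * Real.exp (-(1 / (2 * 2 ^ d))) :=
            mul_le_mul_of_nonneg_left h2 (Nat.cast_nonneg _)
        _ ≤ _ * Real.exp (-(Q.length / (2 * 2 ^ d))) * Real.exp (-(1 / (2 * 2 ^ d))) :=
            mul_le_mul_of_nonneg_right ih1 (Real.exp_pos _).le
        _ = _ := by
            rw [mul_assoc, ← Real.exp_add]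
            congr 2
            simp only [List.length_append, List.length_singleton, Nat.cast_add, Nat.cast_one]
            ring
    · have h1 : Real.exp (Q.length / (2 * 2 ^ d)) ≤
          totalExcess d ([] : List (Assignment n)) := by
        have h2 := hT.trans ih1
        rw [Real.exp_neg, ← div_eq_mul_inv, le_div_iff₀ (Real.exp_pos _), one_mul] at h2
        exact h2
      have h2 := Real.log_le_log (Real.exp_pos _) h1
      rw [Real.log_exp, div_le_iff₀ hK] at h2
      simp only [List.length_append, List.length_singleton, Nat.cast_add, Nat.cast_one]
      linarith

theorem IsGreedy.length_le (hn : 2 ≤ n) (hd : 1 ≤ d) (h : IsGreedy d Q) :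
    (Q.length : ℝ) ≤ 10 * (d * 2 ^ d * Real.log n) := by
  have hlogn : Real.log 2 ≤ Real.log n :=
    Real.log_le_log (by norm_num) (by exact_mod_cast hn)
  have hlog2 := Real.log_two_gt_d9
  have hlog : Real.log (totalExcess d ([] : List (Assignment n))) ≤ 4 * d * Real.log n := by
    -- Without initial excess the logarithm takes the default value `Real.log 0 = 0`.
    rcases Nat.eq_zero_or_pos (totalExcess d ([] : List (Assignment n))) with h0 | h0
    · rw [h0]; simp only [Nat.cast_zero, Real.log_zero]; positivity
    · have h1 : (totalExcess d ([] : List (Assignment n)) : ℝ) ≤ (n : ℝ) ^ (4 * d) := by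
        rw [pow_mul]; exact_mod_cast totalExcess_nil_le hn hd
      have h2 := Real.log_le_log (by exact_mod_cast h0) h1
      rw [Real.log_pow] at h2
      exact_mod_cast h2
  have h1 : (1 : ℝ) ≤ d := by exact_mod_cast hd
  have h2 : (2 : ℝ) ≤ 2 ^ d := by
    calc (2 : ℝ) = 2 ^ 1 := by norm_num
      _ ≤ 2 ^ d := pow_le_pow_right₀ (by norm_num) hd
  have h3 : (2 : ℝ) ≤ d * 2 ^ d := by nlinarith
  -- The product is at least `2 * Real.log 2 > 1`, so it absorbs the additive 1.
  have h4 : (1 : ℝ) ≤ d * 2 ^ d * Real.log n := by nlinarith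
  calc (Q.length : ℝ) ≤ 2 * 2 ^ d * Real.log (totalExcess d ([] : List (Assignment n))) + 1 :=
        h.excess_le.2
    _ ≤ 2 * 2 ^ d * (4 * d * Real.log n) + 1 := by
        gcongr
    _ = 8 * (d * 2 ^ d * Real.log n) + 1 := by ring
    _ ≤ _ := by linarith

/-- The summands are the bounds for writing down the queries, for asking them and for inferring. All
are polynomial in `loopBound n d`, and `loopBound n d + 2 ≤ n ^ (5 * d)`. -/
theorem exists_time_bound : ∃ C, ∀ n d : ℕ, 2 ≤ n → 1 ≤ d →
    (Cmd.powers.cost n + (Cmd.seq .tables .select).cost (loopBound n d) + 4) +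
      loopBound n d * loopBound n d + Cmd.infer.cost (loopBound n d) ≤ n ^ (C * d) := by
  obtain ⟨A, hA⟩ := Cmd.powers.polyBounded_cost
  -- The cost of `powers` at `n` is passed to the larger `loopBound n d` through its polynomial
  -- bound, which is monotone.
  have hmono : PolyBounded fun N => (N + 2) ^ A := ⟨A, fun N => le_rfl⟩
  obtain ⟨C, hC⟩ := (((hmono.add (Cmd.seq .tables .select).polyBounded_cost).add (.const 4)).add
    (PolyBounded.id.mul .id)).add Cmd.infer.polyBounded_cost
  refine ⟨5 * C, fun n d hn hd => ?_⟩
  have hN := le_loopBound hn hd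
  have h1 : Cmd.powers.cost n ≤ (loopBound n d + 2) ^ A :=
    (hA n).trans (Nat.pow_le_pow_left (by omega) A)
  have h2 : loopBound n d + 2 ≤ n ^ (5 * d) := by
    calc loopBound n d + 2 ≤ 2 * loopBound n d := by omega
      _ ≤ n ^ d * loopBound n d :=
          Nat.mul_le_mul_right _ (hn.trans (Nat.le_self_pow (by omega) n))
      _ = n ^ (5 * d) := by rw [loopBound, ← pow_mul, ← pow_add]; congr 1; ring
  calc _ ≤ (loopBound n d + 2) ^ C := le_trans (by simp only; omega) (hC (loopBound n d))
    _ ≤ (n ^ (5 * d)) ^ C := Nat.pow_le_pow_left h2 C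
    _ = n ^ (5 * C * d) := by rw [← pow_mul]; congr 1; ring

end Bounds

/-- The queries are fixed before the target is, so their number `m` is chosen uniformly in `f`. -/
theorem learner_learns {n d : ℕ} (hn : 2 ≤ n) (hd : 1 ≤ d) (hdn : d ≤ n) :
    ∃ m : ℕ, (m : ℝ) ≤ 10 * (d * 2 ^ d * Real.log n) ∧ ∀ f ∈ Junta n d, learner.Learns n d f m
      ((Cmd.powers.cost n + (Cmd.seq .tables .select).cost (loopBound n d) + 4) +
        loopBound n d * loopBound n d + Cmd.infer.cost (loopBound n d)) := by
  obtain ⟨t₁, s₁, Q, e₁, c₁, b₁, hlen, hq, hgr, hex⟩ := exec_ask hn hd hdn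
  refine ⟨Q.length, hgr.length_le hn hd, fun f hf => ?_⟩
  have hQN : Q.length ≤ loopBound n d := by
    have := hgr.length_add_le
    have := totalExcess_nil_le hn hd
    omega
  have hans : HasAnswers n d f Q (s₁.withAnswers f) := by
    refine ⟨⟨hn, hd, hdn, b₁.reg_zero, b₁.reg_one, b₁.reg_four, b₁.reg_five, b₁.reg_six, ?_, ?_⟩,
      hlen, hQN, ?_, ?_⟩
    · intro j hj; simp [Memory.withAnswers, b₁.pow_n j hj]
    · intro j hj; simp [Memory.withAnswers, b₁.pow_two j hj]
    · intro q x hqx i; simp [Memory.withAnswers, hq q x hqx i]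
    · intro q x hqx
      have hql : q < Q.length := (List.getElem?_eq_some_iff.1 hqx).1
      have hquery : s₁.query n q = x := by
        funext i
        rw [Memory.query, hq q x hqx i]
        cases x i <;> rfl
      simp [Memory.withAnswers, Memory.numQueries, hlen, hql, hquery]
  obtain ⟨t₂, s₂, e₂, g₂, c₂⟩ := Cmd.exec_compile Cmd.infer 40 (s₁.withAnswers f) (by norm_num)
    (by decide) hans.base.reg_four
  refine ⟨t₁, t₂, s₁, s₂, e₁, e₂, describes_of_agree (by norm_num) g₂ (hans.describes hex hf),
    hlen.le, ?_⟩
  have : s₁.numQueries * n ≤ loopBound n d * loopBound n d :=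
    Nat.mul_le_mul (hlen.le.trans hQN) (le_loopBound hn hd)
  omega

end JuntaLearning

/-- There is a deterministic non-adaptive algorithm that learns `d`-Junta in time `n ^ O(d)` with
`O(d * 2 ^ d * log n)` queries. -/
theorem theorem2 :
    ∃ (A : JuntaLearning.NonadaptiveAlgorithm) (c : ℕ),
      ∀ n d : ℕ, 2 ≤ n → 1 ≤ d → d ≤ n →
        ∃ m : ℕ, (m : ℝ) ≤ c * (d * 2 ^ d * Real.log n) ∧
          ∀ f ∈ JuntaLearning.Junta n d, A.Learns n d f m (n ^ (c * d)) := by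
  obtain ⟨C, hC⟩ := JuntaLearning.exists_time_bound
  refine ⟨JuntaLearning.learner, max 10 C, fun n d hn hd hdn => ?_⟩
  obtain ⟨m, hm, hlearn⟩ := JuntaLearning.learner_learns hn hd hdn
  refine ⟨m, hm.trans ?_, fun f hf => ?_⟩
  · have : (10 : ℝ) ≤ (max 10 C : ℕ) := by exact_mod_cast le_max_left 10 C
    have hlog : 0 ≤ Real.log n := Real.log_natCast_nonneg n
    gcongr
  · obtain ⟨t₁, t₂, s₁, s₂, h1, h2, h3, h4, h5⟩ := hlearn f hf
    exact ⟨t₁, t₂, s₁, s₂, h1, h2, h3, h4, h5.trans ((hC n d hn hd).trans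
      (Nat.pow_le_pow_right (by omega) (Nat.mul_le_mul_right d (le_max_right 10 C))))⟩
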